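/- Let $X=(X_t)_{t\ge 0}$ be an affine process (a càdlàg, conservative, stochastically continuous, time-homogeneous Markov process under laws $(\mathbb P^x)_{x\in D}$ on a space with right-continuous filtration, such that $\mathbb E^x[e^{\langle u,X_t\rangle}]=\exp(\phi(t,u)+\langle\psi(t,u),x\rangle)$ for all $t\ge 0$, $x\in D$ and all $u\in\mathbb C^d$ for which $x\mapsto e^{\langle u,x\rangle}$ is bounded on $D$, for some functions $\phi,\psi$) with state space $D\subset\mathbb R^d$ and differential semimartingale characteristics $(a(x),b(x),K(x,d\xi))$ relative to $h(\xi)=\xi 1_{\{|\xi|\le 1\}}$. These depend affinely on $x\in D$; $a(x)$ is a positive semidefinite matrix, $b(x)\in\mathbb R^d$ and $K(x,d\xi)$ is a Lévy measure. Assume that, in suitable linear coordinates of $\mathbb R^d$, either (i) $D=\mathbb R_{\ge 0}^m\times\mathbb R^n$ for some $m,n$, or (ii) $D=S_k^+$, the cone of positive semidefinite real symmetric $k\times k$ matrices, and there is a positive definite $x\in S_k^{++}$ such that $a(x)$ is either zero or non-degenerate. Let $\mathcal Y=\bigcap_{x\in D}\{y\in\mathbb R^d:\int_{|\xi|\ge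 1}e^{\langle y,\xi\rangle}K(x,d\xi)<\infty\}$, let $\mathcal Y^\circ$ be its interior, and let $S(\mathcal Y^\circ)=\{u\in\mathbb C^d:\operatorname{Re}u\in\mathcal Y^\circ\}$. For $u\in\mathcal Y\cup S(\mathcal Y^\circ)$ define $F(u)$ and $R(u)$ by $$F(u)+\langle R(u),x\rangle=\tfrac12\langle u,a(x)u\rangle+\langle b(x),u\rangle+\int_{\mathbb R^d\setminus\{0\}}\bigl(e^{\langle\xi,u\rangle}-1-\langle h(\xi),u\rangle\bigr)K(x,d\xi)\qquad\text{for all }x\in D,$$ where $\langle\cdot,\cdot\rangle$ is extended complex-bilinearly. For $y\in\mathcal Y^\circ$ let $T_+(y)\in[0,\infty]$ be the maximal lifetime of the $\mathcal{C}^1$ solution $(p,q)$, with values in $\mathbb R\times\mathcal Y^\circ$, of the extended Riccati system $\partial_tp=F(q)$, $p(0)=0$, $\partial_tq=R(q)$, $q(0)=y$, i.e. the supremum of all $T\ge 0$ such that such a solution exists on $[0,T]$. For $u\in S(\mathcal Y^\circ)$ let $T_+(u)\in[0,\infty]$ be the maximal lifetime, in the same sense, of the $\mathcal{C}^1$ solution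 $(\phi,\psi)$, with values in $\mathbb C\times S(\mathcal Y^\circ)$, of the complex Riccati system $\partial_t\phi=F(\psi)$, $\phi(0)=0$, $\partial_t\psi=R(\psi)$, $\psi(0)=u$. Then for every $u\in S(\mathcal Y^\circ)$, with $y=\operatorname{Re}u$, one has $T_+(u)\ge T_+(y)$, where $T_+(y)$ refers to the extended (real) Riccati system and $T_+(u)$ to the complex one. -/

import Mathlib

open MeasureTheory ProbabilityTheory Filter Topology Set
open scoped NNReal ENNReal BoundedContinuousFunction

noncomputable section

namespace AffineMoments

/-- The space `ℝ^d` with its Euclidean inner product. -/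
abbrev RVec (d : ℕ) : Type := EuclideanSpace ℝ (Fin d)

/-- The space `ℂ^d`. -/
abbrev CVec (d : ℕ) : Type := EuclideanSpace ℂ (Fin d)

/-- The bilinear pairing `⟨u, x⟩ = ∑ i, u i * x i` of `u ∈ ℂ^d` with `x ∈ ℝ^d`. -/
def cpair {d : ℕ} (u : CVec d) (x : RVec d) : ℂ := ∑ i, u i * ((x i : ℝ) : ℂ)

/-- The componentwise real part of a complex vector. -/
def rePart {d : ℕ} (u : CVec d) : RVec d := WithLp.toLp 2 (fun i => (u i).re)

/-- The complex strip `S(A) = {u ∈ ℂ^d : Re u ∈ A}`. -/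
def strip {d : ℕ} (A : Set (RVec d)) : Set (CVec d) := {u | rePart u ∈ A}

/-- The truncation function `h(ξ) = 1_{|ξ| ≤ 1} ξ`. -/
def trunc {d : ℕ} (ξ : RVec d) : RVec d :=
  (Metric.closedBall (0 : RVec d) 1).indicator (fun ζ => ζ) ξ

/-- The set `𝒰` of those `u ∈ ℂ^d` for which `x ↦ exp ⟨u, x⟩` is bounded on `D`. -/
def boundedExponents {d : ℕ} (D : Set (RVec d)) : Set (CVec d) :=
  {u | ∃ C : ℝ, ∀ x ∈ D, ‖Complex.exp (cpair u x)‖ ≤ C}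

/-- An affine process with state space `D`: a càdlàg, adapted, conservative, time-homogeneous Markov
process `X` under a family of laws `ℙ^x`, `x ∈ D`, on a space with right-continuous filtration, whose
transition kernels `p_t(x, A) = ℙ^x(X_t ∈ A)` are stochastically continuous and have characteristic
function of exponentially affine form in the starting point. -/
structure AffineProcess {d : ℕ} (D : Set (RVec d)) (Ω : Type*) [mΩ : MeasurableSpace Ω] where
  /-- the filtration -/
  ℱ : Filtration ℝ≥0 mΩ
  rightCont : ℱ.IsRightContinuous
  /-- the laws -/
  P : D → Measure Ω
  isProb : ∀ x, IsProbabilityMeasure (P x)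
  /-- the process -/
  X : ℝ≥0 → Ω → D
  adapted : ∀ t, Measurable[ℱ t] (X t)
  right_continuous : ∀ ω t, ContinuousWithinAt (fun s => (X s ω : RVec d)) (Ici t) t
  left_limits : ∀ ω t, ∃ l : RVec d, Tendsto (fun s => (X s ω : RVec d)) (𝓝[<] t) (𝓝 l)
  measurable_kernel : ∀ (t : ℝ≥0) (A : Set D), MeasurableSet A →
    Measurable (fun x => P x (X t ⁻¹' A))
  start : ∀ x, P x (X 0 ⁻¹' {x}) = 1
  /-- `ℙ^x(X_{s+t} ∈ A | ℱ_s) = p_t(X_s, A)` almost surely -/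
  markov : ∀ (x : D) (s t : ℝ≥0) (A : Set D), MeasurableSet A →
    (P x)[(X (s + t) ⁻¹' A).indicator (fun _ => (1 : ℝ)) | ℱ s]
      =ᵐ[P x] fun ω => (P (X s ω)).real (X t ⁻¹' A)
  /-- `p_s(x, ·) → p_t(x, ·)` weakly as `s → t` -/
  stochCont : ∀ (x : D) (t : ℝ≥0) (f : D →ᵇ ℝ),
    Tendsto (fun s => ∫ ω, f (X s ω) ∂(P x)) (𝓝 t) (𝓝 (∫ ω, f (X t ω) ∂(P x)))
  affine : ∃ (φ : ℝ≥0 → CVec d → ℂ) (ψ : ℝ≥0 → CVec d → CVec d),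
    ∀ (t : ℝ≥0) (x : D), ∀ u ∈ boundedExponents D,
      ∫ ω, Complex.exp (cpair u (X t ω)) ∂(P x) = Complex.exp (φ t u + cpair (ψ t u) x)

/-- A triplet `(a(x), b(x), K(x, dξ))` depending in an affine way on the state `x ∈ D`, consisting for
each `x ∈ D` of a positive semidefinite matrix, a vector and a Lévy measure. For `a` and `b` affine
dependence is expressed by affine maps on `ℝ^d`; for the measures `K(x, ·)` it is expressed through
convex combinations of points of the (convex) state space. -/
structure AffineTriplet {d : ℕ} (D : Set (RVec d)) where
  /-- diffusion matrix -/
  a : RVec d →ᵃ[ℝ] Matrix (Fin d) (Fin d) ℝ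
  /-- drift -/
  b : RVec d →ᵃ[ℝ] RVec d
  /-- jump measure (only its values at `x ∈ D` matter) -/
  K : RVec d → Measure (RVec d)
  a_posSemidef : ∀ x ∈ D, (a x).PosSemidef
  K_zero : ∀ x ∈ D, K x {0} = 0
  K_integrable : ∀ x ∈ D, ∫⁻ ξ, ENNReal.ofReal (min (‖ξ‖ ^ 2) 1) ∂(K x) < ⊤
  K_affine : ∀ x ∈ D, ∀ y ∈ D, ∀ s : ℝ, 0 ≤ s → s ≤ 1 →
    K (s • x + (1 - s) • y) = ENNReal.ofReal s • K x + ENNReal.ofReal (1 - s) • K y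

namespace AffineTriplet

variable {d : ℕ} {D : Set (RVec d)} (χ : AffineTriplet D)

/-- The integro-differential operator with coefficients `(a(x), b(x), K(x, dξ))`, on `C²` functions. -/
def generator (f : RVec d → ℝ) (x : RVec d) : ℝ :=
  (1 / 2 : ℝ) * ∑ i, ∑ j, χ.a x i j *
      fderiv ℝ (fderiv ℝ f) x (EuclideanSpace.single i 1) (EuclideanSpace.single j 1)
    + fderiv ℝ f x (χ.b x)
    + ∫ ξ, (f (x + ξ) - f x - fderiv ℝ f x (trunc ξ)) ∂(χ.K x)

/-- The triplet gives the differential semimartingale characteristics (relative to the truncation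
function `trunc`) of the affine process: for every starting point `x` and every bounded `C²` function
`f`, the process `f(X_t) - f(X_0) - ∫_0^t (generator f)(X_s) ds` is a local martingale under `ℙ^x`.
(This is the martingale-problem form of the definition of the characteristics
`A_t = ∫_0^t a(X_{s-}) ds`, `B_t = ∫_0^t b(X_{s-}) ds`, `ν(dt, dξ) = K(X_{t-}, dξ) dt`.) -/
def IsCharacteristicsOf {Ω : Type*} [MeasurableSpace Ω] (Z : AffineProcess D Ω) : Prop :=
  ∀ (x : D) (f : RVec d → ℝ), ContDiff ℝ 2 f → (∃ C : ℝ, ∀ z, |f z| ≤ C) →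
    Locally (fun Y : ℝ≥0 → Ω → ℝ => Martingale Y Z.ℱ (Z.P x)) Z.ℱ
      (fun (t : ℝ≥0) (ω : Ω) => f (Z.X t ω) - f (Z.X 0 ω)
        - ∫ s in (0 : ℝ)..(t : ℝ), χ.generator f (Z.X s.toNNReal ω)) (Z.P x)

/-- The set `𝒴` of those `y` for which all jump measures `K(x, ·)`, `x ∈ D`, have a finite exponential
moment of order `y` away from the origin. -/
def expDomain : Set (RVec d) :=
  {y | ∀ x ∈ D, ∫⁻ ξ in {ξ : RVec d | 1 ≤ ‖ξ‖}, ENNReal.ofReal (Real.exp (inner ℝ y ξ)) ∂(χ.K x) < ⊤}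

/-- The Lévy–Khintchine function `ℛ_x(y)` for real `y`. -/
def realRx (x y : RVec d) : ℝ :=
  (1 / 2 : ℝ) * ∑ i, ∑ j, y i * χ.a x i j * y j + inner ℝ (χ.b x) y
    + ∫ ξ, (Real.exp (inner ℝ ξ y) - 1 - inner ℝ (trunc ξ) y) ∂(χ.K x)

/-- The function `F` on `𝒴`, i.e. `ℛ_x` at `x = 0`. -/
def realF (y : RVec d) : ℝ := χ.realRx 0 y

/-- The function `R` on `𝒴`: the vector `R(y)` with `ℛ_x(y) = F(y) + ⟨R(y), x⟩` for all `x ∈ D`. -/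
def realR (y : RVec d) : RVec d :=
  Classical.epsilon (fun v : RVec d => ∀ x ∈ D, χ.realRx x y = χ.realF y + inner ℝ v x)

/-- The analytic extension of `ℛ_x` to the complex strip over the interior of `𝒴`. -/
def complexRx (x : RVec d) (u : CVec d) : ℂ :=
  (1 / 2 : ℂ) * ∑ i, ∑ j, u i * ((χ.a x i j : ℝ) : ℂ) * u j + cpair u (χ.b x)
    + ∫ ξ, (Complex.exp (cpair u ξ) - 1 - cpair u (trunc ξ)) ∂(χ.K x)

/-- The analytic extension of `F`. -/
def complexF (u : CVec d) : ℂ := χ.complexRx 0 u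

/-- The analytic extension of `R`: the vector `R(u)` with `ℛ_x(u) = F(u) + ⟨R(u), x⟩` for `x ∈ D`. -/
def complexR (u : CVec d) : CVec d :=
  Classical.epsilon (fun v : CVec d => ∀ x ∈ D, χ.complexRx x u = χ.complexF u + cpair v x)

/-- `(p, q)` is a solution of the extended Riccati system up to time `T`, starting at `y`. -/
structure IsExtendedRiccatiSolution (T : ℝ) (y : RVec d) (p : ℝ → ℝ) (q : ℝ → RVec d) : Prop where
  p_C1 : ContDiffOn ℝ 1 p (Icc 0 T)
  q_C1 : ContDiffOn ℝ 1 q (Icc 0 T)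
  q_mem : ∀ t ∈ Icc 0 T, q t ∈ χ.expDomain
  p_zero : p 0 = 0
  q_zero : q 0 = y
  p_deriv : ∀ t ∈ Icc 0 T, HasDerivWithinAt p (χ.realF (q t)) (Icc 0 T) t
  q_deriv : ∀ t ∈ Icc 0 T, HasDerivWithinAt q (χ.realR (q t)) (Icc 0 T) t

/-- `(φ, ψ)` is a solution of the complex Riccati system up to time `T`, starting at `u`. -/
structure IsComplexRiccatiSolution (T : ℝ) (u : CVec d) (φ : ℝ → ℂ) (ψ : ℝ → CVec d) : Prop where
  φ_C1 : ContDiffOn ℝ 1 φ (Icc 0 T)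
  ψ_C1 : ContDiffOn ℝ 1 ψ (Icc 0 T)
  ψ_mem : ∀ t ∈ Icc 0 T, ψ t ∈ strip (interior χ.expDomain)
  φ_zero : φ 0 = 0
  ψ_zero : ψ 0 = u
  φ_deriv : ∀ t ∈ Icc 0 T, HasDerivWithinAt φ (χ.complexF (ψ t)) (Icc 0 T) t
  ψ_deriv : ∀ t ∈ Icc 0 T, HasDerivWithinAt ψ (χ.complexR (ψ t)) (Icc 0 T) t

/-- Maximal lifetime `T_+(y) ∈ [0, ∞]` of the solution of the extended Riccati system with values in
the interior of `𝒴` (where the solution is unique) starting at `y`. -/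
def realLifetime (y : RVec d) : ℝ≥0∞ :=
  ⨆ (T : ℝ≥0) (_ : ∃ (p : ℝ → ℝ) (q : ℝ → RVec d), χ.IsExtendedRiccatiSolution T y p q ∧
    ∀ t ∈ Icc (0 : ℝ) T, q t ∈ interior χ.expDomain), (T : ℝ≥0∞)

/-- Maximal lifetime `T_+(u) ∈ [0, ∞]` of the solution of the complex Riccati system from `u`. -/
def complexLifetime (u : CVec d) : ℝ≥0∞ :=
  ⨆ (T : ℝ≥0) (_ : ∃ (φ : ℝ → ℂ) (ψ : ℝ → CVec d), χ.IsComplexRiccatiSolution T u φ ψ), (T : ℝ≥0∞)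

end AffineTriplet

/-- The space `S_k` of real symmetric `k × k` matrices. -/
def symMatrices (k : ℕ) : Submodule ℝ (Matrix (Fin k) (Fin k) ℝ) where
  carrier := {A | A.IsSymm}
  add_mem' := fun hA hB => hA.add hB
  zero_mem' := Matrix.isSymm_zero
  smul_mem' := fun c _ hA => hA.smul c

/-- `D` is the canonical state space `ℝ_{≥0}^m × ℝ^n`, in some linear coordinates of `ℝ^d`. -/
def IsCanonicalStateSpace {d : ℕ} (D : Set (RVec d)) : Prop :=
  ∃ (m n : ℕ) (e : RVec d ≃ₗ[ℝ] (Fin m → ℝ) × (Fin n → ℝ)), D = {x | ∀ i, 0 ≤ (e x).1 i}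

/-- `D` is the cone `S_k^+` of positive semidefinite matrices, under some linear identification of
`ℝ^d` with `S_k`, and at some point `x ∈ S_k^{++}` the diffusion matrix `a(x)` either vanishes or is
non-degenerate. -/
def IsMatrixStateSpace {d : ℕ} {D : Set (RVec d)} (χ : AffineTriplet D) : Prop :=
  ∃ (k : ℕ) (e : RVec d ≃ₗ[ℝ] symMatrices k),
    D = {x | (e x : Matrix (Fin k) (Fin k) ℝ).PosSemidef} ∧
    ∃ x, (e x : Matrix (Fin k) (Fin k) ℝ).PosDef ∧ (χ.a x = 0 ∨ (χ.a x).det ≠ 0)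

end AffineMoments

end

/-! Both state spaces are closed convex cones `C`, and vectors are ordered by the dual cone: y ≤ y'
when y' - y is nonnegative on `C`. Let q solve the real system from Re u on [0, T] inside 𝒴°, and
let ψ solve the complex one from u. As long as ψ exists, Re ψ ≤ q. Indeed ⟨Re R(ψ), x⟩ ≤ ⟨R(Re ψ),
x⟩ on `C`, since Re e^w ≤ |e^w| and the diffusion is nonnegative (`inner_rePart_complexR_le`), and R
is quasi-monotone (`inner_realR_le_of_le`), so the comparison principle
`sub_mem_innerDual_of_quasimonotone` applies. The jumps lie in `C`, hence 𝒴° is closed downwards and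
ψ cannot leave S(𝒴°) through its boundary. Only explosion of the norm remains, and
`realLifetime_le_complexLifetime` reduces the theorem to an a priori bound for ‖ψ‖.

All geometric input comes from the positive maximum principle, which `generator_nonpos_of_nonneg`
extracts from the martingale problem. Bumps off the cone show that jumps stay in `C`; differences of
exponentials give quasi-monotonicity; exponentials in direction -s y, with y normal to the cone at x
and s growing, show that a(x) annihilates y and that the jumps have finite variation along y. Along
lines contained in `C` only the drift varies.

The a priori bound is Grönwall's inequality for a quadratic Lyapunov function, although R itself may
grow faster than linearly. On the canonical space the components of ψ along the lines solve a linear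
equation. For a half-line component c, the superlinear terms are c² and ∫(e^{cs} - 1 - cs);
multiplied by the conjugate of c they have real part O(|c|²), because Re c is bounded above
(`re_conj_mul_axis_le`).

On positive semidefinite matrices of size at least two the jumps have finite variation
(`integrable_norm_trunc`) and contribute linear growth. If a(x₀) = 0 for a positive definite x₀, the
diffusion vanishes everywhere. If a(x₀) is nondegenerate, `exists_diffusion_matrix` identifies the
quadratic part of R as u ↦ ½ u N u with N positive semidefinite. The energy given by a(x₀) on Re u
and Im u is then a Lyapunov function: with V = Re u and W = Im u the mixed cubic terms cancel, and
the others are controlled by NVN ≤ cN, which holds because V is bounded above by q. Size at most one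
is a canonical case. -/

namespace AffineMoments

/-! ### Comparison of differential inequalities in the order of a dual cone. -/

section Comparison

variable {E : Type*} [NormedAddCommGroup E] [InnerProductSpace ℝ E] [CompleteSpace E]

/-- Moreau's decomposition with respect to the dual of a proper cone. -/
theorem exists_moreau_decomposition (C : ProperCone ℝ E) (w : E) :
    ∃ p ∈ ProperCone.innerDual (C : Set E), ∃ x ∈ C, w = p - x ∧ inner ℝ p x = 0 ∧
      Metric.infDist w (ProperCone.innerDual (C : Set E) : Set E) = ‖x‖ := by
  set K := ProperCone.innerDual (C : Set E) with hK
  -- The decomposition comes from the metric projection p of w onto the dual cone. The variational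
  -- inequality at 0 and 2p gives ⟨w - p, p⟩ = 0; at all other elements it puts p - w into the
  -- bidual, which is `C`.
  obtain ⟨p, hp, hmin⟩ := exists_norm_eq_iInf_of_complete_convex K.nonempty
    K.isClosed.isComplete K.convex w
  have hvar := (norm_eq_iInf_iff_real_inner_le_zero K.convex hp).1 hmin
  have h0 : inner ℝ (w - p) p = 0 := by
    have h1 := hvar 0 (K.zero_mem)
    have h2 := hvar (p + p) (K.add_mem hp hp)
    simp only [zero_sub, inner_neg_right, add_sub_cancel_right] at h1 h2
    linarith
  have hle : ∀ c ∈ K, inner ℝ (w - p) c ≤ 0 := by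
    intro c hc
    have := hvar c hc
    rw [inner_sub_right, h0] at this
    linarith
  have hx : p - w ∈ C := by
    have : p - w ∈ ProperCone.innerDual (K : Set E) := by
      rw [ProperCone.mem_innerDual]
      intro c hc
      have := hle c hc
      rw [real_inner_comm, ← neg_sub w p, inner_neg_left]
      linarith
    rwa [hK, ProperCone.innerDual_innerDual] at this
  refine ⟨p, hp, p - w, hx, by abel, ?_, ?_⟩
  · rw [real_inner_comm, ← neg_sub w p, inner_neg_left, h0, neg_zero]
  · rw [Metric.infDist_eq_iInf, norm_sub_rev, hmin]
    simp_rw [dist_eq_norm]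

/-- Comparison principle for ordinary differential inequalities with a vector field that is
quasi-monotone with respect to the dual of a proper cone. -/
theorem sub_mem_innerDual_of_quasimonotone (C : ProperCone ℝ E) {O : Set E} (hO : IsOpen O)
    {R : E → E} (hR : LocallyLipschitzOn O R)
    (hmono : ∀ y, ∀ y' ∈ O, y' - y ∈ ProperCone.innerDual (C : Set E) → ∀ x ∈ C,
      inner ℝ (y' - y) x = 0 → inner ℝ (R y) x ≤ inner ℝ (R y') x)
    {T : ℝ} {q v v' : ℝ → E} (hqO : ∀ t ∈ Icc 0 T, q t ∈ O)
    (hq : ∀ t ∈ Icc 0 T, HasDerivWithinAt q (R (q t)) (Icc 0 T) t)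
    (hv : ∀ t ∈ Icc 0 T, HasDerivWithinAt v (v' t) (Icc 0 T) t)
    (hle : ∀ t ∈ Icc 0 T, ∀ x ∈ C, inner ℝ (v' t) x ≤ inner ℝ (R (v t)) x)
    (h0 : q 0 - v 0 ∈ ProperCone.innerDual (C : Set E)) :
    ∀ t ∈ Icc 0 T, q t - v t ∈ ProperCone.innerDual (C : Set E) := by
  set K := ProperCone.innerDual (C : Set E) with hK
  set m : ℝ → ℝ := fun t => Metric.infDist (q t - v t) (K : Set E) with hm
  have hmem : ∀ t, q t - v t ∈ K ↔ m t = 0 := fun t =>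
    (K.isClosed.mem_iff_infDist_zero K.nonempty)
  have hqc : ContinuousOn q (Icc 0 T) := fun t ht => (hq t ht).continuousWithinAt
  have hvc : ContinuousOn v (Icc 0 T) := fun t ht => (hv t ht).continuousWithinAt
  have hmc : ContinuousOn m (Icc 0 T) :=
    (Metric.continuous_infDist_pt _).comp_continuousOn (hqc.sub hvc)
  -- The zero set of the distance m is closed in [0, T] and contains 0, so it suffices to extend it
  -- to the right of each of its points s < T.
  suffices Icc 0 T ⊆ {t | m t = 0} from fun t ht => (hmem t).2 (this ht)
  apply IsClosed.Icc_subset_of_forall_mem_nhdsWithin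
  · rw [inter_comm]
    exact hmc.preimage_isClosed_of_isClosed isClosed_Icc (isClosed_singleton (x := (0:ℝ)))
  · exact (hmem 0).1 h0
  rintro s ⟨hs0, hs⟩
  have hs0 : m s = 0 := hs0
  have hsI : s ∈ Icc 0 T := ⟨hs.1, hs.2.le⟩
  obtain ⟨L, N, hN, hL⟩ := hR (hqO s hsI)
  rw [hO.nhdsWithin_eq (hqO s hsI)] at hN
  obtain ⟨ε, hε, hεN⟩ := Metric.mem_nhds_iff.1 (inter_mem hN (hO.mem_nhds (hqO s hsI)))
  -- Two margins of ε / 2 keep both q t and its perturbation by a vector of norm m t in the region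
  -- where R is Lipschitz.
  have hev : ∀ᶠ t in 𝓝[Icc 0 T] s, dist (q t) (q s) < ε / 2 ∧ m t < ε / 2 := by
    refine ((hqc s hsI).eventually (Metric.ball_mem_nhds _ (half_pos hε))).and ?_
    exact (hmc s hsI).eventually (gt_mem_nhds (by rw [hs0]; exact half_pos hε))
  obtain ⟨η, hη, hηT, hgood⟩ : ∃ η > s, η ≤ T ∧ ∀ t ∈ Icc s η,
      dist (q t) (q s) < ε / 2 ∧ m t < ε / 2 := by
    rw [Metric.nhdsWithin_basis_ball.eventually_iff] at hev
    obtain ⟨r, hr, h⟩ := hev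
    refine ⟨min T (s + r / 2), lt_min hs.2 (by linarith), min_le_left _ _, fun t ht => h ⟨?_, ?_⟩⟩
    · rw [Metric.mem_ball, Real.dist_eq, abs_of_nonneg (by linarith [ht.1])]
      linarith [ht.2.trans (min_le_right _ _)]
    · exact ⟨hs.1.trans ht.1, ht.2.trans (min_le_left _ _)⟩
  have hsub : Icc s η ⊆ Icc 0 T := Icc_subset_Icc hs.1 hηT
  choose p hp x hx hpx hinner hdist using fun t => exists_moreau_decomposition C (q t - v t)
  -- Grönwall for m² with initial value zero. With the projection p t frozen, m z ≤ ‖q z - v z - p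
  -- t‖ with equality at z = t, so the derivative of the smooth square bounds the upper right slope
  -- of m².
  have hzero : ∀ t ∈ Icc s η, m t ^ 2 ≤ gronwallBound 0 (2 * L) 0 (t - s) := by
    refine le_gronwallBound_of_liminf_deriv_right_le
      (f' := fun t => 2 * inner ℝ (q t - v t - p t) (R (q t) - v' t))
      ((hmc.mono hsub).pow 2) ?_ (by simp [hs0]) ?_
    · intro t ht r hr
      have htI : t ∈ Icc 0 T := hsub ⟨ht.1, ht.2.le⟩
      have hnhds : Icc 0 T ∈ 𝓝[>] t :=
        mem_of_superset (Ioo_mem_nhdsGT (ht.2.trans_le hηT)) fun z hz =>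
          ⟨htI.1.trans hz.1.le, hz.2.le⟩
      have hder : HasDerivWithinAt (fun z => ‖q z - v z - p t‖ ^ 2)
          (2 * inner ℝ (q t - v t - p t) (R (q t) - v' t)) (Ioi t) t :=
        (((hq t htI).sub (hv t htI)).sub_const (p t)).norm_sq.mono_of_mem_nhdsWithin hnhds
      have hslope := (hasDerivWithinAt_iff_tendsto_slope' (by simp)).1 hder
      refine ((hslope.eventually (gt_mem_nhds hr)).and self_mem_nhdsWithin).frequently.mono ?_
      rintro z ⟨hz, hzt⟩
      refine lt_of_le_of_lt ?_ hz
      rw [slope_def_field, div_eq_inv_mul]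
      have hpos : 0 ≤ (z - t)⁻¹ := inv_nonneg.2 (sub_nonneg.2 (le_of_lt hzt))
      refine mul_le_mul_of_nonneg_left ?_ hpos
      have h1 : m z ≤ ‖q z - v z - p t‖ := by
        rw [← dist_eq_norm]; exact Metric.infDist_le_dist_of_mem (hp t)
      have h2 : m t = ‖q t - v t - p t‖ := by
        rw [hm]; simp only; rw [hdist t, hpx t, sub_sub_cancel_left, norm_neg]
      have h3 : 0 ≤ m z := Metric.infDist_nonneg
      rw [h2]
      gcongr
    · intro t ht
      have htI : t ∈ Icc 0 T := hsub ⟨ht.1, ht.2.le⟩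
      have hg := hgood t ⟨ht.1, ht.2.le⟩
      have hmx : m t = ‖x t‖ := hdist t
      have hxq : q t - v t - p t = - x t := by rw [hpx t]; abel
      -- Moreau's decomposition reads (q + x) - v = p with p in the dual cone and orthogonal to x,
      -- which is exactly the configuration in which quasi-monotonicity compares R v with R (q + x).
      -- Replacing q + x by q then costs L‖x‖² = L m².
      have hqx : v t + p t = q t + x t := by
        rw [eq_comm, ← sub_eq_iff_eq_add', add_sub_right_comm, hpx t]; abel
      have hqN : q t ∈ N ∩ O := hεN (by rw [Metric.mem_ball]; linarith)
      have hqxN : q t + x t ∈ N ∩ O := by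
        refine hεN ?_
        rw [Metric.mem_ball]
        calc dist (q t + x t) (q s) ≤ dist (q t + x t) (q t) + dist (q t) (q s) :=
              dist_triangle _ _ _
          _ < ε / 2 + ε / 2 := by
              refine add_lt_add ?_ hg.1
              rw [dist_eq_norm, add_sub_cancel_left, ← hmx]; exact hg.2
          _ = ε := by ring
      have h1 := hle t htI (x t) (hx t)
      have h2 : inner ℝ (R (v t)) (x t) ≤ inner ℝ (R (q t + x t)) (x t) := by
        refine hmono _ _ hqxN.2 ?_ _ (hx t) ?_
        · rw [← hqx, add_sub_cancel_left]; exact hp t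
        · rw [← hqx, add_sub_cancel_left]; exact hinner t
      have h3 : inner ℝ (R (q t + x t) - R (q t)) (x t) ≤ L * ‖x t‖ * ‖x t‖ := by
        refine (real_inner_le_norm _ _).trans ?_
        gcongr
        have := hL.dist_le_mul _ hqxN.1 _ hqN.1
        rwa [dist_eq_norm, dist_eq_norm, add_sub_cancel_left] at this
      rw [inner_sub_left] at h3
      rw [hxq, hmx, inner_neg_left, inner_sub_right, real_inner_comm (R (q t)),
        real_inner_comm (v' t)]
      nlinarith
  refine mem_of_superset (Ioo_mem_nhdsGT hη) fun t ht => ?_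
  have := hzero t ⟨ht.1.le, ht.2.le⟩
  rw [gronwallBound_ε0_δ0] at this
  exact pow_eq_zero_iff two_ne_zero |>.1 (le_antisymm this (sq_nonneg _))

end Comparison

/-! ### Global existence from an a priori bound. -/

section Existence

variable {E : Type*} [NormedAddCommGroup E] [NormedSpace ℝ E] [FiniteDimensional ℝ E]

/-- A vector field that is locally Lipschitz on an open set agrees near a compact subset with a
bounded Lipschitz vector field. -/
theorem exists_lipschitz_cutoff {U k : Set E} (hU : IsOpen U) (hk : IsCompact k) (hkU : k ⊆ U)
    {R : E → E} (hR : LocallyLipschitzOn U R) (hne : k.Nonempty) :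
    ∃ (G : E → E) (L B : ℝ≥0) (δ : ℝ), 0 < δ ∧ LipschitzWith L G ∧ (∀ u, ‖G u‖ ≤ B) ∧
      ∀ u, Metric.infDist u k ≤ δ → u ∈ U ∧ G u = R u := by
  have : ProperSpace E := FiniteDimensional.proper ℝ E
  obtain ⟨δ, hδ, hδU⟩ := hk.exists_cthickening_subset_open hU hkU
  set S := Metric.cthickening δ k with hS
  have hSc : IsCompact S := hk.cthickening
  have hmemS : ∀ u, u ∈ S ↔ Metric.infDist u k ≤ δ := fun u =>
    Metric.mem_cthickening_iff.trans
      (by rw [Metric.infDist, ENNReal.le_ofReal_iff_toReal_le (Metric.infEDist_ne_top hne) hδ.le])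
  obtain ⟨L, hL⟩ := (hR.mono hδU).exists_lipschitzOnWith_of_compact hSc
  obtain ⟨B, hB⟩ := hSc.exists_bound_of_continuousOn hL.continuousOn
  -- The cutoff κ is 1 where the distance to k is at most δ / 2 and 0 where it is at least δ.
  set κ : E → ℝ := fun u => max 0 (min 1 (2 - (2 / δ) * Metric.infDist u k)) with hκ
  have hκ0 : ∀ u, 0 ≤ κ u := fun u => le_max_left _ _
  have hκ1 : ∀ u, κ u ≤ 1 := fun u => max_le zero_le_one (min_le_left _ _)
  have hκL : ∀ u w, |κ u - κ w| ≤ (2 / δ) * ‖u - w‖ := by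
    intro u w
    have h1 : |κ u - κ w| ≤ |(2 - (2 / δ) * Metric.infDist u k) -
        (2 - (2 / δ) * Metric.infDist w k)| := by
      refine (abs_max_sub_max_le_max _ _ _ _).trans ?_
      rw [sub_self, abs_zero, max_eq_right (abs_nonneg _)]
      refine (abs_min_sub_min_le_max _ _ _ _).trans ?_
      rw [sub_self, abs_zero, max_eq_right (abs_nonneg _)]
    refine h1.trans ?_
    have h2 : |Metric.infDist u k - Metric.infDist w k| ≤ ‖u - w‖ := by
      have := (Metric.lipschitz_infDist_pt k).dist_le_mul u w
      simpa [Real.dist_eq, dist_eq_norm] using this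
    rw [show (2 - (2 / δ) * Metric.infDist u k) - (2 - (2 / δ) * Metric.infDist w k) =
      -((2 / δ) * (Metric.infDist u k - Metric.infDist w k)) by ring, abs_neg, abs_mul,
      abs_of_pos (by positivity)]
    gcongr
  have hκS : ∀ u, u ∉ S → κ u = 0 := by
    intro u hu
    rw [hmemS, not_le] at hu
    refine max_eq_left ((min_le_right _ _).trans ?_)
    have : 2 = (2 / δ) * δ := by field_simp
    nlinarith [mul_lt_mul_of_pos_left hu (show 0 < 2 / δ by positivity)]
  have hB' : ∀ u ∈ S, ‖R u‖ ≤ max B 0 := fun u hu => (hB u hu).trans (le_max_left _ _)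
  have hout : ∀ u w, u ∈ S → w ∉ S → ‖κ u • R u - κ w • R w‖ ≤ (2 / δ * max B 0) * ‖u - w‖ := by
    intro u w hu hw
    have h1 := hκL u w
    rw [hκS w hw, sub_zero] at h1
    rw [hκS w hw, zero_smul, sub_zero, norm_smul, Real.norm_eq_abs]
    calc |κ u| * ‖R u‖ ≤ (2 / δ * ‖u - w‖) * max B 0 :=
          mul_le_mul h1 (hB' u hu) (norm_nonneg _) (by positivity)
      _ = _ := by ring
  refine ⟨fun u => κ u • R u, ⟨L + 2 / δ * max B 0, by positivity⟩, ⟨max B 0, by positivity⟩,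
    δ / 2, half_pos hδ, ?_, ?_, ?_⟩
  · refine LipschitzWith.of_dist_le_mul fun u w => ?_
    rw [dist_eq_norm, dist_eq_norm]
    change _ ≤ (L + 2 / δ * max B 0) * ‖u - w‖
    have hL0 : (0:ℝ) ≤ L * ‖u - w‖ := by positivity
    by_cases hu : u ∈ S <;> by_cases hw : w ∈ S
    · rw [show κ u • R u - κ w • R w = κ u • (R u - R w) + (κ u - κ w) • R w by module]
      refine (norm_add_le _ _).trans ?_
      rw [norm_smul, norm_smul, Real.norm_eq_abs, Real.norm_eq_abs, abs_of_nonneg (hκ0 u), add_mul]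
      refine add_le_add ?_ ?_
      · have := hL.dist_le_mul u hu w hw
        rw [dist_eq_norm, dist_eq_norm] at this
        calc κ u * ‖R u - R w‖ ≤ 1 * ‖R u - R w‖ := by gcongr; exact hκ1 u
          _ ≤ _ := by rwa [one_mul]
      · calc |κ u - κ w| * ‖R w‖ ≤ (2 / δ * ‖u - w‖) * max B 0 :=
              mul_le_mul (hκL u w) (hB' w hw) (norm_nonneg _) (by positivity)
          _ = _ := by ring
    · linarith [hout u w hu hw]
    · have := hout w u hw hu
      rw [norm_sub_rev, norm_sub_rev u w]
      rw [norm_sub_rev u w] at hL0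
      linarith
    · simp only [hκS u hu, hκS w hw, zero_smul, sub_zero, norm_zero]
      positivity
  · intro u
    change _ ≤ max B 0
    by_cases hu : u ∈ S
    · rw [norm_smul, Real.norm_eq_abs, abs_of_nonneg (hκ0 u)]
      calc κ u * ‖R u‖ ≤ 1 * max B 0 := by gcongr; exacts [hκ1 u, hB' u hu]
        _ = _ := one_mul _
    · simp [hκS u hu]
  · intro u hu
    refine ⟨hδU ((hmemS u).2 (hu.trans (by linarith))), ?_⟩
    have : κ u = 1 := by
      have h1 : 1 ≤ 2 - (2 / δ) * Metric.infDist u k := by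
        have : (2 / δ) * Metric.infDist u k ≤ (2 / δ) * (δ / 2) := by gcongr
        have h2 : (2 / δ) * (δ / 2) = 1 := by field_simp
        linarith
      simp only [hκ]
      rw [min_eq_left h1, max_eq_right zero_le_one]
    simp only [this, one_smul]

/-- Existence on a prescribed time interval under an a priori bound: if all solutions remain in a
fixed compact subset of the domain of the vector field, then there is no explosion. -/
theorem exists_solution_of_apriori_bound {U k : Set E} (hU : IsOpen U) (hk : IsCompact k)
    (hkU : k ⊆ U) {R : E → E} (hR : LocallyLipschitzOn U R) {u : E} (hu : u ∈ k) {T : ℝ}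
    (hT : 0 < T)
    (apriori : ∀ τ, 0 < τ → τ ≤ T → ∀ ψ : ℝ → E, ψ 0 = u → (∀ t ∈ Icc 0 τ, ψ t ∈ U) →
      (∀ t ∈ Icc 0 τ, HasDerivWithinAt ψ (R (ψ t)) (Icc 0 τ) t) → ψ τ ∈ k) :
    ∃ ψ : ℝ → E, ψ 0 = u ∧ (∀ t ∈ Icc 0 T, ψ t ∈ k) ∧
      ∀ t ∈ Icc 0 T, HasDerivWithinAt ψ (R (ψ t)) (Icc 0 T) t := by
  have : CompleteSpace E := FiniteDimensional.complete ℝ E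
  obtain ⟨G, L, B, δ, hδ, hGL, hGB, hG⟩ := exists_lipschitz_cutoff hU hk hkU hR ⟨u, hu⟩
  -- The radius B · T contains every curve of speed at most B, so a single application of
  -- Picard–Lindelöf covers all of [0, T].
  have hPL : IsPicardLindelof (fun _ => G) (tmin := 0) (tmax := T) ⟨0, le_rfl, hT.le⟩ u
      (B * ⟨T, hT.le⟩) 0 B L := by
    refine ⟨fun t _ => hGL.lipschitzOnWith, fun x _ => continuousOn_const, fun t _ x _ => hGB x, ?_⟩
    simp only [sub_zero, sub_self, NNReal.coe_zero]
    rw [max_eq_left hT.le]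
    rfl
  obtain ⟨ψ, hψ0, hψ⟩ := hPL.exists_eq_forall_mem_Icc_hasDerivWithinAt₀
  have hψ0 : ψ 0 = u := hψ0
  have hψc : ContinuousOn ψ (Icc 0 T) := fun t ht => (hψ t ht).continuousWithinAt
  have hmc : ContinuousOn (fun t => Metric.infDist (ψ t) k) (Icc 0 T) :=
    (Metric.continuous_infDist_pt _).comp_continuousOn hψc
  have key : ∀ τ, 0 < τ → τ ≤ T → (∀ t ∈ Icc 0 τ, Metric.infDist (ψ t) k ≤ δ) → ψ τ ∈ k := by
    intro τ hτ hτT hle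
    refine apriori τ hτ hτT ψ hψ0 (fun t ht => (hG _ (hle t ht)).1) fun t ht => ?_
    rw [← (hG _ (hle t ht)).2]
    exact (hψ t ⟨ht.1, ht.2.trans hτT⟩).mono (Icc_subset_Icc le_rfl hτT)
  -- Until the first time t₀ at which distance δ is reached, the cut-off field agrees with R. The a
  -- priori bound then keeps the curve in k before t₀, and by continuity its distance to k is still
  -- 0 at t₀, a contradiction.
  have hlt : ∀ t ∈ Icc 0 T, Metric.infDist (ψ t) k < δ := by
    by_contra! hcon
    set b := {t | t ∈ Icc 0 T ∧ δ ≤ Metric.infDist (ψ t) k} with hb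
    have hbc : IsCompact b := by
      refine isCompact_Icc.of_isClosed_subset ?_ (fun t ht => ht.1)
      exact hmc.preimage_isClosed_of_isClosed isClosed_Icc (isClosed_Ici (a := δ))
    obtain ⟨t₀, ht₀, hmin⟩ := hbc.exists_isLeast (by obtain ⟨t, h1, h2⟩ := hcon; exact ⟨t, h1, h2⟩)
    have hpos : 0 < t₀ := by
      rcases ht₀.1.1.eq_or_lt with h | h
      · exfalso
        have := ht₀.2
        rw [← h, hψ0, Metric.infDist_zero_of_mem hu] at this
        linarith
      · exact h
    have hbefore : ∀ t ∈ Icc 0 T, t < t₀ → Metric.infDist (ψ t) k ≤ δ := by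
      intro t ht htt
      by_contra! h
      exact absurd (hmin ⟨ht, h.le⟩) (not_le.2 htt)
    have hzero : EqOn (fun t => Metric.infDist (ψ t) k) (fun _ => 0) (Ico 0 t₀) := by
      intro t ht
      rcases ht.1.eq_or_lt with h | h
      · simp only [← h, hψ0, Metric.infDist_zero_of_mem hu]
      · exact Metric.infDist_zero_of_mem (key t h (ht.2.le.trans ht₀.1.2) fun s hs =>
          hbefore s ⟨hs.1, hs.2.trans (ht.2.le.trans ht₀.1.2)⟩ (hs.2.trans_lt ht.2))
    have hcl : EqOn (fun t => Metric.infDist (ψ t) k) (fun _ => 0) (Icc 0 t₀) := by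
      refine hzero.of_subset_closure (hmc.mono (Icc_subset_Icc le_rfl ht₀.1.2))
        continuousOn_const Ico_subset_Icc_self ?_
      rw [closure_Ico hpos.ne]
    have := hcl ⟨hpos.le, le_rfl⟩
    simp only at this
    linarith [ht₀.2]
  refine ⟨ψ, hψ0, fun t ht => ?_, fun t ht => ?_⟩
  · rcases ht.1.eq_or_lt with h | h
    · rw [← h, hψ0]; exact hu
    · exact key t h ht.2 fun s hs => (hlt s ⟨hs.1, hs.2.trans ht.2⟩).le
  · rw [← (hG _ (hlt t ht).le).2]
    exact hψ t ht

end Existence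

end AffineMoments

namespace AffineMoments

/-! ### Affine maps on a spanning cone. -/

section ConvexAffine

variable {E F : Type*} [NormedAddCommGroup E] [NormedSpace ℝ E] [FiniteDimensional ℝ E]
  [AddCommGroup F] [Module ℝ F]

/-- A map on a spanning cone that respects convex combinations is the restriction of an affine
map. -/
theorem exists_linearMap_of_convex_affine (C : ProperCone ℝ E)
    (hspan : Submodule.span ℝ (C : Set E) = ⊤) {g : E → F}
    (hg : ∀ x ∈ C, ∀ y ∈ C, ∀ s : ℝ, 0 ≤ s → s ≤ 1 →
      g (s • x + (1 - s) • y) = s • g x + (1 - s) • g y) :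
    ∃ L : E →ₗ[ℝ] F, ∀ x ∈ C, g x = g 0 + L x := by
  have hC0 : (0 : E) ∈ C := C.zero_mem
  -- The map g - g 0 is positively homogeneous (first for factors at most 1, then by inversion) and
  -- additive (through midpoints) on the cone.
  have hscale1 : ∀ x ∈ C, ∀ s : ℝ, 0 ≤ s → s ≤ 1 → g (s • x) - g 0 = s • (g x - g 0) := by
    intro x hx s h0 h1
    have := hg x hx 0 hC0 s h0 h1
    rw [smul_zero, add_zero] at this
    rw [this]; module
  have hscale : ∀ x ∈ C, ∀ s : ℝ, 0 ≤ s → g (s • x) - g 0 = s • (g x - g 0) := by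
    intro x hx s h0
    rcases le_total s 1 with h1 | h1
    · exact hscale1 x hx s h0 h1
    · have hs : s ≠ 0 := by linarith
      have := hscale1 (s • x) (C.smul_mem hx h0) s⁻¹ (inv_nonneg.2 h0) (inv_le_one_of_one_le₀ h1)
      rw [smul_smul, inv_mul_cancel₀ hs, one_smul] at this
      rw [this, smul_smul, mul_inv_cancel₀ hs, one_smul]
  have hadd : ∀ x ∈ C, ∀ y ∈ C, g (x + y) - g 0 = (g x - g 0) + (g y - g 0) := by
    intro x hx y hy
    have h1 := hg x hx y hy (1 / 2) (by norm_num) (by norm_num)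
    have h2 := hscale (x + y) (C.add_mem hx hy) (1 / 2) (by norm_num)
    rw [smul_add, show (1 / 2 : ℝ) • y = (1 - 1 / 2 : ℝ) • y by norm_num, h1] at h2
    have h3 : (2 : ℝ) • ((1 / 2 : ℝ) • g x + (1 - 1 / 2 : ℝ) • g y - g 0) =
        (2 : ℝ) • ((1 / 2 : ℝ) • (g (x + y) - g 0)) := by rw [h2]
    rw [smul_smul, show (2 : ℝ) * (1 / 2) = 1 by norm_num, one_smul] at h3
    rw [← h3]; module
  -- A basis chosen inside `C` defines the linear map. Adding the negative parts of the coordinates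
  -- of x turns its expansion into an identity between nonnegative combinations, to which additivity
  -- on the cone applies.
  obtain ⟨b, hbC, hbspan, hbli⟩ := exists_linearIndependent ℝ (C : Set E)
  rw [hspan] at hbspan
  let B : Module.Basis b ℝ E := Module.Basis.mk hbli (by simp [hbspan])
  have hBmem : ∀ i, B i ∈ C := fun i => by
    simpa [B] using hbC i.2
  have : Finite b := Module.Finite.finite_basis B
  have := Fintype.ofFinite b
  have hsum : ∀ (c : b → ℝ), (∀ i, 0 ≤ c i) → ∀ s : Finset b, (∑ i ∈ s, c i • B i) ∈ C ∧
      g (∑ i ∈ s, c i • B i) - g 0 = ∑ i ∈ s, c i • (g (B i) - g 0) := by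
    intro c hc s
    induction s using Finset.cons_induction with
    | empty => simp
    | cons a s ha ih =>
      rw [Finset.sum_cons, Finset.sum_cons]
      have hm := C.smul_mem (hBmem a) (hc a)
      exact ⟨C.add_mem hm ih.1, by rw [hadd _ hm _ ih.1, ih.2, hscale _ (hBmem a) _ (hc a)]⟩
  refine ⟨B.constr ℝ (fun i => g (B i) - g 0), fun x hx => ?_⟩
  rw [Module.Basis.constr_apply_fintype]
  have hrepr : x = ∑ i, B.repr x i • B i := (B.sum_repr x).symm
  have h1 := hsum (fun i => max (B.repr x i) 0) (fun i => le_max_right _ _) Finset.univ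
  have h2 := hsum (fun i => max (-B.repr x i) 0) (fun i => le_max_right _ _) Finset.univ
  have hc : ∀ i, max (B.repr x i) 0 = B.repr x i + max (-B.repr x i) 0 := by
    intro i
    rcases le_total 0 (B.repr x i) with h | h
    · rw [max_eq_left h, max_eq_right (by linarith), add_zero]
    · rw [max_eq_right h, max_eq_left (by linarith), add_neg_cancel]
  have h3 : x + ∑ i, max (-B.repr x i) 0 • B i = ∑ i, max (B.repr x i) 0 • B i := by
    conv_lhs => rw [hrepr]
    rw [← Finset.sum_add_distrib]
    refine Finset.sum_congr rfl fun i _ => ?_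
    rw [hc i, add_smul, ← hrepr]
  have h4 := hadd x hx _ h2.1
  rw [h3, h1.2, h2.2] at h4
  have h5 : ∑ i, max (B.repr x i) 0 • (g (B i) - g 0) =
      ∑ i, B.repr x i • (g (B i) - g 0) + ∑ i, max (-B.repr x i) 0 • (g (B i) - g 0) := by
    rw [← Finset.sum_add_distrib]
    refine Finset.sum_congr rfl fun i _ => ?_
    rw [hc i, add_smul]
  rw [h5, add_left_inj] at h4
  simp only [B.equivFun_apply]
  rw [h4]; abel

end ConvexAffine

/-! ### The complex-bilinear pairing and its real and imaginary parts. -/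

section Pairing

variable {d : ℕ}

/-- The componentwise imaginary part of a complex vector. -/
noncomputable def imPart (u : CVec d) : RVec d := WithLp.toLp 2 (fun i => (u i).im)

/-- The inclusion of real vectors into complex vectors. -/
noncomputable def toC (y : RVec d) : CVec d := WithLp.toLp 2 (fun i => (y i : ℂ))

@[simp] theorem rePart_apply (u : CVec d) (i : Fin d) : rePart u i = (u i).re := rfl

@[simp] theorem imPart_apply (u : CVec d) (i : Fin d) : imPart u i = (u i).im := rfl

@[simp] theorem toC_apply (y : RVec d) (i : Fin d) : toC y i = (y i : ℂ) := rfl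

@[simp] theorem rePart_toC (y : RVec d) : rePart (toC y) = y := by ext i; simp

@[simp] theorem imPart_toC (y : RVec d) : imPart (toC y) = 0 := by ext i; simp

theorem inner_eq_sum (y x : RVec d) : inner ℝ y x = ∑ i, y i * x i := by
  rw [PiLp.inner_apply]
  exact Finset.sum_congr rfl fun i _ => by simp [mul_comm]

@[simp] theorem cpair_re (u : CVec d) (x : RVec d) : (cpair u x).re = inner ℝ (rePart u) x := by
  simp [cpair, inner_eq_sum]

@[simp] theorem cpair_im (u : CVec d) (x : RVec d) : (cpair u x).im = inner ℝ (imPart u) x := by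
  simp [cpair, inner_eq_sum]

theorem cpair_eq (u : CVec d) (x : RVec d) :
    cpair u x = (inner ℝ (rePart u) x : ℝ) + (inner ℝ (imPart u) x : ℝ) * Complex.I := by
  apply Complex.ext <;> simp

@[simp] theorem cpair_toC (y x : RVec d) : cpair (toC y) x = (inner ℝ y x : ℝ) := by
  rw [cpair_eq]; simp

@[simp] theorem cpair_zero (u : CVec d) : cpair u 0 = 0 := by simp [cpair]

theorem cpair_add (u : CVec d) (x y : RVec d) : cpair u (x + y) = cpair u x + cpair u y := by
  simp [cpair, mul_add, Finset.sum_add_distrib]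

theorem cpair_sub (u : CVec d) (x y : RVec d) : cpair u (x - y) = cpair u x - cpair u y := by
  simp [cpair, mul_sub, Finset.sum_sub_distrib]

theorem cpair_smul (u : CVec d) (s : ℝ) (x : RVec d) : cpair u (s • x) = s * cpair u x := by
  simp only [cpair, Finset.mul_sum, PiLp.smul_apply, smul_eq_mul, Complex.ofReal_mul]
  exact Finset.sum_congr rfl fun i _ => by ring

theorem cpair_sum {ι : Type*} (s : Finset ι) (u : CVec d) (f : ι → RVec d) :
    cpair u (∑ i ∈ s, f i) = ∑ i ∈ s, cpair u (f i) := by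
  classical
  induction s using Finset.induction_on with
  | empty => simp
  | insert a s ha ih => rw [Finset.sum_insert ha, Finset.sum_insert ha, cpair_add, ih]

theorem add_cpair (u v : CVec d) (x : RVec d) : cpair (u + v) x = cpair u x + cpair v x := by
  simp [cpair, add_mul, Finset.sum_add_distrib]

theorem sub_cpair (u v : CVec d) (x : RVec d) : cpair (u - v) x = cpair u x - cpair v x := by
  simp [cpair, sub_mul, Finset.sum_sub_distrib]

theorem smul_cpair (c : ℂ) (u : CVec d) (x : RVec d) : cpair (c • u) x = c * cpair u x := by
  simp [cpair, Finset.mul_sum, mul_assoc]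

theorem cpair_single (u : CVec d) (i : Fin d) : cpair u (EuclideanSpace.single i 1) = u i := by
  rw [cpair, Finset.sum_eq_single i]
  · simp
  · intro j _ hj; simp [hj]
  · simp

theorem norm_rePart_le (u : CVec d) : ‖rePart u‖ ≤ ‖u‖ := by
  rw [EuclideanSpace.norm_eq, EuclideanSpace.norm_eq]
  refine Real.sqrt_le_sqrt (Finset.sum_le_sum fun i _ => ?_)
  have := Complex.abs_re_le_norm (u i)
  rw [rePart_apply, Real.norm_eq_abs]
  gcongr

theorem norm_cpair_le (u : CVec d) (x : RVec d) : ‖cpair u x‖ ≤ ‖u‖ * ‖x‖ := by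
  have h : cpair u x = inner ℂ (toC x) u := by
    rw [cpair, PiLp.inner_apply]
    exact Finset.sum_congr rfl fun i _ => by simp
  have h2 : ‖toC x‖ = ‖x‖ := by
    rw [EuclideanSpace.norm_eq, EuclideanSpace.norm_eq]
    simp
  rw [h, mul_comm, ← h2]
  exact norm_inner_le_norm _ _

theorem rePart_add (u v : CVec d) : rePart (u + v) = rePart u + rePart v := by ext i; simp

theorem rePart_sub (u v : CVec d) : rePart (u - v) = rePart u - rePart v := by ext i; simp

/-- The real part as a continuous linear map. -/
noncomputable def rePartL : CVec d →L[ℝ] RVec d :=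
  LinearMap.mkContinuous
    { toFun := rePart
      map_add' := rePart_add
      map_smul' := fun c u => by ext i; simp } 1 (fun u => by
        rw [one_mul]; exact norm_rePart_le u)

@[simp] theorem rePartL_apply (u : CVec d) : rePartL u = rePart u := rfl

theorem continuous_rePart : Continuous (rePart : CVec d → RVec d) := rePartL.continuous

/-- Pairing with a fixed real vector, as a continuous real-linear map. -/
noncomputable def cpairL (x : RVec d) : CVec d →L[ℝ] ℂ :=
  LinearMap.mkContinuous
    { toFun := fun u => cpair u x
      map_add' := fun u v => add_cpair u v x
      map_smul' := fun c u => by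
        simp only [cpair, RingHom.id_apply, Finset.smul_sum]
        exact Finset.sum_congr rfl fun i _ => by simp [mul_assoc] } ‖x‖
    (fun u => by rw [mul_comm]; exact norm_cpair_le u x)

@[simp] theorem cpairL_apply (x : RVec d) (u : CVec d) : cpairL x u = cpair u x := rfl

theorem continuous_cpair_right (u : CVec d) : Continuous (cpair u) := by
  unfold cpair; fun_prop

theorem isOpen_strip {A : Set (RVec d)} (hA : IsOpen A) : IsOpen (strip A) :=
  hA.preimage continuous_rePart

/-- A complex vector is determined, with control of norms, by its pairings with a spanning set. -/
theorem exists_norm_le_sum_cpair {s : Set (RVec d)} (hs : Submodule.span ℝ s = ⊤) :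
    ∃ (b : Finset (RVec d)) (c : ℝ), (↑b : Set (RVec d)) ⊆ s ∧ 0 ≤ c ∧
      ∀ u : CVec d, ‖u‖ ≤ c * ∑ x ∈ b, ‖cpair u x‖ := by
  classical
  have h1 : ∀ i : Fin d, ∃ (b : Finset (RVec d)) (f : RVec d → ℝ), (↑b : Set (RVec d)) ⊆ s ∧
      ∑ x ∈ b, f x • x = EuclideanSpace.single i 1 := by
    intro i
    have : (EuclideanSpace.single i 1 : RVec d) ∈ Submodule.span ℝ s := by rw [hs]; trivial
    obtain ⟨f, b, hb, -, h⟩ := Submodule.mem_span_iff_exists_finset_subset.1 this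
    exact ⟨b, f, hb, h⟩
  choose b f hb hf using h1
  refine ⟨Finset.univ.biUnion b, ∑ i, ∑ x ∈ b i, |f i x|, ?_, by positivity, fun u => ?_⟩
  · intro x hx
    simp only [Finset.coe_biUnion, mem_iUnion] at hx
    obtain ⟨i, _, hx⟩ := hx
    exact hb i hx
  · have hu : ‖u‖ ≤ ∑ i, ‖u i‖ := by
      calc ‖u‖ = ‖∑ i, EuclideanSpace.single i (u i)‖ := by
            congr 1; ext j; simp
        _ ≤ ∑ i, ‖EuclideanSpace.single i (u i)‖ := norm_sum_le _ _
        _ = _ := by simp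
    refine hu.trans ?_
    rw [Finset.sum_mul]
    refine Finset.sum_le_sum fun i _ => ?_
    rw [← cpair_single u i, ← hf i, cpair_sum, Finset.sum_mul]
    refine (norm_sum_le _ _).trans (Finset.sum_le_sum fun x hx => ?_)
    rw [cpair_smul, norm_mul, Complex.norm_real, Real.norm_eq_abs]
    gcongr
    exact Finset.single_le_sum (f := fun x => ‖cpair u x‖) (fun _ _ => norm_nonneg _)
      (Finset.mem_biUnion.2 ⟨i, Finset.mem_univ _, hx⟩)

theorem eq_of_cpair_eq {s : Set (RVec d)} (hs : Submodule.span ℝ s = ⊤) {u v : CVec d}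
    (h : ∀ x ∈ s, cpair u x = cpair v x) : u = v := by
  obtain ⟨b, c, hb, -, hle⟩ := exists_norm_le_sum_cpair hs
  have := hle (u - v)
  rw [Finset.sum_eq_zero fun x hx => by
    rw [sub_cpair, h x (hb hx), sub_self, norm_zero], mul_zero] at this
  exact sub_eq_zero.1 (norm_le_zero_iff.1 this)

end Pairing

end AffineMoments

namespace AffineMoments

/-! ### Taylor estimates for the jump part of the generator. -/

section Weight

variable {d : ℕ}

/-- The weight `min (‖ξ‖²) 1` against which Lévy measures are integrable. -/
noncomputable def levyWeight (ξ : RVec d) : ℝ := min (‖ξ‖ ^ 2) 1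

theorem levyWeight_nonneg (ξ : RVec d) : 0 ≤ levyWeight ξ := le_min (by positivity) zero_le_one

theorem levyWeight_of_le {ξ : RVec d} (h : ‖ξ‖ ≤ 1) : levyWeight ξ = ‖ξ‖ ^ 2 :=
  min_eq_left (pow_le_one₀ (norm_nonneg _) h)

theorem levyWeight_of_ge {ξ : RVec d} (h : 1 ≤ ‖ξ‖) : levyWeight ξ = 1 :=
  min_eq_right (one_le_pow₀ h)

theorem continuous_levyWeight : Continuous (levyWeight : RVec d → ℝ) := by
  unfold levyWeight; fun_prop

theorem trunc_of_le {ξ : RVec d} (h : ‖ξ‖ ≤ 1) : trunc ξ = ξ := by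
  rw [trunc, indicator_of_mem]; simpa using h

theorem trunc_of_gt {ξ : RVec d} (h : 1 < ‖ξ‖) : trunc ξ = 0 := by
  rw [trunc, indicator_of_notMem]; simpa using h

theorem measurable_trunc : Measurable (trunc : RVec d → RVec d) :=
  measurable_id.indicator Metric.isClosed_closedBall.measurableSet

theorem norm_trunc_le (ξ : RVec d) : ‖trunc ξ‖ ≤ 1 := by
  rcases le_or_gt ‖ξ‖ 1 with h | h
  · rwa [trunc_of_le h]
  · rw [trunc_of_gt h]; simp

/-- First-order Taylor remainder, with the increment truncated in the derivative term. -/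
theorem abs_taylor_trunc_le {f : RVec d → ℝ} (hf : Differentiable ℝ f) {ε : ℝ}
    (h0 : ∀ z, |f z| ≤ ε) (h1 : ∀ z, ‖fderiv ℝ f z - fderiv ℝ f 0‖ ≤ ε * ‖z‖) (ξ : RVec d) :
    |f ξ - f 0 - fderiv ℝ f 0 (trunc ξ)| ≤ 2 * ε * levyWeight ξ := by
  have hε : 0 ≤ ε := (abs_nonneg _).trans (h0 0)
  rcases le_or_gt ‖ξ‖ 1 with h | h
  · rw [trunc_of_le h, levyWeight_of_le h]
    have := Convex.norm_image_sub_le_of_norm_fderiv_le' (𝕜 := ℝ) (s := Metric.closedBall 0 ‖ξ‖)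
      (f := f) (φ := fderiv ℝ f 0) (C := ε * ‖ξ‖) (x := 0) (y := ξ) (fun x _ => hf x)
      (fun x hx => (h1 x).trans (by
        have : ‖x‖ ≤ ‖ξ‖ := by simpa using hx
        gcongr)) (convex_closedBall _ _) (by simp) (by simp)
    rw [sub_zero, Real.norm_eq_abs] at this
    nlinarith [sq_nonneg ‖ξ‖, mul_nonneg hε (sq_nonneg ‖ξ‖)]
  · rw [trunc_of_gt h, levyWeight_of_ge h.le, map_zero, sub_zero, mul_one, two_mul]
    exact (abs_sub _ _).trans (add_le_add (h0 _) (h0 _))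

/-- The integrand of the jump part of the generator. -/
noncomputable def jumpIncrement (f : RVec d → ℝ) (z ξ : RVec d) : ℝ :=
  f (z + ξ) - f z - fderiv ℝ f z (trunc ξ)

theorem measurable_jumpIncrement {f : RVec d → ℝ} (hf : Continuous f) (z : RVec d) :
    Measurable (jumpIncrement f z) :=
  (((hf.comp (continuous_const.add continuous_id)).measurable).sub_const _).sub
    ((fderiv ℝ f z).continuous.measurable.comp measurable_trunc)

theorem exists_norm_sub_lt_of_compactSupport {F : Type*} [NormedAddCommGroup F] {g : RVec d → F}
    (hg : Continuous g) (hgc : HasCompactSupport g) {ε : ℝ} (hε : 0 < ε) :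
    ∃ δ > 0, ∀ z x, ‖z - x‖ < δ → ‖g z - g x‖ < ε := by
  obtain ⟨δ, hδ, h⟩ := Metric.uniformContinuous_iff.1
    (hgc.uniformContinuous_of_continuous hg) ε hε
  refine ⟨δ, hδ, fun z x hzx => ?_⟩
  rw [← dist_eq_norm] at hzx ⊢
  exact h hzx

theorem norm_fderiv_add_sub_le {F : Type*} [NormedAddCommGroup F] [NormedSpace ℝ F]
    {g : RVec d → F} (hg : Differentiable ℝ g) {M : ℝ} (hM : ∀ z, ‖fderiv ℝ g z‖ ≤ M)
    (z y : RVec d) : ‖g (z + y) - g z‖ ≤ M * ‖y‖ := by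
  have := Convex.norm_image_sub_le_of_norm_fderiv_le (𝕜 := ℝ) (f := g) (s := univ)
    (C := M) (x := z) (y := z + y) (fun x _ => hg x) (fun x _ => hM x) convex_univ trivial trivial
  rwa [add_sub_cancel_left] at this

theorem exists_norm_le_of_compactSupport {F : Type*} [NormedAddCommGroup F] {g : RVec d → F}
    (hg : Continuous g) (hgc : HasCompactSupport g) : ∃ M, ∀ z, ‖g z‖ ≤ M :=
  hgc.exists_bound_of_continuous hg

variable {f : RVec d → ℝ}

/-- Second-order Taylor for small jumps and the sup norm for large ones, both uniform in z by
compact support; this is integrability against every Lévy measure at once. -/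
theorem exists_abs_jumpIncrement_le (hf : ContDiff ℝ 2 f) (hfc : HasCompactSupport f) :
    ∃ c, 0 ≤ c ∧ ∀ z ξ, |jumpIncrement f z ξ| ≤ c * levyWeight ξ := by
  obtain ⟨M, hM⟩ := hfc.exists_bound_of_continuous hf.continuous
  have hf' : ContDiff ℝ 1 (fderiv ℝ f) := hf.fderiv_right (by norm_num)
  obtain ⟨M', hM'⟩ := exists_norm_le_of_compactSupport (hf'.continuous_fderiv (by norm_num))
    (hfc.fderiv ℝ |>.fderiv ℝ)
  have hlip : ∀ z y, ‖fderiv ℝ f (z + y) - fderiv ℝ f z‖ ≤ max M M' * ‖y‖ := fun z y =>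
    (norm_fderiv_add_sub_le (hf'.differentiable (by norm_num)) hM' z y).trans
      (mul_le_mul_of_nonneg_right (le_max_right _ _) (norm_nonneg _))
  have hM0 : 0 ≤ max M M' := (norm_nonneg _).trans ((hM 0).trans (le_max_left _ _))
  refine ⟨2 * max M M', by positivity, fun z ξ => ?_⟩
  have hd : ∀ y, fderiv ℝ (fun y => f (z + y)) y = fderiv ℝ f (z + y) := fun y => by
    rw [fderiv_comp_add_left]
  have := abs_taylor_trunc_le (f := fun y => f (z + y)) (ε := max M M')
    ((hf.differentiable (by norm_num)).comp (differentiable_const z |>.add differentiable_id))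
    (fun y => (hM _).trans (le_max_left _ _)) (fun y => by
      rw [hd, hd, add_zero]
      exact hlip z y) ξ
  simp only [hd, add_zero] at this
  exact this

/-- The Taylor bound is applied to f (z + ·) - f (x + ·), which is uniformly small together with its
second derivative by uniform continuity. -/
theorem exists_abs_jumpIncrement_sub_le (hf : ContDiff ℝ 2 f) (hfc : HasCompactSupport f)
    {ε : ℝ} (hε : 0 < ε) : ∃ δ > 0, ∀ z x, ‖z - x‖ < δ → ∀ ξ,
      |jumpIncrement f z ξ - jumpIncrement f x ξ| ≤ 2 * ε * levyWeight ξ := by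
  have hf' : ContDiff ℝ 1 (fderiv ℝ f) := hf.fderiv_right (by norm_num)
  obtain ⟨δ, hδ, h0⟩ := exists_norm_sub_lt_of_compactSupport hf.continuous hfc hε
  obtain ⟨δ', hδ', h2⟩ := exists_norm_sub_lt_of_compactSupport
    (hf'.continuous_fderiv (by norm_num)) (hfc.fderiv ℝ |>.fderiv ℝ) hε
  refine ⟨min δ δ', lt_min hδ hδ', fun z x hzx ξ => ?_⟩
  have hdist : ∀ y : RVec d, ‖(z + y) - (x + y)‖ < min δ δ' := fun y => by
    rwa [add_sub_add_right_eq_sub]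
  have hdf : ∀ w, Differentiable ℝ (fun y => f (w + y)) := fun w =>
    (hf.differentiable (by norm_num)).comp (differentiable_const w |>.add differentiable_id)
  have hd : ∀ y, fderiv ℝ (fun y => f (z + y) - f (x + y)) y =
      fderiv ℝ f (z + y) - fderiv ℝ f (x + y) := fun y => by
    rw [fderiv_fun_sub (hdf z y) (hdf x y), fderiv_comp_add_left, fderiv_comp_add_left]
  have hdf' : ∀ w, Differentiable ℝ (fun y => fderiv ℝ f (w + y)) := fun w =>
    (hf'.differentiable (by norm_num)).comp (differentiable_const w |>.add differentiable_id)
  have := abs_taylor_trunc_le (f := fun y => f (z + y) - f (x + y)) (ε := ε)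
    ((hdf z).sub (hdf x)) (fun y => (h0 _ _ ((hdist y).trans_le (min_le_left _ _))).le)
    (fun y => by
      have := Convex.norm_image_sub_le_of_norm_fderiv_le (𝕜 := ℝ)
        (f := fun y => fderiv ℝ f (z + y) - fderiv ℝ f (x + y)) (s := univ)
        (C := ε) (x := 0) (y := y) (fun w _ => ((hdf' z).sub (hdf' x)) w)
        (fun w _ => by
          rw [fderiv_fun_sub (hdf' z w) (hdf' x w), fderiv_comp_add_left, fderiv_comp_add_left]
          exact (h2 _ _ ((hdist w).trans_le (min_le_right _ _))).le) convex_univ trivial trivial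
      rw [hd, hd]
      simpa using this) ξ
  rw [hd, add_zero, add_zero] at this
  convert this using 2
  simp only [jumpIncrement, sub_apply]
  ring

end Weight

/-! ### Continuity and lower bounds of the generator on the cone. -/

namespace AffineTriplet

variable {d : ℕ} {D : Set (RVec d)} (χ : AffineTriplet D)

theorem integrable_levyWeight {x : RVec d} (hx : x ∈ D) : Integrable levyWeight (χ.K x) := by
  refine ⟨continuous_levyWeight.aestronglyMeasurable, ?_⟩
  rw [hasFiniteIntegral_iff_ofReal (Eventually.of_forall levyWeight_nonneg)]
  exact χ.K_integrable x hx

theorem integrable_of_norm_le {F : Type*} [NormedAddCommGroup F] {x : RVec d} (hx : x ∈ D)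
    {g : RVec d → F} (hg : AEStronglyMeasurable g (χ.K x)) (c : ℝ)
    (hle : ∀ ξ, ‖g ξ‖ ≤ c * levyWeight ξ) : Integrable g (χ.K x) :=
  ((χ.integrable_levyWeight hx).const_mul c).mono' hg (Eventually.of_forall hle)

theorem integral_K_convex {F : Type*} [NormedAddCommGroup F] [NormedSpace ℝ F] {x y : RVec d}
    (hx : x ∈ D) (hy : y ∈ D) {g : RVec d → F} (hgx : Integrable g (χ.K x))
    (hgy : Integrable g (χ.K y)) {s : ℝ} (h0 : 0 ≤ s) (h1 : s ≤ 1) :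
    ∫ ξ, g ξ ∂(χ.K (s • x + (1 - s) • y)) =
      s • ∫ ξ, g ξ ∂(χ.K x) + (1 - s) • ∫ ξ, g ξ ∂(χ.K y) := by
  rw [χ.K_affine x hx y hy s h0 h1, integral_add_measure
    (hgx.smul_measure ENNReal.ofReal_ne_top) (hgy.smul_measure ENNReal.ofReal_ne_top),
    integral_smul_measure, integral_smul_measure, ENNReal.toReal_ofReal h0,
    ENNReal.toReal_ofReal (by linarith)]

theorem continuous_a_apply (i j : Fin d) : Continuous fun x => χ.a x i j := by
  have h : (fun x => χ.a x i j) = fun x => (LinearMap.proj j ∘ₗ LinearMap.proj i ∘ₗ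
      (Matrix.ofLinearEquiv ℝ).symm.toLinearMap ∘ₗ χ.a.linear :
        RVec d →ₗ[ℝ] ℝ) x + χ.a 0 i j := by
    ext x
    have := congrFun (χ.a.decomp) x
    simp only [Pi.add_apply] at this
    rw [this]; rfl
  rw [h]
  exact (LinearMap.continuous_of_finiteDimensional _).add continuous_const

theorem continuous_b : Continuous χ.b := χ.b.continuous_of_finiteDimensional

section Cone

variable {C : ProperCone ℝ (RVec d)} (χ : AffineTriplet (C : Set (RVec d)))

/-- Integrals against `K` inherit its compatibility with convex combinations, hence are restrictions
of affine maps in finite dimension. -/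
theorem continuousOn_integral_K (hspan : Submodule.span ℝ (C : Set (RVec d)) = ⊤)
    {g : RVec d → ℝ} (hg : ∀ x ∈ C, Integrable g (χ.K x)) :
    ContinuousOn (fun x => ∫ ξ, g ξ ∂(χ.K x)) C := by
  obtain ⟨L, hL⟩ := exists_linearMap_of_convex_affine C hspan
    (g := fun x => ∫ ξ, g ξ ∂(χ.K x))
    (fun x hx y hy s h0 h1 => χ.integral_K_convex hx hy (hg x hx) (hg y hy) h0 h1)
  exact ((continuous_const.add L.continuous_of_finiteDimensional).continuousOn).congr
    fun x hx => hL x hx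

/-- In the jump term both the integrand and the measure move with z. The change of the integrand is
small relative to the Lévy weight, uniformly in ξ; with the integrand frozen, the integral is affine
in z. -/
theorem continuousOn_generator (hspan : Submodule.span ℝ (C : Set (RVec d)) = ⊤)
    {f : RVec d → ℝ} (hf : ContDiff ℝ 2 f) (hfc : HasCompactSupport f) :
    ContinuousOn (χ.generator f) C := by
  have hf' : ContDiff ℝ 1 (fderiv ℝ f) := hf.fderiv_right (by norm_num)
  have hf'c := hf'.continuous
  have hf''c := hf'.continuous_fderiv (by norm_num)
  obtain ⟨c, hc, hcle⟩ := exists_abs_jumpIncrement_le hf hfc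
  have hint : ∀ z, ∀ x ∈ C, Integrable (jumpIncrement f z) (χ.K x) := fun z x hx =>
    χ.integrable_of_norm_le hx (measurable_jumpIncrement hf.continuous z).aestronglyMeasurable c
      (hcle z)
  have hjump : ContinuousOn (fun z => ∫ ξ, jumpIncrement f z ξ ∂(χ.K z)) C := by
    intro x hx
    have hW := χ.continuousOn_integral_K hspan (fun x hx => χ.integrable_levyWeight hx) x hx
    have hG := χ.continuousOn_integral_K hspan (hint x) x hx
    set W := fun z => ∫ ξ, levyWeight ξ ∂(χ.K z) with hWdef
    have hW0 : 0 ≤ W x := integral_nonneg levyWeight_nonneg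
    rw [ContinuousWithinAt, Metric.tendsto_nhds]
    intro ε hε
    -- This tolerance gives an error of at most ε / 2 as soon as W z < W x + 1.
    obtain ⟨δ, hδ, hδle⟩ := exists_abs_jumpIncrement_sub_le hf hfc
      (show 0 < ε / (4 * (W x + 1)) by positivity)
    have e1 := hW.eventually (gt_mem_nhds (show W x < W x + 1 by linarith))
    have e2 := hG.eventually (Metric.ball_mem_nhds _ (half_pos hε))
    have e3 : ∀ᶠ z in 𝓝[C] x, ‖z - x‖ < δ := by
      have : Metric.ball x δ ∈ 𝓝[C] x := mem_nhdsWithin_of_mem_nhds (Metric.ball_mem_nhds x hδ)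
      filter_upwards [this] with z hz
      rwa [Metric.mem_ball, dist_eq_norm] at hz
    filter_upwards [e1, e2, e3, self_mem_nhdsWithin] with z h1 h2 h3 hz
    have h4 : |∫ ξ, jumpIncrement f z ξ ∂(χ.K z) - ∫ ξ, jumpIncrement f x ξ ∂(χ.K z)| ≤
        2 * (ε / (4 * (W x + 1))) * W z := by
      rw [← integral_sub (hint z z hz) (hint x z hz), ← integral_const_mul]
      rw [← Real.norm_eq_abs]
      exact norm_integral_le_of_norm_le ((χ.integrable_levyWeight hz).const_mul _)
        (Eventually.of_forall fun ξ => hδle z x h3 ξ)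
    have h5 : 2 * (ε / (4 * (W x + 1))) * W z ≤ ε / 2 := by
      calc 2 * (ε / (4 * (W x + 1))) * W z ≤ 2 * (ε / (4 * (W x + 1))) * (W x + 1) := by gcongr
        _ = ε / 2 := by field_simp; norm_num
    calc dist (∫ ξ, jumpIncrement f z ξ ∂(χ.K z)) (∫ ξ, jumpIncrement f x ξ ∂(χ.K x))
        ≤ dist (∫ ξ, jumpIncrement f z ξ ∂(χ.K z)) (∫ ξ, jumpIncrement f x ξ ∂(χ.K z)) +
          dist (∫ ξ, jumpIncrement f x ξ ∂(χ.K z)) (∫ ξ, jumpIncrement f x ξ ∂(χ.K x)) :=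
          dist_triangle _ _ _
      _ < ε / 2 + ε / 2 := by
          refine add_lt_add_of_le_of_lt ?_ h2
          rw [Real.dist_eq]
          exact h4.trans h5
      _ = ε := by ring
  have ha := χ.continuous_a_apply
  have hb := χ.continuous_b
  unfold generator
  refine (Continuous.continuousOn ?_).add hjump
  refine (continuous_const.mul ?_).add (hf'c.clm_apply hb)
  refine continuous_finsetSum _ fun i _ => continuous_finsetSum _ fun j _ => (ha i j).mul ?_
  exact (hf''c.clm_apply continuous_const).clm_apply continuous_const

/-- The generator of a nonnegative compactly supported function is bounded below on the state
space. -/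
theorem exists_le_generator (hspan : Submodule.span ℝ (C : Set (RVec d)) = ⊤)
    {f : RVec d → ℝ} (hf : ContDiff ℝ 2 f) (hfc : HasCompactSupport f) (hf0 : ∀ z, 0 ≤ f z) :
    ∃ c, 0 ≤ c ∧ ∀ z ∈ C, -c ≤ χ.generator f z := by
  have hcomp : IsCompact (tsupport f ∩ C) := IsCompact.inter_right hfc C.isClosed
  obtain ⟨c, hc⟩ := hcomp.exists_bound_of_continuousOn
    ((χ.continuousOn_generator hspan hf hfc).mono inter_subset_right)
  refine ⟨max c 0, le_max_right _ _, fun z hz => ?_⟩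
  by_cases hzs : z ∈ tsupport f
  · have := (abs_le.1 (hc z ⟨hzs, hz⟩)).1
    linarith [le_max_left c 0]
  · have h0 : f z = 0 := image_eq_zero_of_notMem_tsupport hzs
    have h1 : fderiv ℝ f z = 0 :=
      image_eq_zero_of_notMem_tsupport (fun h => hzs (tsupport_fderiv_subset ℝ h))
    have h2 : fderiv ℝ (fderiv ℝ f) z = 0 :=
      image_eq_zero_of_notMem_tsupport (fun h =>
        hzs (tsupport_fderiv_subset ℝ (tsupport_fderiv_subset ℝ h)))
    have h3 : 0 ≤ χ.generator f z := by
      simp only [generator, h0, h1, h2, zero_apply, mul_zero,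
        Finset.sum_const_zero, sub_zero, zero_add, add_zero]
      exact integral_nonneg fun ξ => hf0 _
    linarith [le_max_right c 0]

end Cone

end AffineTriplet

end AffineMoments

/-! ### The positive maximum principle, from the martingale problem. -/

namespace AffineMoments

/-- Sampling h at the first grid point strictly to the right of s gives step functions converging to
h by right-continuity. It makes the generator along a path measurable in time. -/
theorem measurable_of_rightContinuous {h : ℝ≥0 → ℝ}
    (hh : ∀ t, ContinuousWithinAt h (Ici t) t) : Measurable h := by
  have hlt : ∀ (k : ℕ) (s : ℝ≥0), s < ((⌊((k:ℝ≥0) + 1) * s⌋₊ + 1 : ℕ) : ℝ≥0) / ((k:ℝ≥0) + 1) := by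
    intro k s
    rw [lt_div_iff₀ (by positivity), mul_comm]
    exact_mod_cast Nat.lt_floor_add_one _
  refine measurable_of_tendsto_metrizable
    (f := fun (k : ℕ) s => h (((⌊((k:ℝ≥0) + 1) * s⌋₊ + 1 : ℕ) : ℝ≥0) / ((k:ℝ≥0) + 1))) ?_ ?_
  · intro k
    exact (measurable_from_nat (f := fun m : ℕ => h (((m + 1 : ℕ) : ℝ≥0) / ((k:ℝ≥0) + 1)))).comp
      (Nat.measurable_floor.comp (measurable_const.mul measurable_id))
  · rw [tendsto_pi_nhds]
    intro s
    refine (hh s).tendsto.comp (tendsto_nhdsWithin_iff.2 ⟨?_, Eventually.of_forall fun k =>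
      (hlt k s).le⟩)
    have hle : ∀ k : ℕ, ((⌊((k:ℝ≥0) + 1) * s⌋₊ + 1 : ℕ) : ℝ≥0) / ((k:ℝ≥0) + 1) ≤
        s + 1 / ((k:ℝ≥0) + 1) := by
      intro k
      rw [div_le_iff₀ (by positivity), add_mul s, one_div, inv_mul_cancel₀ (by positivity),
        mul_comm s]
      push_cast
      gcongr
      exact Nat.floor_le zero_le
    refine tendsto_of_tendsto_of_tendsto_of_le_of_le tendsto_const_nhds ?_
      (fun k => (hlt k s).le) hle
    have : Tendsto (fun k : ℕ => s + 1 / ((k:ℝ≥0) + 1)) atTop (𝓝 (s + 0)) :=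
      tendsto_const_nhds.add tendsto_one_div_add_atTop_nhds_zero_nat
    rwa [add_zero] at this

namespace AffineTriplet

variable {d : ℕ} {C : ProperCone ℝ (RVec d)} (χ : AffineTriplet (C : Set (RVec d)))
  {Ω : Type*} [MeasurableSpace Ω] {Z : AffineProcess (C : Set (RVec d)) Ω}

/-- Positive maximum principle for nonnegative functions of compact support. -/
theorem generator_nonpos_of_nonneg (hχ : χ.IsCharacteristicsOf Z)
    (hspan : Submodule.span ℝ (C : Set (RVec d)) = ⊤)
    {f : RVec d → ℝ} (hf : ContDiff ℝ 2 f) (hfc : HasCompactSupport f) (hf0 : ∀ z, 0 ≤ f z)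
    {x : RVec d} (hx : x ∈ C) (hmax : ∀ z ∈ C, f z ≤ f x) : χ.generator f x ≤ 0 := by
  obtain ⟨c, hc, hcle⟩ := χ.exists_le_generator hspan hf hfc hf0
  obtain ⟨B, hB⟩ := hfc.exists_bound_of_continuous hf.continuous
  obtain ⟨σ, hσ, hmart⟩ := hχ ⟨x, hx⟩ f hf ⟨B, hB⟩
  set P := Z.P ⟨x, hx⟩ with hP
  have : IsProbabilityMeasure P := Z.isProb _
  -- The localized process is set to zero off {⊥ < σ n}. Since the localizing times tend to ⊤, some
  -- n gives this event positive probability.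
  obtain ⟨n, hn⟩ : ∃ n, P {ω | ⊥ < σ n ω} ≠ 0 := by
    by_contra! hcon
    have h1 : ∀ᵐ ω ∂P, ∀ n, ¬ ⊥ < σ n ω := ae_all_iff.2 fun n => by
      rw [ae_iff]; simpa only [not_not] using hcon n
    obtain ⟨ω, h1, h2⟩ := (h1.and hσ.tendsto_top).exists
    have h3 := h2.eventually (lt_mem_nhds (show (⊥ : WithTop ℝ≥0) < ⊤ from bot_lt_top))
    obtain ⟨m, hm⟩ := h3.exists
    exact h1 m hm
  set A := {ω | ⊥ < σ n ω} with hA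
  have hAm : MeasurableSet A := by
    have h1 := (hσ.isStoppingTime n) 0
    have h2 : A = {ω | σ n ω ≤ (0 : ℝ≥0)}ᶜ := by
      ext ω; simp only [hA, mem_ofPred_eq, mem_compl_iff, not_le]; rfl
    rw [h2]
    exact (Z.ℱ.le _ _ h1).compl
  set h : Ω → ℝ≥0 → ℝ := fun ω s => χ.generator f (Z.X s ω) with hh
  have hrc : ∀ ω t, ContinuousWithinAt (h ω) (Ici t) t := fun ω t =>
    ContinuousWithinAt.comp (f := fun s => (Z.X s ω : RVec d))
      ((χ.continuousOn_generator hspan hf hfc) (Z.X t ω) (Z.X t ω).2)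
      (Z.right_continuous ω t) fun s _ => (Z.X s ω).2
  have hmeas : ∀ ω, Measurable fun s : ℝ => h ω s.toNNReal := fun ω =>
    (measurable_of_rightContinuous (hrc ω)).comp measurable_real_toNNReal
  set M : ℝ≥0 → Ω → ℝ := fun t ω => f (Z.X t ω) - f (Z.X 0 ω) -
    ∫ s in (0 : ℝ)..(t : ℝ), h ω s.toNNReal with hM
  set N := stoppedProcess (fun i => A.indicator (M i)) (σ n) with hN
  have hNmart : Martingale N Z.ℱ P := hmart n
  have hN0 : ∀ ω, N 0 ω = 0 := by
    intro ω
    have : min ((0 : ℝ≥0) : WithTop ℝ≥0) (σ n ω) = ((0 : ℝ≥0) : WithTop ℝ≥0) :=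
      min_eq_left (by simp)
    simp only [hN, stoppedProcess, this, WithTop.untopA_eq_untop WithTop.coe_ne_top, WithTop.untop_coe]
    by_cases hω : ω ∈ A
    · simp [hω, hM]
    · simp [hω]
  have hNnot : ∀ t, ∀ ω, ω ∉ A → N t ω = 0 := fun t ω hω => by
    simp only [hN, stoppedProcess, indicator_of_notMem hω]
  have hNA : ∀ t : ℝ≥0, ∀ ω ∈ A, ∃ r ≤ t, N t ω = M r ω ∧ ((t : WithTop ℝ≥0) < σ n ω → r = t) := by
    intro t ω hω
    have hne : min ((t : ℝ≥0) : WithTop ℝ≥0) (σ n ω) ≠ ⊤ :=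
      ((min_le_left _ _).trans_lt (WithTop.coe_lt_top t)).ne
    obtain ⟨r, hr⟩ := WithTop.ne_top_iff_exists.1 hne
    refine ⟨r, ?_, ?_, fun hlt => ?_⟩
    · have := min_le_left ((t : ℝ≥0) : WithTop ℝ≥0) (σ n ω)
      rw [← hr] at this
      exact_mod_cast this
    · simp only [hN, stoppedProcess, indicator_of_mem hω, ← hr, WithTop.untopA_eq_untop WithTop.coe_ne_top, WithTop.untop_coe]
    · rw [min_eq_left hlt.le] at hr
      exact_mod_cast hr
  have hstart : ∀ᵐ ω ∂P, (Z.X 0 ω : RVec d) = x := by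
    have hm : MeasurableSet (Z.X 0 ⁻¹' {⟨x, hx⟩}) :=
      Z.ℱ.le 0 _ (Z.adapted 0 (measurableSet_singleton _))
    have := (mem_ae_iff_prob_eq_one hm).2 (Z.start ⟨x, hx⟩)
    filter_upwards [this] with ω hω
    have : Z.X 0 ω = ⟨x, hx⟩ := hω
    rw [this]
  have hMle : ∀ ω, (Z.X 0 ω : RVec d) = x → ∀ r : ℝ≥0, M r ω ≤
      - ∫ s in (0 : ℝ)..(r : ℝ), h ω s.toNNReal := by
    intro ω hω r
    have := hmax _ (Z.X r ω).2
    simp only [hM, hω]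
    linarith
  have hbound : ∀ ω, ∀ r : ℝ≥0, - (c * r) ≤ ∫ s in (0 : ℝ)..(r : ℝ), h ω s.toNNReal := by
    intro ω r
    by_cases hi : IntervalIntegrable (fun s : ℝ => h ω s.toNNReal) volume 0 r
    · have := intervalIntegral.integral_mono_on (r.2) (intervalIntegrable_const (c := -c)) hi
        fun s _ => hcle _ (Z.X s.toNNReal ω).2
      rw [intervalIntegral.integral_const] at this
      simpa [mul_comm] using this
    · rw [intervalIntegral.integral_undef hi]
      have : 0 ≤ c * (r : ℝ) := by positivity
      linarith
  have hupper : ∀ᵐ ω ∂P, ∀ t : ℝ≥0, N t ω ≤ A.indicator (fun _ => c * (t : ℝ)) ω := by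
    filter_upwards [hstart] with ω hω t
    by_cases hωA : ω ∈ A
    · obtain ⟨r, hrt, hr, -⟩ := hNA t ω hωA
      rw [hr, indicator_of_mem hωA]
      have h1 := hMle ω hω r
      have h2 := hbound ω r
      have h3 : c * (r : ℝ) ≤ c * (t : ℝ) := by gcongr
      linarith
    · rw [hNnot t ω hωA, indicator_of_notMem hωA]
  refine le_of_forall_pos_le_add fun ε hε => ?_
  rw [zero_add]
  -- For small t the stopping time has not yet acted and right-continuity keeps the generator within
  -- ε of its value at x; moreover f(X_t) ≤ f(x), so the compensator alone bounds N.
  have hsmall : ∀ᵐ ω ∂P, ω ∈ A → ∀ᶠ t : ℝ≥0 in 𝓝[>] 0,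
      N t ω ≤ - (t * (χ.generator f x - ε)) := by
    filter_upwards [hstart] with ω hω hωA
    have h0 : h ω 0 = χ.generator f x := by simp only [hh, hω]
    have h1 : ∀ᶠ s in 𝓝[≥] (0 : ℝ≥0), dist (h ω s) (h ω 0) < ε :=
      (hrc ω 0).eventually (Metric.ball_mem_nhds _ hε)
    obtain ⟨δ, hδ, hδle⟩ : ∃ δ : ℝ≥0, 0 < δ ∧ ∀ s < δ, dist (h ω s) (h ω 0) < ε := by
      obtain ⟨δ, hδ, hsub⟩ := mem_nhdsGE_iff_exists_Ico_subset.1 h1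
      exact ⟨δ, hδ, fun s hs => hsub ⟨zero_le, hs⟩⟩
    obtain ⟨η, hη, hηle⟩ : ∃ η : ℝ≥0, 0 < η ∧ ∀ t < η, (t : WithTop ℝ≥0) < σ n ω := by
      rcases h2 : σ n ω with _ | η
      · exact ⟨1, one_pos, fun t _ => WithTop.coe_lt_top t⟩
      · refine ⟨η, ?_, fun t ht => WithTop.coe_lt_coe.2 ht⟩
        have : (⊥ : WithTop ℝ≥0) < σ n ω := hωA
        rw [h2] at this
        exact WithTop.coe_lt_coe.1 this
    filter_upwards [Ioo_mem_nhdsGT (lt_min hδ hη)] with t ht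
    obtain ⟨r, -, hr, hrt⟩ := hNA t ω hωA
    rw [hrt (hηle t (ht.2.trans_le (min_le_right _ _)))] at hr
    rw [hr]
    refine (hMle ω hω t).trans (neg_le_neg ?_)
    have hclose : ∀ s ∈ Icc (0 : ℝ) t, |h ω s.toNNReal - χ.generator f x| < ε := by
      intro s hs
      rw [← h0, ← Real.dist_eq]
      refine hδle _ (lt_of_le_of_lt ?_ (ht.2.trans_le (min_le_left _ _)))
      exact Real.toNNReal_le_iff_le_coe.2 hs.2
    have hi : IntervalIntegrable (fun s : ℝ => h ω s.toNNReal) volume 0 t := by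
      refine (intervalIntegrable_iff_integrableOn_Icc_of_le t.2 (by simp)).2 ?_
      refine Measure.integrableOn_of_bounded (M := |χ.generator f x| + ε) (by simp)
        (hmeas ω).aestronglyMeasurable ?_
      refine (ae_restrict_iff' measurableSet_Icc).2 (Eventually.of_forall fun s hs => ?_)
      rw [Real.norm_eq_abs]
      have h2 := hclose s hs
      have h3 := abs_sub_abs_le_abs_sub (h ω s.toNNReal) (χ.generator f x)
      linarith
    have := intervalIntegral.integral_mono_on t.2
      (intervalIntegrable_const (c := χ.generator f x - ε)) hi
      fun s hs => by linarith [(abs_lt.1 (hclose s hs)).1]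
    rw [intervalIntegral.integral_const] at this
    simpa using this
  set τ : ℕ → ℝ≥0 := fun k => 1 / ((k : ℝ≥0) + 1) with hτ
  have hτpos : ∀ k, 0 < τ k := fun k => by positivity
  have hτlim : Tendsto τ atTop (𝓝[>] 0) :=
    tendsto_nhdsWithin_iff.2 ⟨tendsto_one_div_add_atTop_nhds_zero_nat,
      Eventually.of_forall hτpos⟩
  set H : ℕ → Ω → ℝ := fun k ω => A.indicator (fun _ => c) ω - N (τ k) ω / τ k with hH
  have hcint : Integrable (A.indicator fun _ => c) P := (integrable_const c).indicator hAm
  have hNint : ∀ t, Integrable (N t) P := fun t => hNmart.integrable t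
  have hHint : ∀ k, Integrable (H k) P := fun k => hcint.sub ((hNint _).div_const _)
  have hNzero : ∀ t, ∫ ω, N t ω ∂P = 0 := by
    intro t
    have h1 := hNmart.setIntegral_eq (zero_le (a := t)) (MeasurableSet.univ)
    simp only [setIntegral_univ, hN0, integral_zero] at h1
    exact h1.symm
  have hHval : ∀ k, ∫ ω, H k ω ∂P = c * P.real A := by
    intro k
    rw [integral_sub hcint ((hNint _).div_const _), integral_div, hNzero, zero_div, sub_zero,
      integral_indicator_const _ hAm, smul_eq_mul, mul_comm]
  have hHnn : ∀ k, 0 ≤ᵐ[P] H k := by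
    intro k
    filter_upwards [hupper] with ω hω
    have h1 := hω (τ k)
    have h2 : N (τ k) ω / τ k ≤ A.indicator (fun _ => c) ω := by
      rw [div_le_iff₀ (by exact_mod_cast hτpos k)]
      refine h1.trans (le_of_eq ?_)
      by_cases hωA : ω ∈ A <;> simp [hωA]
    simp only [Pi.zero_apply, hH]
    linarith
  have hfatou := lintegral_liminf_le' (u := atTop) (μ := P) (f := fun (k : ℕ) ω => ENNReal.ofReal (H k ω))
    fun k => (hHint k).1.aemeasurable.ennreal_ofReal
  have hval : ∀ k, ∫⁻ ω, ENNReal.ofReal (H k ω) ∂P = ENNReal.ofReal c * P A := by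
    intro k
    rw [← ofReal_integral_eq_lintegral_ofReal (hHint k) (hHnn k), hHval,
      ENNReal.ofReal_mul hc, ofReal_measureReal]
  simp only [hval, liminf_const] at hfatou
  have hlow : ∀ᵐ ω ∂P, A.indicator (fun _ => ENNReal.ofReal (c + (χ.generator f x - ε))) ω ≤
      liminf (fun k => ENNReal.ofReal (H k ω)) atTop := by
    filter_upwards [hsmall] with ω hω
    by_cases hωA : ω ∈ A
    · rw [indicator_of_mem hωA]
      refine le_liminf_of_le (by isBoundedDefault) ?_
      filter_upwards [hτlim.eventually (hω hωA)] with k hk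
      refine ENNReal.ofReal_le_ofReal ?_
      simp only [hH, indicator_of_mem hωA]
      have h1 : N (τ k) ω / τ k ≤ -(χ.generator f x - ε) := by
        rw [div_le_iff₀ (by exact_mod_cast hτpos k)]
        linarith
      linarith
    · rw [indicator_of_notMem hωA]; exact zero_le
  have hfin := (lintegral_mono_ae hlow).trans hfatou
  rw [lintegral_indicator_const hAm] at hfin
  have := (ENNReal.mul_le_mul_iff_left hn (measure_ne_top P A)).1 hfin
  rw [ENNReal.ofReal_le_ofReal_iff hc] at this
  linarith

end AffineTriplet

end AffineMoments

namespace AffineMoments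

/-! ### The Lévy–Khintchine integrand and the moment domain. -/

section ExpIncrement

variable {d : ℕ}

/-- The integrand of the Lévy–Khintchine function. -/
noncomputable def expIncrement (u : CVec d) (ξ : RVec d) : ℂ :=
  Complex.exp (cpair u ξ) - 1 - cpair u (trunc ξ)

theorem measurable_expIncrement (u : CVec d) : Measurable (expIncrement u) :=
  ((Complex.continuous_exp.comp (continuous_cpair_right u)).measurable.sub_const 1).sub
    ((continuous_cpair_right u).measurable.comp measurable_trunc)

theorem expIncrement_toC (y ξ : RVec d) : expIncrement (toC y) ξ =
    ((Real.exp (inner ℝ ξ y) - 1 - inner ℝ (trunc ξ) y : ℝ) : ℂ) := by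
  simp only [expIncrement, cpair_toC, real_inner_comm y]
  push_cast
  rfl

theorem norm_exp_sub_one_sub_le (w : ℂ) :
    ‖Complex.exp w - 1 - w‖ ≤ ‖w‖ ^ 2 * Real.exp ‖w‖ := by
  have := Complex.norm_exp_sub_sum_le_norm_mul_exp w 2
  simpa [Finset.sum_range_succ, sub_sub] using this

theorem norm_expIncrement_le (u : CVec d) (ξ : RVec d) : ‖expIncrement u ξ‖ ≤
    (‖u‖ ^ 2 * Real.exp ‖u‖ + 1) * levyWeight ξ +
      {ξ : RVec d | 1 ≤ ‖ξ‖}.indicator (fun ξ => Real.exp (inner ℝ (rePart u) ξ)) ξ := by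
  have hind : 0 ≤ {ξ : RVec d | 1 ≤ ‖ξ‖}.indicator
      (fun ξ => Real.exp (inner ℝ (rePart u) ξ)) ξ :=
    indicator_nonneg (fun _ _ => (Real.exp_pos _).le) _
  rcases le_or_gt ‖ξ‖ 1 with h | h
  · rw [expIncrement, trunc_of_le h, levyWeight_of_le h]
    refine (norm_exp_sub_one_sub_le _).trans ?_
    have h1 := norm_cpair_le u ξ
    have h2 : ‖cpair u ξ‖ ≤ ‖u‖ := h1.trans (mul_le_of_le_one_right (norm_nonneg _) h)
    calc ‖cpair u ξ‖ ^ 2 * Real.exp ‖cpair u ξ‖ ≤ (‖u‖ * ‖ξ‖) ^ 2 * Real.exp ‖u‖ := by gcongr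
      _ = ‖u‖ ^ 2 * Real.exp ‖u‖ * ‖ξ‖ ^ 2 := by ring
      _ ≤ (‖u‖ ^ 2 * Real.exp ‖u‖ + 1) * ‖ξ‖ ^ 2 := by gcongr; linarith
      _ ≤ _ := by linarith
  · rw [expIncrement, trunc_of_gt h, levyWeight_of_ge h.le, cpair_zero, sub_zero,
      indicator_of_mem (show ξ ∈ {ξ : RVec d | 1 ≤ ‖ξ‖} from h.le)]
    refine (norm_sub_le _ _).trans ?_
    rw [Complex.norm_exp, cpair_re, norm_one]
    have : 0 ≤ ‖u‖ ^ 2 * Real.exp ‖u‖ := by positivity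
    linarith

end ExpIncrement

namespace AffineTriplet

section Domain

variable {d : ℕ} {D : Set (RVec d)} (χ : AffineTriplet D)

theorem measurableSet_one_le_norm : MeasurableSet {ξ : RVec d | 1 ≤ ‖ξ‖} :=
  measurableSet_le measurable_const measurable_norm

theorem integrable_indicator_exp {x y : RVec d} (hx : x ∈ D) (hy : y ∈ χ.expDomain) :
    Integrable ({ξ : RVec d | 1 ≤ ‖ξ‖}.indicator fun ξ => Real.exp (inner ℝ y ξ)) (χ.K x) := by
  have hc : Continuous fun ξ : RVec d => Real.exp (inner ℝ y ξ) := by fun_prop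
  rw [integrable_indicator_iff measurableSet_one_le_norm]
  refine ⟨hc.aestronglyMeasurable, ?_⟩
  rw [hasFiniteIntegral_iff_ofReal (Eventually.of_forall fun _ => (Real.exp_pos _).le)]
  exact hy x hx

theorem integrable_expIncrement {x : RVec d} (hx : x ∈ D) {u : CVec d}
    (hu : rePart u ∈ χ.expDomain) : Integrable (expIncrement u) (χ.K x) :=
  (((χ.integrable_levyWeight hx).const_mul _).add (χ.integrable_indicator_exp hx hu)).mono'
    (measurable_expIncrement u).aestronglyMeasurable
    (Eventually.of_forall (norm_expIncrement_le u))

theorem complexRx_toC (x y : RVec d) : χ.complexRx x (toC y) = (χ.realRx x y : ℂ) := by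
  have : ∫ ξ, (Complex.exp (cpair (toC y) ξ) - 1 - cpair (toC y) (trunc ξ)) ∂(χ.K x) =
      ((∫ ξ, (Real.exp (inner ℝ ξ y) - 1 - inner ℝ (trunc ξ) y) ∂(χ.K x) : ℝ) : ℂ) := by
    rw [← integral_complex_ofReal]
    exact integral_congr_ae (Eventually.of_forall fun ξ => expIncrement_toC y ξ)
  rw [complexRx, this, realRx, cpair_toC, real_inner_comm y]
  simp only [toC_apply]
  push_cast
  rfl

theorem zero_mem_expDomain : (0 : RVec d) ∈ χ.expDomain := by
  intro x hx
  have h := (χ.integrable_levyWeight hx).lintegral_lt_top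
  refine lt_of_le_of_lt ?_ h
  rw [← lintegral_indicator measurableSet_one_le_norm]
  refine lintegral_mono fun ξ => ?_
  by_cases hξ : 1 ≤ ‖ξ‖
  · rw [indicator_of_mem (show ξ ∈ {ξ : RVec d | 1 ≤ ‖ξ‖} from hξ), levyWeight_of_ge hξ]
    simp
  · rw [indicator_of_notMem (show ξ ∉ {ξ : RVec d | 1 ≤ ‖ξ‖} from hξ)]; exact zero_le

end Domain

/-! ### Jumps in the cone and quasi-monotonicity. -/

section Marginals

variable {d : ℕ} {C : ProperCone ℝ (RVec d)} (χ : AffineTriplet (C : Set (RVec d)))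
  {Ω : Type*} [MeasurableSpace Ω] {Z : AffineProcess (C : Set (RVec d)) Ω}

/-- Positive maximum principle for functions of compact support that are nonpositive on the state
space. -/
theorem generator_nonpos_of_nonpos (hχ : χ.IsCharacteristicsOf Z)
    (hspan : Submodule.span ℝ (C : Set (RVec d)) = ⊤)
    {f : RVec d → ℝ} (hf : ContDiff ℝ 2 f) (hfc : HasCompactSupport f)
    {x : RVec d} (hx : x ∈ C) (hfx : f x = 0) (hle : ∀ z ∈ C, f z ≤ 0) :
    χ.generator f x ≤ 0 := by
  obtain ⟨c, hc⟩ := exists_norm_le_of_compactSupport hf.continuous hfc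
  have hc0 : 0 ≤ c := (norm_nonneg _).trans (hc 0)
  obtain ⟨r, hr⟩ := (hfc.isBounded).subset_closedBall (0 : RVec d)
  -- Adding c · b n makes the function nonnegative everywhere, leaves its derivatives at x
  -- unchanged, and keeps x a maximum point on the cone. As the bumps spread out, the correction ∫ G
  -- n to the generator vanishes by dominated convergence.
  let b : ℕ → ContDiffBump (0 : RVec d) := fun n =>
    ⟨max r ‖x‖ + 1 + n, max r ‖x‖ + 2 + n, by
      have := (norm_nonneg x).trans (le_max_right r ‖x‖); positivity, by linarith⟩
  have hb1 : ∀ (n : ℕ) (z : RVec d), ‖z‖ ≤ max r ‖x‖ + 1 + n → b n z = 1 := fun n z hz =>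
    (b n).one_of_mem_closedBall (by simpa using hz)
  obtain ⟨k, hk, hkle⟩ := exists_abs_jumpIncrement_le hf hfc
  have hfint : Integrable (jumpIncrement f x) (χ.K x) :=
    χ.integrable_of_norm_le hx (measurable_jumpIncrement hf.continuous x).aestronglyMeasurable k
      (hkle x)
  set G : ℕ → RVec d → ℝ := fun n ξ => c * (b n (x + ξ) - 1) with hG
  have hGle : ∀ n ξ, ‖G n ξ‖ ≤ c * levyWeight ξ := by
    intro n ξ
    rw [hG, Real.norm_eq_abs, abs_mul, abs_of_nonneg hc0]
    refine mul_le_mul_of_nonneg_left ?_ hc0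
    rcases le_or_gt ‖ξ‖ 1 with h | h
    · rw [hb1 n (x + ξ) (by
        have := norm_add_le x ξ
        have := le_max_right r ‖x‖
        have : (0:ℝ) ≤ n := by positivity
        linarith), sub_self, abs_zero]
      exact levyWeight_nonneg ξ
    · rw [levyWeight_of_ge h.le, abs_le]
      exact ⟨by linarith [(b n).nonneg (x := x + ξ)], by linarith [(b n).le_one (x := x + ξ)]⟩
  have hGm : ∀ n, AEStronglyMeasurable (G n) (χ.K x) := fun n =>
    (continuous_const.mul (((b n).continuous.comp (continuous_const.add continuous_id)).sub
      continuous_const)).aestronglyMeasurable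
  have hGint : ∀ n, Integrable (G n) (χ.K x) := fun n =>
    χ.integrable_of_norm_le hx (hGm n) c (hGle n)
  have hineq : ∀ n, χ.generator f x + ∫ ξ, G n ξ ∂(χ.K x) ≤ 0 := by
    intro n
    have hev : (fun z => c * b n z + f z) =ᶠ[𝓝 x] fun z => c + f z := by
      have : Metric.ball x 1 ∈ 𝓝 x := Metric.ball_mem_nhds x one_pos
      filter_upwards [this] with z hz
      rw [hb1 n z, mul_one]
      rw [Metric.mem_ball, dist_eq_norm] at hz
      have h1 := norm_le_norm_add_norm_sub' z x
      have h2 := le_max_right r ‖x‖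
      have : (0:ℝ) ≤ n := by positivity
      linarith
    have hd : fderiv ℝ (fun z => c * b n z + f z) =ᶠ[𝓝 x] fderiv ℝ f := by
      refine hev.fderiv.trans (Eventually.of_forall fun z => ?_)
      simp only [fderiv_const_add]
    have := χ.generator_nonpos_of_nonneg hχ hspan (f := fun z => c * b n z + f z)
      ((contDiff_const.mul (b n).contDiff).add hf)
      (((b n).hasCompactSupport.mul_left).add hfc) (fun z => ?_) hx (fun z hz => ?_)
    · have h1 : χ.generator (fun z => c * b n z + f z) x =
          χ.generator f x + ∫ ξ, G n ξ ∂(χ.K x) := by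
        have h2 : ∀ ξ, (c * b n (x + ξ) + f (x + ξ)) - (c * b n x + f x) -
            fderiv ℝ f x (trunc ξ) = G n ξ + jumpIncrement f x ξ := by
          intro ξ
          rw [hb1 n x (by
            have := le_max_right r ‖x‖
            have : (0:ℝ) ≤ n := by positivity
            linarith)]
          simp only [hG, jumpIncrement]
          ring
        simp only [generator, hd.eq_of_nhds, hd.fderiv_eq, h2]
        rw [integral_add (hGint n) hfint]
        simp only [jumpIncrement]
        ring
      rwa [h1] at this
    · by_cases hz : z ∈ tsupport f
      · have h1 : ‖z‖ ≤ r := by simpa using hr hz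
        rw [hb1 n z (by
          have := le_max_left r ‖x‖
          have : (0:ℝ) ≤ n := by positivity
          linarith)]
        have := (abs_le.1 (hc z)).1
        linarith
      · rw [image_eq_zero_of_notMem_tsupport hz, add_zero]
        exact mul_nonneg hc0 (b n).nonneg
    · rw [hb1 n x (by
        have := le_max_right r ‖x‖
        have : (0:ℝ) ≤ n := by positivity
        linarith), hfx]
      have := hle z hz
      have h2 : c * b n z ≤ c * 1 := mul_le_mul_of_nonneg_left (b n).le_one hc0
      linarith
  have hlim : Tendsto (fun n => ∫ ξ, G n ξ ∂(χ.K x)) atTop (𝓝 (∫ ξ, (0 : ℝ) ∂(χ.K x))) := by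
    refine tendsto_integral_of_dominated_convergence (fun ξ => c * levyWeight ξ) hGm
      ((χ.integrable_levyWeight hx).const_mul c) (fun n => Eventually.of_forall (hGle n))
      (Eventually.of_forall fun ξ => ?_)
    refine tendsto_const_nhds.congr' ?_
    obtain ⟨m, hm⟩ := exists_nat_ge ‖x + ξ‖
    filter_upwards [eventually_ge_atTop m] with n hn
    simp only [hG]
    rw [hb1 n (x + ξ)]
    · simp
    · have : (m : ℝ) ≤ n := by exact_mod_cast hn
      have := (norm_nonneg x).trans (le_max_right r ‖x‖)
      linarith
  rw [integral_zero] at hlim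
  have := le_of_tendsto (hlim.const_add (χ.generator f x)) (Eventually.of_forall hineq)
  linarith

/-- A nonnegative bump supported near a point x + ζ outside `C` vanishes on `C` and near x, so the
maximum principle reduces to ∫ b(x + ξ) K(x, dξ) ≤ 0. -/
theorem K_add_notMem_eq_zero (hχ : χ.IsCharacteristicsOf Z)
    (hspan : Submodule.span ℝ (C : Set (RVec d)) = ⊤) {x : RVec d} (hx : x ∈ C) :
    χ.K x {ξ | x + ξ ∉ C} = 0 := by
  refine measure_null_of_locally_null _ fun ζ hζ => ?_
  have hopen : IsOpen {z : RVec d | z ∉ C} := C.isClosed.isOpen_compl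
  obtain ⟨r, hr, hball⟩ := Metric.isOpen_iff.1 hopen (x + ζ) hζ
  let b : ContDiffBump (x + ζ) := ⟨r / 4, r / 2, by linarith, by linarith⟩
  have hts : ∀ z ∈ C, z ∉ tsupport (b : RVec d → ℝ) := fun z hz h => by
    rw [b.tsupport_eq] at h
    exact hball (Metric.closedBall_subset_ball (half_lt_self hr) h) hz
  have hbC : ∀ z ∈ C, b z = 0 := fun z hz => image_eq_zero_of_notMem_tsupport (hts z hz)
  have h1 : fderiv ℝ b x = 0 :=
    image_eq_zero_of_notMem_tsupport (fun h => hts x hx (tsupport_fderiv_subset ℝ h))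
  have h2 : fderiv ℝ (fderiv ℝ b) x = 0 :=
    image_eq_zero_of_notMem_tsupport (fun h =>
      hts x hx (tsupport_fderiv_subset ℝ (tsupport_fderiv_subset ℝ h)))
  have hgen := χ.generator_nonpos_of_nonpos hχ hspan (f := b) b.contDiff b.hasCompactSupport hx
    (hbC x hx) fun z hz => (hbC z hz).le
  obtain ⟨k, -, hk⟩ := exists_abs_jumpIncrement_le (f := b) b.contDiff b.hasCompactSupport
  have hint := χ.integrable_of_norm_le hx
    (measurable_jumpIncrement (f := b) b.continuous x).aestronglyMeasurable k (hk x)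
  have hjump : jumpIncrement b x = fun ξ => b (x + ξ) := by
    ext ξ
    simp [jumpIncrement, hbC x hx, h1]
  rw [hjump] at hint
  simp only [generator, hbC x hx, h1, h2, zero_apply, mul_zero,
    Finset.sum_const_zero, sub_zero, zero_add, add_zero] at hgen
  have hzero : ∫ ξ, b (x + ξ) ∂(χ.K x) = 0 :=
    le_antisymm hgen (integral_nonneg fun ξ => b.nonneg)
  rw [integral_eq_zero_iff_of_nonneg (fun ξ => b.nonneg) hint] at hzero
  refine ⟨Metric.ball ζ (r / 2), mem_nhdsWithin_of_mem_nhds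
    (Metric.ball_mem_nhds _ (half_pos hr)), ?_⟩
  refine measure_mono_null (fun ξ hξ => ?_) (ae_iff.1 hzero)
  refine (b.pos_of_mem_ball (x := x + ξ) ?_).ne'
  rw [Metric.mem_ball, dist_add_left]
  exact hξ

/-- The jumps of the process are almost surely elements of the cone. -/
theorem ae_mem_cone (hχ : χ.IsCharacteristicsOf Z)
    (hspan : Submodule.span ℝ (C : Set (RVec d)) = ⊤) {x : RVec d} (hx : x ∈ C) :
    ∀ᵐ ξ ∂(χ.K x), ξ ∈ C := by
  -- By affinity K(x / (n + 1)) dominates a positive multiple of K(x), so K(x)-almost every ξ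
  -- satisfies x / (n + 1) + ξ ∈ C; closedness of the cone removes the shift.
  have hs : ∀ n : ℕ, ∀ᵐ ξ ∂(χ.K x), (1 / ((n : ℝ) + 1)) • x + ξ ∈ C := by
    intro n
    have h0 : 0 < 1 / ((n : ℝ) + 1) := by positivity
    have h1 : 1 / ((n : ℝ) + 1) ≤ 1 := by
      rw [div_le_one (by positivity)]; linarith [(Nat.cast_nonneg n : (0:ℝ) ≤ n)]
    have h2 := χ.K_add_notMem_eq_zero hχ hspan (C.smul_mem hx h0.le)
    have h3 := χ.K_affine x hx 0 C.zero_mem _ h0.le h1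
    rw [smul_zero, add_zero] at h3
    rw [h3, Measure.add_apply, Measure.smul_apply, smul_eq_mul, add_eq_zero, mul_eq_zero] at h2
    rcases h2.1 with h4 | h4
    · exact absurd h4 (by simpa using h0)
    · exact h4
  filter_upwards [ae_all_iff.2 hs] with ξ hξ
  have hlim : Tendsto (fun n : ℕ => (1 / ((n : ℝ) + 1)) • x + ξ) atTop (𝓝 ((0 : ℝ) • x + ξ)) :=
    (tendsto_one_div_add_atTop_nhds_zero_nat.smul_const x).add_const ξ
  rw [zero_smul, zero_add] at hlim
  exact C.isClosed.mem_of_tendsto hlim (Eventually.of_forall hξ)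

/-- The jumps lie in the cone, so the exponents satisfy ⟨y, ξ⟩ ≤ ⟨y', ξ⟩ almost everywhere. -/
theorem mem_expDomain_of_le (hχ : χ.IsCharacteristicsOf Z)
    (hspan : Submodule.span ℝ (C : Set (RVec d)) = ⊤) {y y' : RVec d}
    (hy' : y' ∈ χ.expDomain) (hle : y' - y ∈ ProperCone.innerDual (C : Set (RVec d))) :
    y ∈ χ.expDomain := by
  intro x hx
  refine lt_of_le_of_lt (lintegral_mono_ae (ae_restrict_of_ae ?_)) (hy' x hx)
  filter_upwards [χ.ae_mem_cone hχ hspan hx] with ξ hξ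
  refine ENNReal.ofReal_le_ofReal (Real.exp_le_exp.2 ?_)
  have := hle hξ
  rw [innerₗ_apply_apply, inner_sub_right] at this
  rw [real_inner_comm ξ y, real_inner_comm ξ y']
  linarith

theorem mem_interior_expDomain_of_le (hχ : χ.IsCharacteristicsOf Z)
    (hspan : Submodule.span ℝ (C : Set (RVec d)) = ⊤) {y y' : RVec d}
    (hy' : y' ∈ interior χ.expDomain)
    (hle : y' - y ∈ ProperCone.innerDual (C : Set (RVec d))) : y ∈ interior χ.expDomain := by
  rw [mem_interior_iff_mem_nhds] at hy' ⊢
  have h : Tendsto (fun z => z + (y' - y)) (𝓝 y) (𝓝 y') := by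
    have : Tendsto (fun z => z + (y' - y)) (𝓝 y) (𝓝 (y + (y' - y))) :=
      tendsto_id.add_const _
    rwa [add_sub_cancel] at this
  filter_upwards [h hy'] with z hz
  exact χ.mem_expDomain_of_le hχ hspan hz (by rwa [add_sub_cancel_left])

theorem fderiv_exp_inner (y : RVec d) : fderiv ℝ (fun z => Real.exp (inner ℝ y z)) =
    fun z => Real.exp (inner ℝ y z) • innerSL ℝ y := by
  ext1 z
  exact ((innerSL ℝ y).hasFDerivAt.exp (x := z)).fderiv

theorem fderiv_fderiv_exp_inner_apply (y z v w : RVec d) :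
    fderiv ℝ (fderiv ℝ fun z => Real.exp (inner ℝ y z)) z v w =
      Real.exp (inner ℝ y z) * (inner ℝ y v * inner ℝ y w) := by
  rw [fderiv_exp_inner]
  have h : HasFDerivAt (fun z => Real.exp (inner ℝ y z) • innerSL ℝ y)
      ((Real.exp (inner ℝ y z) • innerSL ℝ y).smulRight (innerSL ℝ y)) z :=
    ((innerSL ℝ y).hasFDerivAt.exp (x := z)).smul_const (innerSL ℝ y)
  rw [h.fderiv]
  simp [mul_assoc]

/-- Quasi-monotonicity of the Lévy–Khintchine functions. -/
theorem realRx_le_of_le (hχ : χ.IsCharacteristicsOf Z)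
    (hspan : Submodule.span ℝ (C : Set (RVec d)) = ⊤) {y y' x : RVec d}
    (hy' : y' ∈ χ.expDomain) (hle : y' - y ∈ ProperCone.innerDual (C : Set (RVec d)))
    (hx : x ∈ C) (horth : inner ℝ (y' - y) x = 0) : χ.realRx x y ≤ χ.realRx x y' := by
  have hy : y ∈ χ.expDomain := χ.mem_expDomain_of_le hχ hspan hy' hle
  set e : RVec d → RVec d → ℝ := fun y z => Real.exp (inner ℝ y z) with he
  have hec : ∀ y, ContDiff ℝ 2 (e y) := fun y =>
    (innerSL ℝ y).contDiff.exp
  have hex : e y x = e y' x := by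
    rw [inner_sub_left, sub_eq_zero] at horth
    simp only [he, horth]
  set κ := e y x with hκ
  have hκ0 : 0 < κ := Real.exp_pos _
  -- E ≤ 0 on the cone and E x = 0, while its generator at x is κ (ℛ_x(y) - ℛ_x(y')). The
  -- exponentials are not compactly supported, so E is multiplied by bumps that are removed by
  -- dominated convergence.
  set E : RVec d → ℝ := fun z => e y z - e y' z with hE
  have hEc : ContDiff ℝ 2 E := (hec y).sub (hec y')
  have hED : fderiv ℝ E = fun z => fderiv ℝ (e y) z - fderiv ℝ (e y') z := by
    ext1 z
    exact fderiv_fun_sub ((hec y).differentiable (by norm_num) z)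
      ((hec y').differentiable (by norm_num) z)
  have hE1 : ∀ v, fderiv ℝ E x v = κ * (inner ℝ v y - inner ℝ v y') := by
    intro v
    rw [hED]
    simp only [he, fderiv_exp_inner]
    simp only [sub_apply, smul_apply, innerSL_apply_apply, smul_eq_mul]
    change e y x * _ - e y' x * _ = _
    rw [← hex, real_inner_comm v, real_inner_comm v]
    ring
  have hE2 : ∀ i j : Fin d, fderiv ℝ (fderiv ℝ E) x (EuclideanSpace.single i 1)
      (EuclideanSpace.single j 1) = κ * (y i * y j - y' i * y' j) := by
    intro i j
    have hd : ∀ y, Differentiable ℝ (fderiv ℝ (e y)) := fun y =>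
      ((hec y).fderiv_right (m := 1) (by norm_num)).differentiable (by norm_num)
    rw [hED, fderiv_fun_sub (hd y x) (hd y' x)]
    simp only [sub_apply, he, fderiv_fderiv_exp_inner_apply]
    change e y x * _ - e y' x * _ = _
    rw [← hex]
    simp only [EuclideanSpace.inner_single_right]
    simp
    ring
  let b : ℕ → ContDiffBump x := fun n => ⟨1 + n, 2 + n, by positivity, by linarith⟩
  have hb1 : ∀ (n : ℕ) (ξ : RVec d), ‖ξ‖ ≤ 1 + n → b n (x + ξ) = 1 := fun n ξ h =>
    (b n).one_of_mem_closedBall (by simpa using h)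
  set I : RVec d → RVec d → ℝ := fun y ξ => Real.exp (inner ℝ ξ y) - 1 - inner ℝ (trunc ξ) y
    with hI
  have hEx : ∀ ξ, E (x + ξ) - fderiv ℝ E x (trunc ξ) = κ * (I y ξ - I y' ξ) := by
    intro ξ
    rw [hE1]
    have h1 : ∀ y, e y (x + ξ) = e y x * Real.exp (inner ℝ ξ y) := fun y => by
      simp only [he, inner_add_right, Real.exp_add, real_inner_comm]
    simp only [hE, hI, h1, ← hex]
    ring
  have hI' : ∀ y ∈ χ.expDomain, Integrable (I y) (χ.K x) := by
    intro y hy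
    have := (χ.integrable_expIncrement hx (u := toC y) (by rwa [rePart_toC])).re
    refine this.congr (Eventually.of_forall fun ξ => ?_)
    simp only [expIncrement_toC]
    rfl
  have hJ : Integrable (fun ξ => κ * (I y ξ - I y' ξ)) (χ.K x) :=
    ((hI' y hy).sub (hI' y' hy')).const_mul κ
  have hbm : ∀ n, Continuous fun ξ => b n (x + ξ) := fun n =>
    (b n).continuous.comp (continuous_const.add continuous_id)
  have hble : ∀ n, ∀ ξ, ‖b n (x + ξ) * (κ * (I y ξ - I y' ξ))‖ ≤ ‖κ * (I y ξ - I y' ξ)‖ := by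
    intro n ξ
    rw [norm_mul]
    refine mul_le_of_le_one_left (norm_nonneg _) ?_
    rw [Real.norm_eq_abs, abs_of_nonneg (b n).nonneg]
    exact (b n).le_one
  have hineq : ∀ n, κ * ((1 / 2 : ℝ) * ∑ i, ∑ j, χ.a x i j * (y i * y j - y' i * y' j)) +
      κ * (inner ℝ (χ.b x) y - inner ℝ (χ.b x) y') +
      ∫ ξ, b n (x + ξ) * (κ * (I y ξ - I y' ξ)) ∂(χ.K x) ≤ 0 := by
    intro n
    have hev : (fun z => b n z * E z) =ᶠ[𝓝 x] E := by
      filter_upwards [(b n).eventuallyEq_one] with z hz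
      rw [hz, Pi.one_apply, one_mul]
    have hfx : b n x * E x = 0 := by rw [hE]; simp only; rw [← hex, sub_self, mul_zero]
    have := χ.generator_nonpos_of_nonpos hχ hspan (f := fun z => b n z * E z)
      ((b n).contDiff.mul hEc) (b n).hasCompactSupport.mul_right hx hfx fun z hz => ?_
    -- Small jumps stay where b n = 1 and large jumps have zero truncation, so the bump multiplies
    -- the whole increment.
    · have h2 : ∀ ξ, b n (x + ξ) * E (x + ξ) - b n x * E x - fderiv ℝ E x (trunc ξ) =
          b n (x + ξ) * (κ * (I y ξ - I y' ξ)) := by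
        intro ξ
        rw [hfx, ← hEx]
        rcases le_or_gt ‖ξ‖ 1 with h | h
        · rw [hb1 n ξ (by have : (0:ℝ) ≤ n := by positivity
                          linarith)]
          ring
        · rw [trunc_of_gt h, map_zero]; ring
      simp only [generator, hev.fderiv.eq_of_nhds, hev.fderiv.fderiv_eq, hE1, hE2] at this
      refine le_of_eq_of_le ?_ this
      congr 2
      · rw [mul_left_comm, Finset.mul_sum]
        congr 1
        refine Finset.sum_congr rfl fun i _ => ?_
        rw [Finset.mul_sum]
        exact Finset.sum_congr rfl fun j _ => by ring
      · ext1 ξ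
        rw [← h2, hE1]
    · refine mul_nonpos_of_nonneg_of_nonpos (b n).nonneg (sub_nonpos.2 (Real.exp_le_exp.2 ?_))
      have := hle hz
      rw [innerₗ_apply_apply, inner_sub_right] at this
      rw [real_inner_comm z y, real_inner_comm z y']
      linarith
  have hlim : Tendsto (fun n => ∫ ξ, b n (x + ξ) * (κ * (I y ξ - I y' ξ)) ∂(χ.K x)) atTop
      (𝓝 (∫ ξ, κ * (I y ξ - I y' ξ) ∂(χ.K x))) := by
    refine tendsto_integral_of_dominated_convergence _
      (fun n => (hbm n).aestronglyMeasurable.mul hJ.1) hJ.norm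
      (fun n => Eventually.of_forall (hble n)) (Eventually.of_forall fun ξ => ?_)
    refine tendsto_const_nhds.congr' ?_
    obtain ⟨m, hm⟩ := exists_nat_ge ‖ξ‖
    filter_upwards [eventually_ge_atTop m] with n hn
    rw [hb1 n ξ, one_mul]
    have : (m : ℝ) ≤ n := by exact_mod_cast hn
    linarith
  have hfin := le_of_tendsto (hlim.const_add _) (Eventually.of_forall hineq)
  rw [integral_const_mul, integral_sub (hI' y hy) (hI' y' hy'), ← mul_add, ← mul_add] at hfin
  have := nonpos_of_mul_nonpos_right hfin hκ0
  have hsum : ∑ i, ∑ j, χ.a x i j * (y i * y j - y' i * y' j) =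
      (∑ i, ∑ j, y i * χ.a x i j * y j) - ∑ i, ∑ j, y' i * χ.a x i j * y' j := by
    rw [← Finset.sum_sub_distrib]
    refine Finset.sum_congr rfl fun i _ => ?_
    rw [← Finset.sum_sub_distrib]
    exact Finset.sum_congr rfl fun j _ => by ring
  rw [hsum] at this
  simp only [realRx]
  linarith

end Marginals

end AffineTriplet

end AffineMoments

/-! ### Regularity of the Lévy–Khintchine functions. -/

namespace AffineMoments

theorem exists_lipschitzOnWith_of_eventually {E F : Type*} [NormedAddCommGroup E]
    [NormedAddCommGroup F] {f : E → F} {u : E} {L : ℝ≥0}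
    (h : ∀ᶠ p : E × E in 𝓝 (u, u), ‖f p.1 - f p.2‖ ≤ L * ‖p.1 - p.2‖) :
    ∃ s ∈ 𝓝 u, LipschitzOnWith L f s := by
  rw [nhds_prod_eq] at h
  obtain ⟨s, hs, hsub⟩ := (𝓝 u).basis_sets.prod_self.mem_iff.1 h
  refine ⟨s, hs, LipschitzOnWith.of_dist_le_mul fun p hp q hq => ?_⟩
  rw [dist_eq_norm, dist_eq_norm]
  exact hsub (show (p, q) ∈ s ×ˢ s from ⟨hp, hq⟩)

namespace AffineTriplet

section Form

variable {d : ℕ} {D : Set (RVec d)} (χ : AffineTriplet D)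

/-- The bilinear form of the diffusion matrix. -/
noncomputable def diffForm (x : RVec d) : RVec d →ₗ[ℝ] RVec d →ₗ[ℝ] ℝ :=
  LinearMap.mk₂ ℝ (fun v w => ∑ i, ∑ j, v i * χ.a x i j * w j)
    (fun v v' w => by simp [add_mul, Finset.sum_add_distrib])
    (fun c v w => by simp [Finset.mul_sum, mul_assoc])
    (fun v w w' => by simp [mul_add, Finset.sum_add_distrib])
    (fun c v w => by
      simp only [Finset.mul_sum, PiLp.smul_apply, smul_eq_mul]
      exact Finset.sum_congr rfl fun i _ => Finset.sum_congr rfl fun j _ => by ring)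

theorem diffForm_apply (x v w : RVec d) :
    χ.diffForm x v w = ∑ i, ∑ j, v i * χ.a x i j * w j := rfl

theorem diffForm_symm {x : RVec d} (hx : x ∈ D) (v w : RVec d) :
    χ.diffForm x v w = χ.diffForm x w v := by
  have h : ∀ i j, χ.a x i j = χ.a x j i := fun i j => by
    have := (χ.a_posSemidef x hx).isHermitian.apply j i
    simpa using this
  rw [diffForm_apply, diffForm_apply, Finset.sum_comm]
  exact Finset.sum_congr rfl fun i _ => Finset.sum_congr rfl fun j _ => by rw [h i j]; ring

theorem diffForm_eq_dotProduct (x v w : RVec d) :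
    χ.diffForm x v w = (v : Fin d → ℝ) ⬝ᵥ (χ.a x).mulVec w := by
  simp only [diffForm_apply, dotProduct, Matrix.mulVec, Finset.mul_sum, mul_assoc]

theorem diffForm_nonneg {x : RVec d} (hx : x ∈ D) (v : RVec d) : 0 ≤ χ.diffForm x v v := by
  rw [diffForm_eq_dotProduct]
  simpa using (χ.a_posSemidef x hx).dotProduct_mulVec_nonneg (v : Fin d → ℝ)

/-- Cauchy–Schwarz for a positive semidefinite form: an isotropic vector lies in the kernel. The
coefficient in the test vector is chosen so that the form would take the value -1 there. -/
theorem diffForm_eq_zero {x : RVec d} (hx : x ∈ D) {v : RVec d} (hv : χ.diffForm x v v = 0)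
    (w : RVec d) : χ.diffForm x v w = 0 := by
  by_contra h
  have h1 := χ.diffForm_nonneg hx
    (-((χ.diffForm x w w + 1) / (2 * χ.diffForm x v w)) • v + w)
  simp only [map_add, map_smul, LinearMap.add_apply, LinearMap.smul_apply, smul_eq_mul, hv,
    χ.diffForm_symm hx w v] at h1
  have h2 : (χ.diffForm x w w + 1) / (2 * χ.diffForm x v w) * χ.diffForm x v w =
    (χ.diffForm x w w + 1) / 2 := by field_simp
  linarith

theorem diffForm_convex (x y v w : RVec d) (s : ℝ) :
    χ.diffForm (s • x + (1 - s) • y) v w =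
      s * χ.diffForm x v w + (1 - s) * χ.diffForm y v w := by
  simp only [diffForm_apply, Convex.combo_affine_apply (show s + (1 - s) = 1 by ring),
    Finset.mul_sum, ← Finset.sum_add_distrib, Matrix.add_apply, Matrix.smul_apply, smul_eq_mul]
  exact Finset.sum_congr rfl fun i _ => Finset.sum_congr rfl fun j _ => by ring

theorem sum_mul_a_mul (x : RVec d) (hx : x ∈ D) (u : CVec d) :
    ∑ i, ∑ j, u i * ((χ.a x i j : ℝ) : ℂ) * u j =
      ((χ.diffForm x (rePart u) (rePart u) - χ.diffForm x (imPart u) (imPart u) : ℝ) : ℂ) +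
      ((2 * χ.diffForm x (rePart u) (imPart u) : ℝ) : ℂ) * Complex.I := by
  have h2 : 2 * χ.diffForm x (rePart u) (imPart u) =
      χ.diffForm x (rePart u) (imPart u) + χ.diffForm x (imPart u) (rePart u) := by
    rw [χ.diffForm_symm hx (imPart u)]; ring
  rw [h2]
  simp only [diffForm_apply]
  apply Complex.ext
  · simp [← Finset.sum_sub_distrib]
  · simp [← Finset.sum_add_distrib]

theorem complexRx_eq {x : RVec d} (hx : x ∈ D) (u : CVec d) : χ.complexRx x u =
    (1 / 2 : ℂ) * (((χ.diffForm x (rePart u) (rePart u) -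
      χ.diffForm x (imPart u) (imPart u) : ℝ) : ℂ) +
      ((2 * χ.diffForm x (rePart u) (imPart u) : ℝ) : ℂ) * Complex.I) + cpair u (χ.b x) +
    ∫ ξ, expIncrement u ξ ∂(χ.K x) := by
  rw [complexRx, χ.sum_mul_a_mul x hx u]
  rfl

theorem realRx_eq (x y : RVec d) : χ.realRx x y =
    (1 / 2 : ℝ) * χ.diffForm x y y + inner ℝ (χ.b x) y +
    ∫ ξ, (Real.exp (inner ℝ ξ y) - 1 - inner ℝ (trunc ξ) y) ∂(χ.K x) := rfl

/-- The imaginary part contributes -½ ⟨Im u, a Im u⟩ ≤ 0 to the diffusion term, and in the jump term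
Re e^w ≤ |e^w| = e^{Re w}. -/
theorem re_complexRx_le {x : RVec d} (hx : x ∈ D) {u : CVec d}
    (hu : rePart u ∈ χ.expDomain) : (χ.complexRx x u).re ≤ χ.realRx x (rePart u) := by
  have hint := χ.integrable_expIncrement hx hu
  have hint' := χ.integrable_expIncrement hx (u := toC (rePart u)) (by rwa [rePart_toC])
  have h1 : (∫ ξ, expIncrement u ξ ∂(χ.K x)).re ≤
      ∫ ξ, (Real.exp (inner ℝ ξ (rePart u)) - 1 - inner ℝ (trunc ξ) (rePart u)) ∂(χ.K x) := by
    have h2 : ∀ ξ, (expIncrement (toC (rePart u)) ξ).re =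
        Real.exp (inner ℝ ξ (rePart u)) - 1 - inner ℝ (trunc ξ) (rePart u) := fun ξ => by
      rw [expIncrement_toC, Complex.ofReal_re]
    have h3 : (∫ ξ, expIncrement u ξ ∂(χ.K x)).re = ∫ ξ, (expIncrement u ξ).re ∂(χ.K x) :=
      (integral_re hint).symm
    rw [h3]
    refine integral_mono hint.re (hint'.re.congr (Eventually.of_forall h2)) fun ξ => ?_
    change (expIncrement u ξ).re ≤ _
    simp only [expIncrement, Complex.sub_re, cpair_re, Complex.one_re, real_inner_comm (rePart u)]
    have h4 := Complex.re_le_norm (Complex.exp (cpair u ξ))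
    rw [Complex.norm_exp, cpair_re] at h4
    linarith [real_inner_comm ξ (rePart u)]
  rw [χ.complexRx_eq hx, realRx_eq]
  have h5 := χ.diffForm_nonneg hx (imPart u)
  simp only [Complex.add_re, cpair_re, real_inner_comm (rePart u) (χ.b x)]
  have h6 : ((1 / 2 : ℂ) * (((χ.diffForm x (rePart u) (rePart u) -
      χ.diffForm x (imPart u) (imPart u) : ℝ) : ℂ) +
      ((2 * χ.diffForm x (rePart u) (imPart u) : ℝ) : ℂ) * Complex.I)).re =
      1 / 2 * (χ.diffForm x (rePart u) (rePart u) - χ.diffForm x (imPart u) (imPart u)) := by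
    rw [show (1 / 2 : ℂ) = ((1 / 2 : ℝ) : ℂ) by push_cast; rfl, Complex.re_ofReal_mul]
    simp
  rw [h6]
  linarith

/-- The Euclidean norm is at most the ℓ¹ norm, which is the pairing of ξ with a sign vector. Hence
the integrand is bounded by a finite sum of exponentials whose exponents y + ρ v stay in the moment
domain for small ρ. -/
theorem exists_integrable_exp_add_norm {y : RVec d} (hy : y ∈ interior χ.expDomain) :
    ∃ ρ > 0, ∀ x ∈ D, Integrable ({ξ : RVec d | 1 ≤ ‖ξ‖}.indicator
      fun ξ => Real.exp (inner ℝ y ξ + ρ * ‖ξ‖)) (χ.K x) := by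
  let v : (Fin d → Bool) → RVec d := fun s => WithLp.toLp 2 fun i => if s i then 1 else -1
  have hev : ∀ s, ∀ᶠ ρ in 𝓝 (0 : ℝ), y + ρ • v s ∈ χ.expDomain := by
    intro s
    have h1 : Tendsto (fun ρ : ℝ => y + ρ • v s) (𝓝 0) (𝓝 (y + (0 : ℝ) • v s)) :=
      (tendsto_id.smul_const _).const_add _
    rw [zero_smul, add_zero] at h1
    exact h1 (mem_interior_iff_mem_nhds.1 hy)
  obtain ⟨ρ, hρ, hρ0⟩ := (((eventually_all.2 hev).filter_mono
    (nhdsWithin_le_nhds (s := Ioi (0 : ℝ)))).and self_mem_nhdsWithin).exists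
  refine ⟨ρ, hρ0, fun x hx => ?_⟩
  have hρ0 : 0 < ρ := hρ0
  have hsum : Integrable (fun ξ => ∑ s, {ξ : RVec d | 1 ≤ ‖ξ‖}.indicator
      (fun ξ => Real.exp (inner ℝ (y + ρ • v s) ξ)) ξ) (χ.K x) :=
    integrable_finsetSum _ fun s _ => χ.integrable_indicator_exp hx (hρ s)
  have hc : Continuous fun ξ : RVec d => Real.exp (inner ℝ y ξ + ρ * ‖ξ‖) := by fun_prop
  refine hsum.mono' (hc.measurable.indicator measurableSet_one_le_norm).aestronglyMeasurable
    (Eventually.of_forall fun ξ => ?_)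
  by_cases hξ : ξ ∈ {ξ : RVec d | 1 ≤ ‖ξ‖}
  · simp only [indicator_of_mem hξ]
    rw [Real.norm_eq_abs, abs_of_pos (Real.exp_pos _)]
    refine le_trans (Real.exp_le_exp.2 ?_) (Finset.single_le_sum
      (f := fun s => Real.exp (inner ℝ (y + ρ • v s) ξ)) (fun s _ => (Real.exp_pos _).le)
      (Finset.mem_univ (fun i => decide (0 ≤ ξ i))))
    rw [inner_add_left, real_inner_smul_left]
    have h1 : ‖ξ‖ ≤ inner ℝ (v fun i => decide (0 ≤ ξ i)) ξ := by
      have h2 : ‖ξ‖ ≤ ∑ i, ‖ξ i‖ := by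
        calc ‖ξ‖ = ‖∑ i, EuclideanSpace.single i (ξ i)‖ := by
              congr 1; ext j; simp
          _ ≤ ∑ i, ‖EuclideanSpace.single i (ξ i)‖ := norm_sum_le _ _
          _ = _ := by simp
      refine h2.trans (le_of_eq ?_)
      rw [inner_eq_sum]
      refine Finset.sum_congr rfl fun i _ => ?_
      by_cases h : 0 ≤ ξ i
      · simp [v, h, abs_of_nonneg h]
      · simp [v, h, abs_of_neg (not_le.1 h)]
    gcongr
  · simp [indicator_of_notMem hξ]

/-- Locally uniform exponential moments of the large jumps. -/
theorem exists_integral_exp_le {k : Set (RVec d)} (hk : IsCompact k)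
    (hkY : k ⊆ interior χ.expDomain) {x : RVec d} (hx : x ∈ D) :
    ∃ B, ∀ y ∈ k, ∫ ξ, {ξ : RVec d | 1 ≤ ‖ξ‖}.indicator (fun ξ => Real.exp (inner ℝ y ξ)) ξ
      ∂(χ.K x) ≤ B := by
  refine hk.induction_on (p := fun k => ∃ B, ∀ y ∈ k, ∫ ξ, {ξ : RVec d | 1 ≤ ‖ξ‖}.indicator
    (fun ξ => Real.exp (inner ℝ y ξ)) ξ ∂(χ.K x) ≤ B) ⟨0, by simp⟩ ?_ ?_ ?_
  · rintro s t hst ⟨B, hB⟩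
    exact ⟨B, fun y hy => hB y (hst hy)⟩
  · rintro s t ⟨B, hB⟩ ⟨B', hB'⟩
    refine ⟨max B B', fun y hy => ?_⟩
    rcases hy with hy | hy
    · exact (hB y hy).trans (le_max_left _ _)
    · exact (hB' y hy).trans (le_max_right _ _)
  · intro y hy
    -- The single function exp(⟨y, ξ⟩ + ρ‖ξ‖) dominates on the whole ball of radius ρ around y.
    obtain ⟨ρ, hρ, hint⟩ := χ.exists_integrable_exp_add_norm (hkY hy)
    refine ⟨Metric.ball y ρ, mem_nhdsWithin_of_mem_nhds (Metric.ball_mem_nhds _ hρ), _,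
      fun z hz => integral_mono_of_nonneg (Eventually.of_forall fun ξ =>
        indicator_nonneg (fun _ _ => (Real.exp_pos _).le) _) (hint x hx)
        (Eventually.of_forall fun ξ => indicator_le_indicator (Real.exp_le_exp.2 ?_))⟩
    have h1 : inner ℝ (z - y) ξ ≤ ρ * ‖ξ‖ := by
      refine (real_inner_le_norm _ _).trans ?_
      rw [Metric.mem_ball, dist_eq_norm] at hz
      gcongr
    rw [inner_sub_left] at h1
    linarith

/-- Mean value inequality in both regimes: for small jumps on a disc of radius M‖ξ‖, where e^z - z
has derivative of that order; for large jumps on a half-plane, with the factor ‖ξ‖ absorbed into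
half of the exponential margin ρ. -/
theorem norm_expIncrement_sub_le {u₀ u u' : CVec d} {ρ M : ℝ} (hρ : 0 < ρ)
    (hu : ‖u - u₀‖ ≤ ρ / 2) (hu' : ‖u' - u₀‖ ≤ ρ / 2) (hM : ‖u‖ ≤ M) (hM' : ‖u'‖ ≤ M)
    (ξ : RVec d) : ‖expIncrement u ξ - expIncrement u' ξ‖ ≤
      (M * Real.exp M * levyWeight ξ + 2 / ρ * {ξ : RVec d | 1 ≤ ‖ξ‖}.indicator
        (fun ξ => Real.exp (inner ℝ (rePart u₀) ξ + ρ * ‖ξ‖)) ξ) * ‖u - u'‖ := by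
  have hind : 0 ≤ {ξ : RVec d | 1 ≤ ‖ξ‖}.indicator
      (fun ξ => Real.exp (inner ℝ (rePart u₀) ξ + ρ * ‖ξ‖)) ξ :=
    indicator_nonneg (fun _ _ => (Real.exp_pos _).le) _
  have hM0 : 0 ≤ M := (norm_nonneg _).trans hM
  have hsub : ‖cpair u ξ - cpair u' ξ‖ ≤ ‖u - u'‖ * ‖ξ‖ := by
    rw [← sub_cpair]; exact norm_cpair_le _ _
  rcases le_or_gt ‖ξ‖ 1 with h | h
  · have hball : ∀ v : CVec d, ‖v‖ ≤ M → cpair v ξ ∈ Metric.closedBall (0 : ℂ) (M * ‖ξ‖) := by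
      intro v hv
      rw [mem_closedBall_zero_iff]
      exact (norm_cpair_le v ξ).trans (by gcongr)
    have hmv := Convex.norm_image_sub_le_of_norm_hasDerivWithin_le
      (f := fun z => Complex.exp z - z) (f' := fun z => Complex.exp z - 1)
      (s := Metric.closedBall (0 : ℂ) (M * ‖ξ‖)) (C := M * ‖ξ‖ * Real.exp M)
      (fun z _ => ((Complex.hasDerivAt_exp z).sub (hasDerivAt_id z)).hasDerivWithinAt)
      (fun z hz => by
        rw [mem_closedBall_zero_iff] at hz
        have h1 := Complex.norm_exp_sub_sum_le_norm_mul_exp z 1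
        have h2 : ‖z‖ ≤ M := hz.trans (mul_le_of_le_one_right hM0 h)
        simp only [Finset.sum_range_one, pow_zero, Nat.factorial_zero, Nat.cast_one, div_one,
          pow_one] at h1
        exact h1.trans (by gcongr))
      (convex_closedBall _ _) (hball u' hM') (hball u hM)
    have heq : expIncrement u ξ - expIncrement u' ξ =
        Complex.exp (cpair u ξ) - cpair u ξ - (Complex.exp (cpair u' ξ) - cpair u' ξ) := by
      rw [expIncrement, expIncrement, trunc_of_le h]; ring
    rw [heq, levyWeight_of_le h]
    refine hmv.trans ?_
    calc M * ‖ξ‖ * Real.exp M * ‖cpair u ξ - cpair u' ξ‖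
        ≤ M * ‖ξ‖ * Real.exp M * (‖u - u'‖ * ‖ξ‖) := by gcongr
      _ = M * Real.exp M * ‖ξ‖ ^ 2 * ‖u - u'‖ := by ring
      _ ≤ _ := by
        refine mul_le_mul_of_nonneg_right ?_ (norm_nonneg _)
        have : 0 ≤ 2 / ρ := by positivity
        nlinarith [mul_nonneg this hind]
  · have hhalf : ∀ v : CVec d, ‖v - u₀‖ ≤ ρ / 2 →
        cpair v ξ ∈ {z : ℂ | z.re ≤ inner ℝ (rePart u₀) ξ + ρ / 2 * ‖ξ‖} := by
      intro v hv
      change (cpair v ξ).re ≤ _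
      rw [cpair_re]
      have h1 : inner ℝ (rePart (v - u₀)) ξ ≤ ρ / 2 * ‖ξ‖ := by
        refine (real_inner_le_norm _ _).trans ?_
        gcongr
        exact (norm_rePart_le _).trans hv
      rw [rePart_sub, inner_sub_left] at h1
      linarith
    have hmv := Convex.norm_image_sub_le_of_norm_hasDerivWithin_le
      (f := Complex.exp) (f' := Complex.exp)
      (s := {z : ℂ | z.re ≤ inner ℝ (rePart u₀) ξ + ρ / 2 * ‖ξ‖})
      (C := Real.exp (inner ℝ (rePart u₀) ξ + ρ / 2 * ‖ξ‖))
      (fun z _ => (Complex.hasDerivAt_exp z).hasDerivWithinAt)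
      (fun z hz => by
        rw [Complex.norm_exp]
        exact Real.exp_le_exp.2 hz)
      (convex_halfSpace_re_le _) (hhalf u' hu') (hhalf u hu)
    have heq : expIncrement u ξ - expIncrement u' ξ =
        Complex.exp (cpair u ξ) - Complex.exp (cpair u' ξ) := by
      rw [expIncrement, expIncrement, trunc_of_gt h, cpair_zero, cpair_zero]; ring
    rw [heq, indicator_of_mem (show ξ ∈ {ξ : RVec d | 1 ≤ ‖ξ‖} from h.le)]
    refine hmv.trans ?_
    have h1 : ρ / 2 * ‖ξ‖ ≤ Real.exp (ρ / 2 * ‖ξ‖) := by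
      linarith [Real.add_one_le_exp (ρ / 2 * ‖ξ‖)]
    have h2 : ‖ξ‖ ≤ 2 / ρ * Real.exp (ρ / 2 * ‖ξ‖) := by
      rw [div_mul_eq_mul_div, le_div_iff₀ hρ]; linarith
    calc Real.exp (inner ℝ (rePart u₀) ξ + ρ / 2 * ‖ξ‖) * ‖cpair u ξ - cpair u' ξ‖
        ≤ Real.exp (inner ℝ (rePart u₀) ξ + ρ / 2 * ‖ξ‖) *
          (‖u - u'‖ * (2 / ρ * Real.exp (ρ / 2 * ‖ξ‖))) := by
          gcongr
          exact hsub.trans (by gcongr)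
      _ = 2 / ρ * Real.exp (inner ℝ (rePart u₀) ξ + ρ * ‖ξ‖) * ‖u - u'‖ := by
          have h3 : Real.exp (inner ℝ (rePart u₀) ξ + ρ * ‖ξ‖) =
              Real.exp (inner ℝ (rePart u₀) ξ + ρ / 2 * ‖ξ‖) * Real.exp (ρ / 2 * ‖ξ‖) := by
            rw [← Real.exp_add]; ring_nf
          rw [h3]
          ring
      _ ≤ _ := by
        refine mul_le_mul_of_nonneg_right ?_ (norm_nonneg _)
        have := levyWeight_nonneg ξ
        have : 0 ≤ M * Real.exp M * levyWeight ξ := by positivity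
        linarith

theorem exists_lipschitz_complexRx {x : RVec d} (hx : x ∈ D) {u₀ : CVec d}
    (hu₀ : u₀ ∈ strip (interior χ.expDomain)) : ∃ L : ℝ, ∀ᶠ p in 𝓝 (u₀, u₀),
      ‖χ.complexRx x p.1 - χ.complexRx x p.2‖ ≤ L * ‖p.1 - p.2‖ := by
  obtain ⟨ρ, hρ, hint⟩ := χ.exists_integrable_exp_add_norm hu₀
  set g : CVec d → ℂ := fun u => (1 / 2 : ℂ) * ∑ i, ∑ j, u i * ((χ.a x i j : ℝ) : ℂ) * u j +
    cpair u (χ.b x) with hg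
  have hgc : ContDiff ℝ 1 g := by
    refine (contDiff_const.mul (ContDiff.sum fun i _ => ContDiff.sum fun j _ => ?_)).add
      (cpairL (χ.b x)).contDiff
    exact ((EuclideanSpace.proj (𝕜 := ℂ) i |>.restrictScalars ℝ).contDiff.mul contDiff_const).mul
      (EuclideanSpace.proj (𝕜 := ℂ) j |>.restrictScalars ℝ).contDiff
  obtain ⟨K, t, ht, hK⟩ := hgc.contDiffAt (x := u₀) |>.exists_lipschitzOnWith
  set M := ‖u₀‖ + ρ / 2 with hM
  set w : RVec d → ℝ := fun ξ => M * Real.exp M * levyWeight ξ + 2 / ρ *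
    {ξ : RVec d | 1 ≤ ‖ξ‖}.indicator (fun ξ => Real.exp (inner ℝ (rePart u₀) ξ + ρ * ‖ξ‖)) ξ
    with hw
  have hwint : Integrable w (χ.K x) :=
    ((χ.integrable_levyWeight hx).const_mul _).add ((hint x hx).const_mul _)
  have hs : t ∩ (Metric.ball u₀ (ρ / 2) ∩ strip (interior χ.expDomain)) ∈ 𝓝 u₀ :=
    inter_mem ht (inter_mem (Metric.ball_mem_nhds _ (half_pos hρ))
      ((isOpen_strip isOpen_interior).mem_nhds hu₀))
  refine ⟨K + ∫ ξ, w ξ ∂(χ.K x), ?_⟩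
  filter_upwards [prod_mem_nhds hs hs] with p hp
  obtain ⟨⟨h1t, h1b, h1s⟩, h2t, h2b, h2s⟩ := hp
  rw [Metric.mem_ball, dist_eq_norm] at h1b h2b
  have hgle := hK.dist_le_mul _ h1t _ h2t
  rw [dist_eq_norm, dist_eq_norm] at hgle
  have hi1 := χ.integrable_expIncrement hx (interior_subset h1s)
  have hi2 := χ.integrable_expIncrement hx (interior_subset h2s)
  have hle : ‖∫ ξ, expIncrement p.1 ξ ∂(χ.K x) - ∫ ξ, expIncrement p.2 ξ ∂(χ.K x)‖ ≤
      (∫ ξ, w ξ ∂(χ.K x)) * ‖p.1 - p.2‖ := by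
    rw [← integral_sub hi1 hi2, ← integral_mul_const]
    refine norm_integral_le_of_norm_le (hwint.mul_const _) (Eventually.of_forall fun ξ => ?_)
    refine norm_expIncrement_sub_le hρ h1b.le h2b.le ?_ ?_ ξ
    · linarith [norm_le_norm_add_norm_sub' p.1 u₀]
    · linarith [norm_le_norm_add_norm_sub' p.2 u₀]
  have heq : χ.complexRx x p.1 - χ.complexRx x p.2 = (g p.1 - g p.2) +
      (∫ ξ, expIncrement p.1 ξ ∂(χ.K x) - ∫ ξ, expIncrement p.2 ξ ∂(χ.K x)) := by
    simp only [hg, complexRx, expIncrement]; ring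
  rw [heq, add_mul]
  exact (norm_add_le _ _).trans (add_le_add hgle hle)

end Form

/-! ### The Riccati vector fields. -/

section Cone

variable {d : ℕ} {C : ProperCone ℝ (RVec d)} (χ : AffineTriplet (C : Set (RVec d)))

theorem complexRx_convex {x y : RVec d} (hx : x ∈ C) (hy : y ∈ C) {u : CVec d}
    (hu : rePart u ∈ χ.expDomain) {s : ℝ} (h0 : 0 ≤ s) (h1 : s ≤ 1) :
    χ.complexRx (s • x + (1 - s) • y) u =
      s • χ.complexRx x u + (1 - s) • χ.complexRx y u := by
  have hz : s • x + (1 - s) • y ∈ C :=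
    C.add_mem (C.smul_mem hx h0) (C.smul_mem hy (by linarith))
  rw [χ.complexRx_eq hz, χ.complexRx_eq hx, χ.complexRx_eq hy,
    χ.integral_K_convex hx hy (χ.integrable_expIncrement hx hu)
      (χ.integrable_expIncrement hy hu) h0 h1]
  simp only [diffForm_convex, Convex.combo_affine_apply (show s + (1 - s) = 1 by ring), cpair_add,
    cpair_smul, Complex.real_smul]
  push_cast
  ring

/-- The map x ↦ ℛ_x(u) is affine on the spanning cone, so the vector demanded by the choice in
`complexR` exists. -/
theorem complexRx_eq_add_cpair (hspan : Submodule.span ℝ (C : Set (RVec d)) = ⊤) {u : CVec d}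
    (hu : rePart u ∈ χ.expDomain) {x : RVec d} (hx : x ∈ C) :
    χ.complexRx x u = χ.complexF u + cpair (χ.complexR u) x := by
  have hex : ∃ v : CVec d, ∀ x ∈ (C : Set (RVec d)),
      χ.complexRx x u = χ.complexF u + cpair v x := by
    obtain ⟨L, hL⟩ := exists_linearMap_of_convex_affine C hspan (g := fun x => χ.complexRx x u)
      (fun x hx y hy s h0 h1 => χ.complexRx_convex hx hy hu h0 h1)
    refine ⟨WithLp.toLp 2 fun i => L (EuclideanSpace.single i 1), fun x hx => ?_⟩
    rw [complexF, hL x hx]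
    congr 1
    have hxs : x = ∑ i, x i • EuclideanSpace.single i (1 : ℝ) := by
      ext j; simp [Pi.single_apply]
    conv_lhs => rw [hxs]
    rw [map_sum, cpair]
    refine Finset.sum_congr rfl fun i _ => ?_
    rw [map_smul, Complex.real_smul, mul_comm]
  exact Classical.epsilon_spec hex x hx

theorem cpair_complexR (hspan : Submodule.span ℝ (C : Set (RVec d)) = ⊤) {u : CVec d}
    (hu : rePart u ∈ χ.expDomain) {x : RVec d} (hx : x ∈ C) :
    cpair (χ.complexR u) x = χ.complexRx x u - χ.complexRx 0 u := by
  rw [χ.complexRx_eq_add_cpair hspan hu hx, complexF]; ring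

/-- Pairings with a spanning cone determine a vector, so the two choices agree on real exponents;
regularity of the complex field thereby passes to the real one. -/
theorem realR_eq (hspan : Submodule.span ℝ (C : Set (RVec d)) = ⊤) {y : RVec d}
    (hy : y ∈ χ.expDomain) : toC (χ.realR y) = χ.complexR (toC y) := by
  have hy' : rePart (toC y) ∈ χ.expDomain := by rwa [rePart_toC]
  have hex : ∃ v : RVec d, ∀ x ∈ (C : Set (RVec d)),
      χ.realRx x y = χ.realF y + inner ℝ v x := by
    refine ⟨rePart (χ.complexR (toC y)), fun x hx => ?_⟩
    have h1 := congrArg Complex.re (χ.complexRx_eq_add_cpair hspan hy' hx)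
    rwa [complexF, complexRx_toC, complexRx_toC, Complex.add_re, Complex.ofReal_re,
      Complex.ofReal_re, cpair_re] at h1
  have hspec : ∀ x ∈ (C : Set (RVec d)), χ.realRx x y = χ.realF y + inner ℝ (χ.realR y) x :=
    Classical.epsilon_spec hex
  refine eq_of_cpair_eq hspan fun x hx => ?_
  rw [χ.cpair_complexR hspan hy' hx, complexRx_toC, complexRx_toC, hspec x hx, cpair_toC, realF]
  push_cast
  ring

theorem inner_realR (hspan : Submodule.span ℝ (C : Set (RVec d)) = ⊤) {y : RVec d}
    (hy : y ∈ χ.expDomain) {x : RVec d} (hx : x ∈ C) :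
    inner ℝ (χ.realR y) x = χ.realRx x y - χ.realRx 0 y := by
  have h1 := χ.cpair_complexR hspan (u := toC y) (by rwa [rePart_toC]) hx
  rw [← χ.realR_eq hspan hy, cpair_toC, complexRx_toC, complexRx_toC] at h1
  exact_mod_cast h1

/-- Meant for inequalities between ℛ_{nx} = F + n ⟨R, x⟩: division by n eliminates F in the limit.
-/
theorem le_of_forall_nat_add_mul_le {a b a' b' : ℝ}
    (h : ∀ n : ℕ, a + n * b ≤ a' + n * b') : b ≤ b' := by
  by_contra! hlt
  obtain ⟨n, hn⟩ := exists_nat_gt ((a' - a) / (b - b'))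
  rw [div_lt_iff₀ (by linarith)] at hn
  have := h n
  nlinarith

/-- The bound Re ℛ ≤ ℛ(Re ·) at all multiples nx of x, with F eliminated. It makes Re ψ a
subsolution of the real equation. -/
theorem inner_rePart_complexR_le (hspan : Submodule.span ℝ (C : Set (RVec d)) = ⊤)
    {u : CVec d} (hu : rePart u ∈ χ.expDomain) {x : RVec d} (hx : x ∈ C) :
    inner ℝ (rePart (χ.complexR u)) x ≤ inner ℝ (χ.realR (rePart u)) x := by
  refine le_of_forall_nat_add_mul_le (a := (χ.complexRx 0 u).re) (a' := χ.realRx 0 (rePart u))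
    fun n => ?_
  have hnx : (n : ℝ) • x ∈ C := C.smul_mem hx n.cast_nonneg
  have h1 := χ.re_complexRx_le hnx hu
  rw [χ.complexRx_eq_add_cpair hspan hu hnx, Complex.add_re, cpair_re, inner_smul_right,
    complexF] at h1
  have h2 := χ.inner_realR hspan hu hnx
  rw [inner_smul_right] at h2
  linarith

/-- Orthogonality of y' - y to x persists for nx, so quasi-monotonicity of ℛ_{nx} passes to R as n
grows. -/
theorem inner_realR_le_of_le {Ω : Type*} [MeasurableSpace Ω]
    {Z : AffineProcess (C : Set (RVec d)) Ω} (hχ : χ.IsCharacteristicsOf Z)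
    (hspan : Submodule.span ℝ (C : Set (RVec d)) = ⊤) {y y' x : RVec d}
    (hy' : y' ∈ χ.expDomain) (hle : y' - y ∈ ProperCone.innerDual (C : Set (RVec d)))
    (hx : x ∈ C) (horth : inner ℝ (y' - y) x = 0) :
    inner ℝ (χ.realR y) x ≤ inner ℝ (χ.realR y') x := by
  refine le_of_forall_nat_add_mul_le (a := χ.realRx 0 y) (a' := χ.realRx 0 y') fun n => ?_
  have hnx : (n : ℝ) • x ∈ C := C.smul_mem hx n.cast_nonneg
  have h1 := χ.realRx_le_of_le hχ hspan hy' hle hnx (by rw [inner_smul_right, horth, mul_zero])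
  have h2 := χ.inner_realR hspan (χ.mem_expDomain_of_le hχ hspan hy' hle) hnx
  have h3 := χ.inner_realR hspan hy' hnx
  rw [inner_smul_right] at h2 h3
  linarith

/-- Finitely many pairings with points of the cone control the norm, and each pairing is a
difference of two locally Lipschitz functions ℛ_x and ℛ_0. -/
theorem exists_lipschitz_complexR (hspan : Submodule.span ℝ (C : Set (RVec d)) = ⊤)
    {u₀ : CVec d} (hu₀ : u₀ ∈ strip (interior χ.expDomain)) : ∃ L : ℝ≥0, ∀ᶠ p in 𝓝 (u₀, u₀),
      ‖χ.complexR p.1 - χ.complexR p.2‖ ≤ L * ‖p.1 - p.2‖ := by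
  obtain ⟨b, c, hb, hc, hle⟩ := exists_norm_le_sum_cpair hspan
  choose! L hL using fun x (hx : x ∈ (C : Set (RVec d))) => χ.exists_lipschitz_complexRx hx hu₀
  have hmem : ∀ᶠ p in 𝓝 (u₀, u₀), p.1 ∈ strip (interior χ.expDomain) ∧
      p.2 ∈ strip (interior χ.expDomain) :=
    prod_mem_nhds ((isOpen_strip isOpen_interior).mem_nhds hu₀)
      ((isOpen_strip isOpen_interior).mem_nhds hu₀)
  have hall : ∀ᶠ p in 𝓝 (u₀, u₀), ∀ x ∈ b,
      ‖χ.complexRx x p.1 - χ.complexRx x p.2‖ ≤ L x * ‖p.1 - p.2‖ :=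
    (Filter.eventually_all_finset b).2 fun x hx => hL x (hb hx)
  refine ⟨(c * ∑ x ∈ b, (L x + L 0)).toNNReal, ?_⟩
  filter_upwards [hmem, hall, hL 0 C.zero_mem] with p hp hpb hp0
  refine (hle _).trans (le_trans ?_ (mul_le_mul_of_nonneg_right (Real.le_coe_toNNReal _)
    (norm_nonneg _)))
  rw [mul_assoc, Finset.sum_mul]
  refine mul_le_mul_of_nonneg_left (Finset.sum_le_sum fun x hx => ?_) hc
  rw [sub_cpair, χ.cpair_complexR hspan (interior_subset hp.1) (hb hx),
    χ.cpair_complexR hspan (interior_subset hp.2) (hb hx), add_mul,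
    show ∀ a b c d : ℂ, a - b - (c - d) = (a - c) - (b - d) by intros; ring]
  exact (norm_sub_le _ _).trans (add_le_add (hpb x hx) hp0)

theorem locallyLipschitzOn_complexR (hspan : Submodule.span ℝ (C : Set (RVec d)) = ⊤) :
    LocallyLipschitzOn (strip (interior χ.expDomain)) χ.complexR := by
  intro u₀ hu₀
  obtain ⟨L, hL⟩ := χ.exists_lipschitz_complexR hspan hu₀
  obtain ⟨s, hs, hLs⟩ := exists_lipschitzOnWith_of_eventually hL
  exact ⟨L, s, mem_nhdsWithin_of_mem_nhds hs, hLs⟩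

theorem continuousOn_complexF : ContinuousOn χ.complexF (strip (interior χ.expDomain)) := by
  intro u₀ hu₀
  obtain ⟨L, hL⟩ := χ.exists_lipschitz_complexRx C.zero_mem hu₀
  refine ContinuousAt.continuousWithinAt ?_
  have h1 : ∀ᶠ v in 𝓝 u₀, ‖χ.complexF v - χ.complexF u₀‖ ≤ L * ‖v - u₀‖ :=
    (Continuous.prodMk_left u₀).continuousAt.eventually hL
  rw [ContinuousAt, tendsto_iff_norm_sub_tendsto_zero]
  refine squeeze_zero' (Eventually.of_forall fun _ => norm_nonneg _) h1 ?_
  have h2 : Tendsto (fun v : CVec d => L * ‖v - u₀‖) (𝓝 u₀) (𝓝 (L * ‖u₀ - u₀‖)) :=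
    Continuous.tendsto (by fun_prop) u₀
  rwa [sub_self, norm_zero, mul_zero] at h2

theorem locallyLipschitzOn_realR (hspan : Submodule.span ℝ (C : Set (RVec d)) = ⊤) :
    LocallyLipschitzOn (interior χ.expDomain) χ.realR := by
  intro y₀ hy₀
  have htoC : Continuous (toC : RVec d → CVec d) := by
    refine (PiLp.continuous_toLp 2 _).comp ?_
    fun_prop
  obtain ⟨L, hL⟩ := χ.exists_lipschitz_complexR hspan (u₀ := toC y₀) (by
    change rePart (toC y₀) ∈ interior χ.expDomain; rwa [rePart_toC])
  obtain ⟨s, hs, hLs⟩ := exists_lipschitzOnWith_of_eventually hL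
  refine ⟨L, interior χ.expDomain ∩ toC ⁻¹' s, inter_mem self_mem_nhdsWithin
    (mem_nhdsWithin_of_mem_nhds (htoC.continuousAt hs)),
    LipschitzOnWith.of_dist_le_mul fun p hp q hq => ?_⟩
  have h1 := hLs.dist_le_mul _ hp.2 _ hq.2
  rw [dist_eq_norm, dist_eq_norm] at h1 ⊢
  have hsubC : ∀ v w : RVec d, toC v - toC w = toC (v - w) := fun v w => by
    ext i; simp [toC]
  have hnorm : ∀ v : RVec d, ‖toC v‖ = ‖v‖ := fun v => by
    simp [toC, EuclideanSpace.norm_eq]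
  rw [← χ.realR_eq hspan (interior_subset hp.1), ← χ.realR_eq hspan (interior_subset hq.1),
    hsubC, hsubC, hnorm, hnorm] at h1
  exact h1

end Cone

end AffineTriplet

end AffineMoments

/-! ### Reduction of the theorem to an a priori bound. -/

namespace AffineMoments

/-- The function (1 + W t) e^{-ct} is nonincreasing. -/
theorem add_one_le_of_deriv_le_mul {W W' : ℝ → ℝ} {c τ : ℝ} (hτ : 0 ≤ τ)
    (hW : ∀ t ∈ Icc 0 τ, HasDerivWithinAt W (W' t) (Icc 0 τ) t)
    (hle : ∀ t ∈ Icc 0 τ, W' t ≤ c * (1 + W t)) : 1 + W τ ≤ (1 + W 0) * Real.exp (c * τ) := by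
  have hd : ∀ t ∈ Icc 0 τ, HasDerivWithinAt (fun t => (1 + W t) * Real.exp (-(c * t)))
      (W' t * Real.exp (-(c * t)) + (1 + W t) * (Real.exp (-(c * t)) * -c)) (Icc 0 τ) t := by
    intro t ht
    have h1 : HasDerivAt (fun t : ℝ => -(c * t)) (-c) t := by
      exact (((hasDerivAt_id t).const_mul c).neg).congr_deriv (by simp)
    exact ((hW t ht).const_add 1).mul h1.exp.hasDerivWithinAt
  have hanti : AntitoneOn (fun t => (1 + W t) * Real.exp (-(c * t))) (Icc 0 τ) := by
    refine antitoneOn_of_hasDerivWithinAt_nonpos (convex_Icc 0 τ)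
      (fun t ht => (hd t ht).continuousWithinAt)
      (fun t ht => (hd t (interior_subset ht)).mono interior_subset) fun t ht => ?_
    have h1 := hle t (interior_subset ht)
    nlinarith [Real.exp_pos (-(c * t))]
  have h := hanti (left_mem_Icc.2 hτ) (right_mem_Icc.2 hτ) hτ
  simp only [mul_zero, neg_zero, Real.exp_zero, mul_one] at h
  have h2 := mul_le_mul_of_nonneg_right h (Real.exp_pos (c * τ)).le
  rwa [mul_assoc, ← Real.exp_add, neg_add_cancel, Real.exp_zero, mul_one] at h2

namespace AffineTriplet

variable {d : ℕ} {C : ProperCone ℝ (RVec d)} (χ : AffineTriplet (C : Set (RVec d)))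

/-- `ψ` solves the complex Riccati equation up to time `τ`. -/
def IsRiccatiPath (τ : ℝ) (ψ : ℝ → CVec d) : Prop :=
  (∀ t ∈ Icc 0 τ, ψ t ∈ strip (interior χ.expDomain)) ∧
    ∀ t ∈ Icc 0 τ, HasDerivWithinAt ψ (χ.complexR (ψ t)) (Icc 0 τ) t

variable {χ} {Ω : Type*} [MeasurableSpace Ω] {Z : AffineProcess (C : Set (RVec d)) Ω}

theorem IsRiccatiPath.sub_mem_innerDual (hχ : χ.IsCharacteristicsOf Z)
    (hspan : Submodule.span ℝ (C : Set (RVec d)) = ⊤) {τ : ℝ} {ψ : ℝ → CVec d}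
    (hψ : χ.IsRiccatiPath τ ψ) {q : ℝ → RVec d}
    (hqO : ∀ t ∈ Icc 0 τ, q t ∈ interior χ.expDomain)
    (hq : ∀ t ∈ Icc 0 τ, HasDerivWithinAt q (χ.realR (q t)) (Icc 0 τ) t)
    (h0 : rePart (ψ 0) = q 0) :
    ∀ t ∈ Icc 0 τ, q t - rePart (ψ t) ∈ ProperCone.innerDual (C : Set (RVec d)) := by
  refine sub_mem_innerDual_of_quasimonotone C isOpen_interior
    (χ.locallyLipschitzOn_realR hspan)
    (fun y y' hy' hle x hx horth =>
      χ.inner_realR_le_of_le hχ hspan (interior_subset hy') hle hx horth) hqO hq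
    (v := fun t => rePart (ψ t)) (v' := fun t => rePart (χ.complexR (ψ t))) (fun t ht => ?_)
    (fun t ht x hx => χ.inner_rePart_complexR_le hspan (interior_subset (hψ.1 t ht)) hx) ?_
  · exact (rePartL (d := d)).hasFDerivAt.comp_hasDerivWithinAt t (hψ.2 t ht)
  · rw [h0, sub_self]; exact zero_mem _

/-- The equation for ψ does not involve φ, which is therefore a plain integral; continuity of the
fields along ψ gives the C¹ regularity. -/
theorem exists_isComplexRiccatiSolution {T : ℝ} (hT : 0 < T) {ψ : ℝ → CVec d}
    (hspan : Submodule.span ℝ (C : Set (RVec d)) = ⊤) (hψ : χ.IsRiccatiPath T ψ) :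
    ∃ φ, χ.IsComplexRiccatiSolution T (ψ 0) φ ψ := by
  have hψc : ContinuousOn ψ (Icc 0 T) := fun t ht => (hψ.2 t ht).continuousWithinAt
  have hFc : ContinuousOn (fun t => χ.complexF (ψ t)) (Icc 0 T) :=
    χ.continuousOn_complexF.comp hψc hψ.1
  have hRc : ContinuousOn (fun t => χ.complexR (ψ t)) (Icc 0 T) :=
    (χ.locallyLipschitzOn_complexR hspan).continuousOn.comp hψc hψ.1
  -- Constant extension beyond the endpoints makes the integrand continuous on the line, so the
  -- fundamental theorem also covers t = 0 and t = T.
  set g : ℝ → ℂ := IccExtend hT.le ((Icc 0 T).domRestrict fun t => χ.complexF (ψ t)) with hg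
  have hgc : Continuous g := hFc.domRestrict.Icc_extend'
  have hgeq : ∀ t ∈ Icc 0 T, g t = χ.complexF (ψ t) := fun t ht => by
    rw [hg, IccExtend_of_mem hT.le _ ht]; rfl
  have hφd : ∀ t ∈ Icc 0 T, HasDerivWithinAt (fun t => ∫ s in (0 : ℝ)..t, g s)
      (χ.complexF (ψ t)) (Icc 0 T) t := fun t ht => by
    rw [← hgeq t ht]
    exact (hgc.integral_hasStrictDerivAt 0 t).hasDerivAt.hasDerivWithinAt
  have hC1 : ∀ {E : Type} [NormedAddCommGroup E] [NormedSpace ℝ E] {f f' : ℝ → E},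
      (∀ t ∈ Icc 0 T, HasDerivWithinAt f (f' t) (Icc 0 T) t) → ContinuousOn f' (Icc 0 T) →
      ContDiffOn ℝ 1 f (Icc 0 T) := by
    intro E _ _ f f' hf hf'
    rw [contDiffOn_one_iff_derivWithin (uniqueDiffOn_Icc hT)]
    exact ⟨fun t ht => (hf t ht).differentiableWithinAt, hf'.congr fun t ht =>
      (hf t ht).derivWithin (uniqueDiffOn_Icc hT t ht)⟩
  exact ⟨fun t => ∫ s in (0 : ℝ)..t, g s, hC1 hφd hFc, hC1 hψ.2 hRc, hψ.1, by simp, rfl, hφd, hψ.2⟩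

/-- This set traps the complex solutions; it is the projection of a closed subset of a compact
product. -/
theorem isCompact_setOf_norm_le_and_le {T M : ℝ} {q : ℝ → RVec d}
    (hq : ContinuousOn q (Icc 0 T)) : IsCompact {v : CVec d | ‖v‖ ≤ M ∧
      ∃ t ∈ Icc 0 T, q t - rePart v ∈ ProperCone.innerDual (C : Set (RVec d))} := by
  have hcont : ContinuousOn (fun p : ℝ × CVec d => q p.1 - rePart p.2)
      (Icc 0 T ×ˢ Metric.closedBall 0 M) :=
    (hq.comp continuousOn_fst fun p hp => hp.1).sub
      (continuous_rePart.comp continuous_snd).continuousOn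
  have hcompact : IsCompact (Icc (0 : ℝ) T ×ˢ Metric.closedBall (0 : CVec d) M) :=
    isCompact_Icc.prod (isCompact_closedBall _ _)
  have hcl := hcont.preimage_isClosed_of_isClosed hcompact.isClosed
    (ProperCone.innerDual (C : Set (RVec d))).isClosed
  convert (hcompact.of_isClosed_subset hcl inter_subset_left).image continuous_snd using 1
  ext v
  constructor
  · rintro ⟨hv, t, ht, h⟩
    exact ⟨(t, v), ⟨⟨ht, by simpa using hv⟩, h⟩, rfl⟩
  · rintro ⟨⟨t, w⟩, ⟨⟨ht, hw⟩, h⟩, rfl⟩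
    exact ⟨by simpa using hw, t, ht, h⟩

/-- An a priori bound along solutions dominated by a real solution yields the comparison of
lifetimes. -/
theorem realLifetime_le_complexLifetime (hχ : χ.IsCharacteristicsOf Z)
    (hspan : Submodule.span ℝ (C : Set (RVec d)) = ⊤) {u : CVec d}
    (hbound : ∀ T > 0, ∀ q : ℝ → RVec d, ContinuousOn q (Icc 0 T) →
      (∀ t ∈ Icc 0 T, q t ∈ interior χ.expDomain) → ∃ M, ∀ τ, 0 < τ → τ ≤ T → ∀ ψ, ψ 0 = u →
        χ.IsRiccatiPath τ ψ →
        (∀ t ∈ Icc 0 τ, q t - rePart (ψ t) ∈ ProperCone.innerDual (C : Set (RVec d))) →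
        ‖ψ τ‖ ≤ M) :
    χ.realLifetime (rePart u) ≤ χ.complexLifetime u := by
  refine iSup₂_le fun T hT => ?_
  obtain ⟨p, q, hpq, hqO⟩ := hT
  rcases eq_or_lt_of_le (zero_le (a := T)) with rfl | hT0
  · simp
  have hT0 : 0 < (T : ℝ) := hT0
  obtain ⟨M, hM⟩ := hbound T hT0 q hpq.q_C1.continuousOn hqO
  have h0T : (0 : ℝ) ∈ Icc 0 (T : ℝ) := left_mem_Icc.2 hT0.le
  -- Comparison bounds Re ψ by q and the hypothesis bounds ‖ψ‖, which confines every solution to one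
  -- compact subset of the strip. The maximum with ‖u‖ ensures that the initial value belongs to it.
  obtain ⟨ψ, hψ0, hψk, hψd⟩ := exists_solution_of_apriori_bound (u := u) (T := T)
    (isOpen_strip isOpen_interior)
    (isCompact_setOf_norm_le_and_le (C := C) (M := max M ‖u‖) hpq.q_C1.continuousOn)
    (fun v ⟨_, t, ht, h⟩ => χ.mem_interior_expDomain_of_le hχ hspan (hqO t ht) h)
    (χ.locallyLipschitzOn_complexR hspan)
    ⟨le_max_right _ _, 0, h0T, by rw [hpq.q_zero, sub_self]; exact zero_mem _⟩ hT0
    (fun τ hτ hτT ψ hψ0 hψO hψd => by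
      have hsub : Icc 0 τ ⊆ Icc 0 (T : ℝ) := Icc_subset_Icc_right hτT
      have hdom := IsRiccatiPath.sub_mem_innerDual hχ hspan ⟨hψO, hψd⟩
        (fun t ht => hqO t (hsub ht)) (fun t ht => (hpq.q_deriv t (hsub ht)).mono hsub)
        (by rw [hψ0, hpq.q_zero])
      exact ⟨(hM τ hτ hτT ψ hψ0 ⟨hψO, hψd⟩ hdom).trans (le_max_left _ _), τ,
        ⟨hτ.le, hτT⟩, hdom τ (right_mem_Icc.2 hτ.le)⟩)
  have hpath : χ.IsRiccatiPath T ψ := ⟨fun t ht => by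
    obtain ⟨_, s, hs, h⟩ := hψk t ht
    exact χ.mem_interior_expDomain_of_le hχ hspan (hqO s hs) h, hψd⟩
  obtain ⟨φ, hφ⟩ := exists_isComplexRiccatiSolution hT0 hspan hpath
  rw [hψ0] at hφ
  exact le_iSup₂_of_le T ⟨φ, ψ, hφ⟩ le_rfl

end AffineTriplet

end AffineMoments

/-! ### Boundary conditions at points with a supporting hyperplane. -/

namespace AffineMoments

namespace AffineTriplet

section Transversal

variable {d : ℕ} {C : ProperCone ℝ (RVec d)} (χ : AffineTriplet (C : Set (RVec d)))
  {Ω : Type*} [MeasurableSpace Ω] {Z : AffineProcess (C : Set (RVec d)) Ω}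

theorem inner_nonneg_of_mem_innerDual {y x : RVec d}
    (hy : y ∈ ProperCone.innerDual (C : Set (RVec d))) (hx : x ∈ C) : 0 ≤ inner ℝ y x := by
  rw [real_inner_comm]; exact ProperCone.mem_innerDual.1 hy hx

/-- Since -s y ≤ 0 and y is orthogonal to x, quasi-monotonicity compares with ℛ_x(0) = 0. Letting s
grow in this inequality constrains the diffusion and the jumps at x. -/
theorem realRx_neg_smul_nonpos (hχ : χ.IsCharacteristicsOf Z)
    (hspan : Submodule.span ℝ (C : Set (RVec d)) = ⊤) {x y : RVec d} (hx : x ∈ C)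
    (hy : y ∈ ProperCone.innerDual (C : Set (RVec d))) (horth : inner ℝ y x = 0) {s : ℝ}
    (hs : 0 ≤ s) : -(s • y) ∈ χ.expDomain ∧ χ.realRx x (-(s • y)) ≤ 0 := by
  have hle : (0 : RVec d) - -(s • y) ∈ ProperCone.innerDual (C : Set (RVec d)) := by
    rw [sub_neg_eq_add, zero_add]
    exact (ProperCone.innerDual (C : Set (RVec d))).smul_mem hy hs
  refine ⟨χ.mem_expDomain_of_le hχ hspan χ.zero_mem_expDomain hle, ?_⟩
  refine (χ.realRx_le_of_le hχ hspan χ.zero_mem_expDomain hle hx ?_).trans (le_of_eq ?_)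
  · rw [sub_neg_eq_add, zero_add, real_inner_smul_left, horth, mul_zero]
  · simp [realRx_eq]

/-- The inequality e^w ≥ 1 + w for small jumps and e^w ≥ 0 for large ones; the bound is independent
of s. -/
theorem neg_levyWeight_le_expIncrement {s : ℝ} {y ξ : RVec d} :
    -levyWeight ξ ≤ Real.exp (inner ℝ ξ (-(s • y))) - 1 - inner ℝ (trunc ξ) (-(s • y)) := by
  rcases le_or_gt ‖ξ‖ 1 with h | h
  · rw [trunc_of_le h]
    linarith [Real.add_one_le_exp (inner ℝ ξ (-(s • y))), levyWeight_nonneg ξ]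
  · rw [trunc_of_gt h, levyWeight_of_ge h.le, inner_zero_left]
    linarith [Real.exp_pos (inner ℝ ξ (-(s • y)))]

theorem integrable_real_expIncrement {x y : RVec d} (hx : x ∈ C) (hy : y ∈ χ.expDomain) :
    Integrable (fun ξ => Real.exp (inner ℝ ξ y) - 1 - inner ℝ (trunc ξ) y) (χ.K x) := by
  have h := (χ.integrable_expIncrement hx (u := toC y) (by rwa [rePart_toC])).re
  refine h.congr (Eventually.of_forall fun ξ => ?_)
  change (expIncrement (toC y) ξ).re = _
  rw [expIncrement_toC, Complex.ofReal_re]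

/-- The diffusion matrix at `x` annihilates the normals of supporting hyperplanes at `x`. -/
theorem diffForm_self_eq_zero_of_orthogonal (hχ : χ.IsCharacteristicsOf Z)
    (hspan : Submodule.span ℝ (C : Set (RVec d)) = ⊤) {x y : RVec d} (hx : x ∈ C)
    (hy : y ∈ ProperCone.innerDual (C : Set (RVec d))) (horth : inner ℝ y x = 0) :
    χ.diffForm x y y = 0 := by
  refine le_antisymm ?_ (χ.diffForm_nonneg hx y)
  have hW := χ.integrable_levyWeight (x := x) hx
  by_contra! hA
  have key : ∀ s : ℝ, 0 ≤ s → (1 / 2) * (s ^ 2 * χ.diffForm x y y) ≤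
      s * inner ℝ (χ.b x) y + ∫ ξ, levyWeight ξ ∂(χ.K x) := by
    intro s hs
    obtain ⟨hmem, hle⟩ := χ.realRx_neg_smul_nonpos hχ hspan hx hy horth hs
    have hint := integral_mono hW.neg (χ.integrable_real_expIncrement hx hmem)
      fun ξ => neg_levyWeight_le_expIncrement
    simp only [Pi.neg_apply, integral_neg] at hint
    rw [realRx_eq] at hle
    have h1 : χ.diffForm x (-(s • y)) (-(s • y)) = s ^ 2 * χ.diffForm x y y := by
      simp only [map_neg, map_smul, LinearMap.neg_apply, LinearMap.smul_apply, smul_eq_mul]; ring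
    have h2 : inner ℝ (χ.b x) (-(s • y)) = -(s * inner ℝ (χ.b x) y) := by
      rw [inner_neg_right, real_inner_smul_right]
    rw [h1, h2] at hle
    linarith
  set A := χ.diffForm x y y
  set β := inner ℝ (χ.b x) y
  set W := ∫ ξ, levyWeight ξ ∂(χ.K x)
  have hW0 : 0 ≤ W := integral_nonneg levyWeight_nonneg
  -- At this s the number s A / 2 exceeds |β| + W, and s ≥ 1, so the term quadratic in s beats the
  -- terms that are at most linear.
  have hs := key (2 * (|β| + W + 1) / A + 1) (by positivity)
  set s := 2 * (|β| + W + 1) / A + 1 with hsdef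
  have hsA : s * A = 2 * (|β| + W + 1) + A := by rw [hsdef]; field_simp
  have hs1 : 1 ≤ s := by rw [hsdef]; linarith [show 0 ≤ 2 * (|β| + W + 1) / A by positivity]
  have h3 : (1 / 2) * (s ^ 2 * A) = s * ((|β| + W + 1) + A / 2) := by
    rw [sq, mul_assoc s s A, hsA]; ring
  nlinarith [le_abs_self β]

/-- The jumps in the direction of the normals of supporting hyperplanes at `x` have finite
variation. -/
theorem integrable_inner_trunc_of_orthogonal (hχ : χ.IsCharacteristicsOf Z)
    (hspan : Submodule.span ℝ (C : Set (RVec d)) = ⊤) {x y : RVec d} (hx : x ∈ C)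
    (hy : y ∈ ProperCone.innerDual (C : Set (RVec d))) (horth : inner ℝ y x = 0) :
    Integrable (fun ξ => inner ℝ y (trunc ξ)) (χ.K x) := by
  have hW := χ.integrable_levyWeight (x := x) hx
  -- The Lévy–Khintchine integrand at -(n + 1) y, divided by n + 1 and made nonnegative by the Lévy
  -- weight. Its integrals are bounded uniformly in n, and it converges to ⟨y, h(ξ)⟩ plus the
  -- weight, so Fatou's lemma gives integrability.
  set G : ℕ → RVec d → ℝ := fun n ξ => (1 / ((n : ℝ) + 1)) *
    (Real.exp (inner ℝ ξ (-(((n : ℝ) + 1) • y))) - 1 -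
      inner ℝ (trunc ξ) (-(((n : ℝ) + 1) • y))) + levyWeight ξ with hG
  have hpos : ∀ n : ℕ, (0 : ℝ) ≤ (n : ℝ) + 1 := fun n => by positivity
  have hr : ∀ n : ℕ, 0 < 1 / ((n : ℝ) + 1) := fun n => by positivity
  have hr1 : ∀ n : ℕ, 1 / ((n : ℝ) + 1) ≤ 1 := fun n => by
    rw [div_le_one (by positivity)]; linarith [(n.cast_nonneg : (0 : ℝ) ≤ n)]
  have hGint : ∀ n, Integrable (G n) (χ.K x) := fun n =>
    ((χ.integrable_real_expIncrement hx
      (χ.realRx_neg_smul_nonpos hχ hspan hx hy horth (hpos n)).1).const_mul _).add hW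
  have hG0 : ∀ n ξ, 0 ≤ G n ξ := fun n ξ => by
    have h1 := neg_levyWeight_le_expIncrement (s := (n : ℝ) + 1) (y := y) (ξ := ξ)
    have h2 := mul_le_mul_of_nonneg_left h1 (hr n).le
    have h3 := mul_le_mul_of_nonneg_right (hr1 n) (levyWeight_nonneg ξ)
    simp only [hG]
    linarith
  have hGle : ∀ n, ∫ ξ, G n ξ ∂(χ.K x) ≤
      inner ℝ (χ.b x) y + ∫ ξ, levyWeight ξ ∂(χ.K x) := by
    intro n
    obtain ⟨hmem, hle⟩ := χ.realRx_neg_smul_nonpos hχ hspan hx hy horth (hpos n)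
    rw [realRx_eq] at hle
    have h1 := χ.diffForm_nonneg hx (-(((n : ℝ) + 1) • y))
    have h2 : inner ℝ (χ.b x) (-(((n : ℝ) + 1) • y)) = -(((n : ℝ) + 1) * inner ℝ (χ.b x) y) := by
      rw [inner_neg_right, real_inner_smul_right]
    rw [h2] at hle
    simp only [hG]
    rw [integral_add ((χ.integrable_real_expIncrement hx hmem).const_mul _) hW,
      integral_const_mul]
    refine add_le_add_left ?_ _
    rw [one_div, inv_mul_le_iff₀ (by positivity)]
    linarith
  have hlim : ∀ᵐ ξ ∂(χ.K x), Tendsto (fun n => G n ξ) atTop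
      (𝓝 (inner ℝ y (trunc ξ) + levyWeight ξ)) := by
    filter_upwards [χ.ae_mem_cone hχ hspan hx] with ξ hξ
    refine Tendsto.add_const _ ?_
    have h0 := inner_nonneg_of_mem_innerDual hy hξ
    have h1 : ∀ n : ℕ, (1 / ((n : ℝ) + 1)) * (Real.exp (inner ℝ ξ (-(((n : ℝ) + 1) • y))) - 1 -
        inner ℝ (trunc ξ) (-(((n : ℝ) + 1) • y))) = (1 / ((n : ℝ) + 1)) *
        (Real.exp (-(((n : ℝ) + 1) * inner ℝ y ξ)) - 1) + inner ℝ y (trunc ξ) := by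
      intro n
      rw [inner_neg_right, inner_neg_right, real_inner_smul_right, real_inner_smul_right,
        real_inner_comm y ξ, real_inner_comm y (trunc ξ)]
      field_simp
      ring
    simp only [h1]
    have h2 : Tendsto (fun n : ℕ => (1 / ((n : ℝ) + 1)) *
        (Real.exp (-(((n : ℝ) + 1) * inner ℝ y ξ)) - 1)) atTop (𝓝 0) := by
      refine squeeze_zero_norm (fun n => ?_) tendsto_one_div_add_atTop_nhds_zero_nat
      rw [norm_mul, Real.norm_of_nonneg (hr n).le]
      refine mul_le_of_le_one_right (hr n).le ?_
      have h3 : Real.exp (-(((n : ℝ) + 1) * inner ℝ y ξ)) ≤ 1 :=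
        Real.exp_le_one_iff.2 (neg_nonpos.2 (mul_nonneg (hpos n) h0))
      rw [Real.norm_eq_abs, abs_le]
      constructor <;> linarith [Real.exp_pos (-(((n : ℝ) + 1) * inner ℝ y ξ))]
    simpa using h2.add_const (inner ℝ y (trunc ξ))
  have hmeas : Measurable fun ξ : RVec d => inner ℝ y (trunc ξ) :=
    measurable_const.inner measurable_trunc
  have hsum : Integrable (fun ξ => inner ℝ y (trunc ξ) + levyWeight ξ) (χ.K x) := by
    refine ⟨(hmeas.add continuous_levyWeight.measurable).aestronglyMeasurable, ?_⟩
    have hliminf : ∫⁻ ξ, ‖inner ℝ y (trunc ξ) + levyWeight ξ‖ₑ ∂(χ.K x) =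
        ∫⁻ ξ, liminf (fun n => ‖G n ξ‖ₑ) atTop ∂(χ.K x) :=
      lintegral_congr_ae (hlim.mono fun ξ hξ => hξ.enorm.liminf_eq.symm)
    rw [HasFiniteIntegral, hliminf]
    refine lt_of_le_of_lt (lintegral_liminf_le' fun n => (hGint n).1.aemeasurable.enorm) ?_
    refine lt_of_le_of_lt (b := ENNReal.ofReal
      (inner ℝ (χ.b x) y + ∫ ξ, levyWeight ξ ∂(χ.K x))) ?_ ENNReal.ofReal_lt_top
    refine liminf_le_of_frequently_le' (Frequently.of_forall fun n => ?_)
    have h1 : ∫⁻ ξ, ‖G n ξ‖ₑ ∂(χ.K x) = ENNReal.ofReal (∫ ξ, G n ξ ∂(χ.K x)) := by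
      rw [ofReal_integral_eq_lintegral_ofReal (hGint n) (Eventually.of_forall (hG0 n))]
      exact lintegral_congr fun ξ => Real.enorm_of_nonneg (hG0 n ξ)
    rw [h1]
    exact ENNReal.ofReal_le_ofReal (hGle n)
  exact (hsum.sub hW).congr (Eventually.of_forall fun ξ => by simp)

end Transversal

/-! ### Constancy of diffusion and jumps along lines in the cone. -/

section Line

variable {d : ℕ} {C : ProperCone ℝ (RVec d)}

/-- On the ray, f(l) - f(0) = (f((n + 1) l) - f(0)) / (n + 1), which tends to 0. -/
theorem eq_of_affine_of_norm_le {F : Type*} [NormedAddCommGroup F] [NormedSpace ℝ F]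
    {f : RVec d → F} (hf : ∀ x ∈ C, ∀ y ∈ C, ∀ s : ℝ, 0 ≤ s → s ≤ 1 →
      f (s • x + (1 - s) • y) = s • f x + (1 - s) • f y) {l : RVec d} (hl : l ∈ C) {c : ℝ}
    (hc : ∀ n : ℕ, ‖f (((n : ℝ) + 1) • l)‖ ≤ c) : f l = f 0 := by
  have h1 : ∀ n : ℕ, ‖f l - f 0‖ ≤ 1 / ((n : ℝ) + 1) * (c + ‖f 0‖) := by
    intro n
    have h0 : (0 : ℝ) < 1 / ((n : ℝ) + 1) := by positivity
    have h01 : 1 / ((n : ℝ) + 1) ≤ 1 := by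
      rw [div_le_one (by positivity)]; linarith [(n.cast_nonneg : (0 : ℝ) ≤ n)]
    have h := hf _ (C.smul_mem hl (show (0 : ℝ) ≤ (n : ℝ) + 1 by positivity)) 0 C.zero_mem _
      h0.le h01
    rw [smul_zero, add_zero, smul_smul, one_div_mul_cancel (by positivity), one_smul] at h
    rw [h, sub_smul, one_smul, show ∀ a b c : F, a + (b - c) - b = a - c by intros; abel,
      ← smul_sub, norm_smul, Real.norm_of_nonneg h0.le]
    gcongr
    exact (norm_sub_le _ _).trans (by gcongr; exact hc n)
  have h2 : Tendsto (fun n : ℕ => 1 / ((n : ℝ) + 1) * (c + ‖f 0‖)) atTop (𝓝 0) := by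
    simpa using tendsto_one_div_add_atTop_nhds_zero_nat.mul_const (c + ‖f 0‖)
  have h3 := ge_of_tendsto' h2 h1
  exact sub_eq_zero.1 (norm_le_zero_iff.1 h3)

/-- The values at (n + 1) l and -(n + 1) l are nonnegative with average f(0), so f is bounded on the
line. -/
theorem eq_of_affine_of_nonneg {f : RVec d → ℝ} (hf : ∀ x ∈ C, ∀ y ∈ C, ∀ s : ℝ, 0 ≤ s → s ≤ 1 →
      f (s • x + (1 - s) • y) = s * f x + (1 - s) * f y) (h0 : ∀ x ∈ C, 0 ≤ f x) {l : RVec d}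
    (hl : l ∈ C) (hl' : -l ∈ C) : f l = f 0 := by
  have hsum : ∀ n : ℕ, f (((n : ℝ) + 1) • l) ≤ 2 * f 0 := by
    intro n
    have hp : (0 : ℝ) ≤ (n : ℝ) + 1 := by positivity
    have h := hf _ (C.smul_mem hl hp) _ (C.smul_mem hl' hp) (1 / 2) (by norm_num) (by norm_num)
    have h2 := h0 _ (C.smul_mem hl' hp)
    rw [smul_neg, show (1 : ℝ) - 1 / 2 = 1 / 2 by norm_num, smul_neg, add_neg_cancel] at h
    rw [smul_neg] at h2
    linarith
  refine eq_of_affine_of_norm_le (F := ℝ) hf hl (c := 2 * f 0) fun n => ?_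
  rw [Real.norm_of_nonneg (h0 _ (C.smul_mem hl (by positivity)))]
  exact hsum n

variable (χ : AffineTriplet (C : Set (RVec d)))

/-- The diagonal values are nonnegative and affine on the line, hence constant; polarization gives
the rest. -/
theorem diffForm_eq_of_neg_mem {l : RVec d} (hl : l ∈ C) (hl' : -l ∈ C) (v w : RVec d) :
    χ.diffForm l v w = χ.diffForm 0 v w := by
  have h : ∀ v, χ.diffForm l v v = χ.diffForm 0 v v := fun v =>
    eq_of_affine_of_nonneg (C := C) (f := fun x => χ.diffForm x v v)
      (fun x _ y _ s _ _ => χ.diffForm_convex x y v v s)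
      (fun x hx => χ.diffForm_nonneg hx v) hl hl'
  have h1 := h (v + w)
  simp only [map_add, LinearMap.add_apply, h v, h w, χ.diffForm_symm hl w v,
    χ.diffForm_symm C.zero_mem w v] at h1
  linarith

/-- The integral of the norm is nonnegative and affine, hence constant along the line; it bounds the
complex integral, which is therefore constant as well. -/
theorem integral_expIncrement_eq_of_neg_mem {l : RVec d} (hl : l ∈ C) (hl' : -l ∈ C) {u : CVec d}
    (hu : rePart u ∈ χ.expDomain) :
    ∫ ξ, expIncrement u ξ ∂(χ.K l) = ∫ ξ, expIncrement u ξ ∂(χ.K 0) := by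
  have hint : ∀ x ∈ C, Integrable (expIncrement u) (χ.K x) := fun x hx =>
    χ.integrable_expIncrement hx hu
  have hconst : ∀ l ∈ C, -l ∈ C → ∫ ξ, ‖expIncrement u ξ‖ ∂(χ.K l) =
      ∫ ξ, ‖expIncrement u ξ‖ ∂(χ.K 0) := fun l hl hl' =>
    eq_of_affine_of_nonneg (C := C) (f := fun x => ∫ ξ, ‖expIncrement u ξ‖ ∂(χ.K x))
      (fun x hx y hy s h0 h1 => χ.integral_K_convex hx hy (hint x hx).norm (hint y hy).norm h0 h1)
      (fun x hx => integral_nonneg fun _ => norm_nonneg _) hl hl'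
  refine eq_of_affine_of_norm_le (C := C) (f := fun x => ∫ ξ, expIncrement u ξ ∂(χ.K x))
    (fun x hx y hy s h0 h1 => χ.integral_K_convex hx hy (hint x hx) (hint y hy) h0 h1) hl
    (c := ∫ ξ, ‖expIncrement u ξ‖ ∂(χ.K 0)) fun n => ?_
  have hp : (0 : ℝ) ≤ (n : ℝ) + 1 := by positivity
  rw [← hconst _ (C.smul_mem hl hp) (by rw [← smul_neg]; exact C.smul_mem hl' hp)]
  exact norm_integral_le_integral_norm _

/-- Along the lineality space of the state space only the drift varies. -/
theorem cpair_complexR_of_neg_mem (hspan : Submodule.span ℝ (C : Set (RVec d)) = ⊤)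
    {l : RVec d} (hl : l ∈ C) (hl' : -l ∈ C) {u : CVec d} (hu : rePart u ∈ χ.expDomain) :
    cpair (χ.complexR u) l = cpair u (χ.b l - χ.b 0) := by
  rw [χ.cpair_complexR hspan hu hl, χ.complexRx_eq hl, χ.complexRx_eq C.zero_mem,
    χ.integral_expIncrement_eq_of_neg_mem hl hl' hu, cpair_sub]
  simp only [χ.diffForm_eq_of_neg_mem hl hl']
  ring

/-- Quasi-monotonicity between -y and 0, tested at both l and -l, forces ⟨R(-y), l⟩ = 0, and along a
line this pairing sees only the drift. -/
theorem inner_drift_eq_zero_of_neg_mem {Ω : Type*} [MeasurableSpace Ω]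
    {Z : AffineProcess (C : Set (RVec d)) Ω} (hχ : χ.IsCharacteristicsOf Z)
    (hspan : Submodule.span ℝ (C : Set (RVec d)) = ⊤) {l : RVec d} (hl : l ∈ C) (hl' : -l ∈ C)
    {y : RVec d} (hy : y ∈ ProperCone.innerDual (C : Set (RVec d))) :
    inner ℝ y (χ.b l - χ.b 0) = 0 := by
  have horth : ∀ l ∈ C, -l ∈ C → inner ℝ y l = 0 := fun l hl hl' => by
    have h1 := inner_nonneg_of_mem_innerDual hy hl
    have h2 := inner_nonneg_of_mem_innerDual hy hl'
    rw [inner_neg_right] at h2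
    linarith
  have hle : (0 : RVec d) - -y ∈ ProperCone.innerDual (C : Set (RVec d)) := by simpa using hy
  have hy' : -y ∈ χ.expDomain := χ.mem_expDomain_of_le hχ hspan χ.zero_mem_expDomain hle
  have h0 : χ.realR 0 = 0 := by
    have : toC (χ.realR 0) = toC 0 := by
      refine eq_of_cpair_eq hspan fun x hx => ?_
      rw [cpair_toC, χ.inner_realR hspan χ.zero_mem_expDomain hx, cpair_toC]
      simp [realRx_eq]
    simpa using congrArg rePart this
  have key : ∀ l ∈ C, -l ∈ C → inner ℝ (χ.realR (-y)) l ≤ 0 := fun l hl hl' => by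
    have := χ.inner_realR_le_of_le hχ hspan χ.zero_mem_expDomain hle hl (by simp [horth l hl hl'])
    simpa [h0] using this
  have h1 := key l hl hl'
  have h2 := key (-l) hl' (by simpa using hl)
  rw [inner_neg_right] at h2
  have h3 := χ.cpair_complexR_of_neg_mem hspan hl hl' (u := toC (-y)) (by rwa [rePart_toC])
  rw [← χ.realR_eq hspan hy', cpair_toC, cpair_toC, inner_neg_left] at h3
  have h4 : inner ℝ (χ.realR (-y)) l = -inner ℝ y (χ.b l - χ.b 0) := by exact_mod_cast h3
  linarith

end Line

end AffineTriplet

end AffineMoments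

namespace AffineMoments

/-! ### Scalar exponential inequalities with only real parts bounded above. -/

section Scalar

/-- Mean value inequality on a half-plane containing 0: no bound on Im w is needed. -/
theorem norm_exp_sub_one_le_of_re_le {w : ℂ} {B : ℝ} (hB : 0 ≤ B) (hw : w.re ≤ B) :
    ‖Complex.exp w - 1‖ ≤ Real.exp B * ‖w‖ := by
  have h := Convex.norm_image_sub_le_of_norm_hasDerivWithin_le (f := Complex.exp)
    (f' := Complex.exp) (s := {z : ℂ | z.re ≤ B}) (C := Real.exp B)
    (fun z _ => (Complex.hasDerivAt_exp z).hasDerivWithinAt)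
    (fun z hz => by rw [Complex.norm_exp]; exact Real.exp_le_exp.2 hz)
    (convex_halfSpace_re_le _) (x := 0) (y := w) (by simpa using hB) hw
  simpa using h

/-- Splitting off the increment `exp z - 1 - z` of one summand of the exponent. -/
theorem norm_exp_add_sub_le {z I J : ℂ} {B N : ℝ} (hB : 0 ≤ B) (hN : 0 ≤ N) (hz : z.re ≤ B)
    (hI : I.re ≤ B) (hJ : ‖J‖ ≤ N) :
    ‖(Complex.exp (z + I + J) - 1 - (z + I + J)) - (Complex.exp z - 1 - z)‖ ≤
      Real.exp (2 * B + N) * (‖I‖ + ‖J‖ ^ 2 + ‖z‖ * ‖J‖) + ‖I‖ := by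
  -- Each term of this expansion carries a factor I, a second-order remainder in J, or the product
  -- of e^z - 1 with J; the superlinear part in z has cancelled.
  have heq : (Complex.exp (z + I + J) - 1 - (z + I + J)) - (Complex.exp z - 1 - z) =
      Complex.exp z * Complex.exp J * (Complex.exp I - 1) +
      Complex.exp z * (Complex.exp J - 1 - J) + (Complex.exp z - 1) * J - I := by
    rw [Complex.exp_add, Complex.exp_add]; ring
  have hez : ‖Complex.exp z‖ ≤ Real.exp B := by
    rw [Complex.norm_exp]; exact Real.exp_le_exp.2 hz
  have heJ : ‖Complex.exp J‖ ≤ Real.exp N := by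
    rw [Complex.norm_exp]; exact Real.exp_le_exp.2 ((Complex.re_le_norm J).trans hJ)
  have h1 : ‖Complex.exp z * Complex.exp J * (Complex.exp I - 1)‖ ≤
      Real.exp (2 * B + N) * ‖I‖ := by
    rw [norm_mul, norm_mul]
    calc _ ≤ Real.exp B * Real.exp N * (Real.exp B * ‖I‖) := by
          gcongr; exact norm_exp_sub_one_le_of_re_le hB hI
      _ = _ := by rw [two_mul, Real.exp_add, Real.exp_add]; ring
  have h2 : ‖Complex.exp z * (Complex.exp J - 1 - J)‖ ≤ Real.exp (2 * B + N) * ‖J‖ ^ 2 := by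
    rw [norm_mul]
    calc _ ≤ Real.exp B * (‖J‖ ^ 2 * Real.exp N) := by
          gcongr
          exact (norm_exp_sub_one_sub_le J).trans (by gcongr)
      _ = Real.exp (B + N) * ‖J‖ ^ 2 := by rw [Real.exp_add]; ring
      _ ≤ _ := by gcongr; linarith
  have h3 : ‖(Complex.exp z - 1) * J‖ ≤ Real.exp (2 * B + N) * (‖z‖ * ‖J‖) := by
    rw [norm_mul]
    calc _ ≤ Real.exp B * ‖z‖ * ‖J‖ := by
          gcongr; exact norm_exp_sub_one_le_of_re_le hB hz
      _ ≤ Real.exp (2 * B + N) * ‖z‖ * ‖J‖ := by gcongr; linarith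
      _ = _ := by ring
  rw [heq]
  refine (norm_sub_le _ _).trans (add_le_add_left ?_ _)
  refine (norm_add_le _ _).trans ?_
  have h4 := norm_add_le (Complex.exp z * Complex.exp J * (Complex.exp I - 1))
    (Complex.exp z * (Complex.exp J - 1 - J))
  rw [mul_add, mul_add]
  linarith

/-- The one-sided bound that controls infinite-variation jumps of a nonnegative coordinate. -/
theorem re_conj_mul_exp_sub_le {c : ℂ} {s S B : ℝ} (hs : 0 ≤ s) (hsS : s ≤ S) (hB : 0 ≤ B)
    (hc : c.re ≤ B) : (starRingEnd ℂ c * (Complex.exp (c * s) - 1 - c * s)).re ≤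
      ‖c‖ ^ 2 * (B * Real.exp (S * B)) * s ^ 2 := by
  set κ := ‖c‖ ^ 2 * (B * Real.exp (S * B)) with hκ
  have hd : ∀ t : ℝ, HasDerivAt (fun t : ℝ =>
      (starRingEnd ℂ c * (Complex.exp (c * t) - 1 - c * t)).re - κ * t ^ 2)
      ((starRingEnd ℂ c * (Complex.exp (c * t) * c - c)).re - κ * (2 * t)) t := by
    intro t
    have h0 : HasDerivAt (fun t : ℝ => c * (t : ℂ)) c t := by
      simpa using (Complex.ofRealCLM.hasDerivAt (x := t)).const_mul c
    have h1 : HasDerivAt (fun t : ℝ => starRingEnd ℂ c * (Complex.exp (c * t) - 1 - c * t))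
        (starRingEnd ℂ c * (Complex.exp (c * t) * c - c)) t :=
      ((h0.cexp.sub_const 1).sub h0).const_mul _
    have h2 := Complex.reCLM.hasFDerivAt.comp_hasDerivAt t h1
    have h3 : HasDerivAt (fun t : ℝ => κ * t ^ 2) (κ * (2 * t)) t := by
      simpa using (hasDerivAt_pow 2 t).const_mul κ
    exact h2.sub h3
  have hanti : AntitoneOn (fun t : ℝ =>
      (starRingEnd ℂ c * (Complex.exp (c * t) - 1 - c * t)).re - κ * t ^ 2) (Icc 0 s) := by
    refine antitoneOn_of_hasDerivWithinAt_nonpos (convex_Icc 0 s)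
      (fun t _ => (hd t).continuousAt.continuousWithinAt)
      (fun t _ => (hd t).hasDerivWithinAt) fun t ht => ?_
    have ht := interior_subset ht
    -- The conjugate factor collapses c̄ c to |c|², so the derivative is |c|² (Re e^{ct} - 1),
    -- bounded above through Re c ≤ B alone.
    have h1 : (starRingEnd ℂ c * (Complex.exp (c * t) * c - c)).re =
        ‖c‖ ^ 2 * ((Complex.exp (c * t)).re - 1) := by
      have : starRingEnd ℂ c * (Complex.exp (c * t) * c - c) =
          ((‖c‖ ^ 2 : ℝ) : ℂ) * (Complex.exp (c * t) - 1) := by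
        rw [← Complex.normSq_eq_norm_sq, Complex.normSq_eq_conj_mul_self]; ring
      rw [this, Complex.re_ofReal_mul]; simp
    have h2 : (Complex.exp (c * t)).re ≤ Real.exp (t * B) := by
      refine (Complex.re_le_norm _).trans ?_
      rw [Complex.norm_exp, Complex.re_mul_ofReal, mul_comm]
      exact Real.exp_le_exp.2 (mul_le_mul_of_nonneg_left hc ht.1)
    have h3 : Real.exp (t * B) - 1 ≤ t * (B * Real.exp (S * B)) := by
      have h4 := Real.add_one_le_exp (-(t * B))
      have h5 : Real.exp (t * B) * Real.exp (-(t * B)) = 1 := by rw [← Real.exp_add]; simp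
      have h6 : Real.exp (t * B) ≤ Real.exp (S * B) :=
        Real.exp_le_exp.2 (mul_le_mul_of_nonneg_right (ht.2.trans hsS) hB)
      have h7 : 0 ≤ t * B := mul_nonneg ht.1 hB
      nlinarith [Real.exp_pos (t * B)]
    rw [h1]
    have h8 : 0 ≤ ‖c‖ ^ 2 * (t * (B * Real.exp (S * B))) := by
      have := ht.1
      positivity
    have h9 : ‖c‖ ^ 2 * ((Complex.exp (c * t)).re - 1) ≤
        ‖c‖ ^ 2 * (t * (B * Real.exp (S * B))) := by gcongr; linarith
    have h10 : κ * (2 * t) = 2 * (‖c‖ ^ 2 * (t * (B * Real.exp (S * B)))) := by rw [hκ]; ring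
    linarith
  have h := hanti (left_mem_Icc.2 hs) (right_mem_Icc.2 hs) hs
  exact sub_nonpos.1 (h.trans_eq (by simp))

end Scalar

/-! ### Growth of ℛ_x with one distinguished direction. -/

namespace AffineTriplet

variable {d : ℕ} {D : Set (RVec d)} (χ : AffineTriplet D)

/-- The complex bilinear extension of the diffusion form. -/
noncomputable def diffFormC (x : RVec d) : CVec d →ₗ[ℂ] CVec d →ₗ[ℂ] ℂ :=
  LinearMap.mk₂ ℂ (fun v w => ∑ i, ∑ j, v i * ((χ.a x i j : ℝ) : ℂ) * w j)
    (fun v v' w => by simp [add_mul, Finset.sum_add_distrib])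
    (fun c v w => by simp [Finset.mul_sum, mul_assoc])
    (fun v w w' => by simp [mul_add, Finset.sum_add_distrib])
    (fun c v w => by
      simp only [Finset.mul_sum, PiLp.smul_apply, smul_eq_mul]
      exact Finset.sum_congr rfl fun i _ => Finset.sum_congr rfl fun j _ => by ring)

theorem diffFormC_apply (x : RVec d) (v w : CVec d) :
    χ.diffFormC x v w = ∑ i, ∑ j, v i * ((χ.a x i j : ℝ) : ℂ) * w j := rfl

theorem diffFormC_symm {x : RVec d} (hx : x ∈ D) (v w : CVec d) :
    χ.diffFormC x v w = χ.diffFormC x w v := by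
  have h : ∀ i j, χ.a x i j = χ.a x j i := fun i j => by
    have := (χ.a_posSemidef x hx).isHermitian.apply j i
    simpa using this
  rw [diffFormC_apply, diffFormC_apply, Finset.sum_comm]
  exact Finset.sum_congr rfl fun i _ => Finset.sum_congr rfl fun j _ => by rw [h i j]; ring

theorem diffFormC_toC (x y : RVec d) (w : CVec d) : χ.diffFormC x (toC y) w =
    (χ.diffForm x y (rePart w) : ℂ) + (χ.diffForm x y (imPart w) : ℂ) * Complex.I := by
  simp only [diffFormC_apply, diffForm_apply]
  apply Complex.ext <;> simp

theorem exists_norm_diffFormC_le (x : RVec d) :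
    ∃ c, 0 ≤ c ∧ ∀ v w, ‖χ.diffFormC x v w‖ ≤ c * ‖v‖ * ‖w‖ := by
  refine ⟨∑ i, ∑ j, ‖((χ.a x i j : ℝ) : ℂ)‖, Finset.sum_nonneg fun i _ =>
    Finset.sum_nonneg fun j _ => norm_nonneg _, fun v w => ?_⟩
  rw [diffFormC_apply, Finset.sum_mul, Finset.sum_mul]
  refine (norm_sum_le _ _).trans (Finset.sum_le_sum fun i _ => ?_)
  rw [Finset.sum_mul, Finset.sum_mul]
  refine (norm_sum_le _ _).trans (Finset.sum_le_sum fun j _ => ?_)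
  rw [norm_mul, norm_mul]
  have h1 := PiLp.norm_apply_le v i
  have h2 := PiLp.norm_apply_le w j
  calc _ ≤ ‖v‖ * ‖((χ.a x i j : ℝ) : ℂ)‖ * ‖w‖ := by gcongr
    _ = _ := by ring

theorem complexRx_eq_diffFormC (x : RVec d) (u : CVec d) : χ.complexRx x u =
    (1 / 2 : ℂ) * χ.diffFormC x u u + cpair u (χ.b x) + ∫ ξ, expIncrement u ξ ∂(χ.K x) := rfl

end AffineTriplet

/-- The compensated exponential increment along a single direction `g`, over the small jumps. -/
noncomputable def axisIncrement {d : ℕ} (c : ℂ) (g ξ : RVec d) : ℂ :=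
  Complex.exp (c * ((inner ℝ g (trunc ξ) : ℝ) : ℂ)) - 1 - c * ((inner ℝ g (trunc ξ) : ℝ) : ℂ)

theorem measurable_axisIncrement {d : ℕ} (c : ℂ) (g : RVec d) :
    Measurable (axisIncrement c g) := by
  have h : Measurable fun ξ : RVec d => c * ((inner ℝ g (trunc ξ) : ℝ) : ℂ) :=
    (Complex.measurable_ofReal.comp (measurable_const.inner measurable_trunc)).const_mul c
  exact (h.cexp.sub_const 1).sub h

theorem norm_trunc_sq_le {d : ℕ} (ξ : RVec d) : ‖trunc ξ‖ ^ 2 ≤ levyWeight ξ := by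
  rcases le_or_gt ‖ξ‖ 1 with h | h
  · rw [trunc_of_le h, levyWeight_of_le h]
  · rw [trunc_of_gt h, norm_zero]
    simpa using levyWeight_nonneg ξ

theorem norm_axisIncrement_le {d : ℕ} (c : ℂ) (g ξ : RVec d) : ‖axisIncrement c g ξ‖ ≤
    (‖c‖ * ‖g‖) ^ 2 * Real.exp (‖c‖ * ‖g‖) * levyWeight ξ := by
  have h1 : ‖c * ((inner ℝ g (trunc ξ) : ℝ) : ℂ)‖ ≤ ‖c‖ * ‖g‖ * ‖trunc ξ‖ := by
    rw [norm_mul, Complex.norm_real, mul_assoc]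
    gcongr
    exact norm_inner_le_norm _ _
  have h2 : ‖c‖ * ‖g‖ * ‖trunc ξ‖ ≤ ‖c‖ * ‖g‖ :=
    mul_le_of_le_one_right (by positivity) (norm_trunc_le ξ)
  refine (norm_exp_sub_one_sub_le _).trans ?_
  calc _ ≤ (‖c‖ * ‖g‖ * ‖trunc ξ‖) ^ 2 * Real.exp (‖c‖ * ‖g‖) := by
        gcongr; exact h1.trans h2
    _ = (‖c‖ * ‖g‖) ^ 2 * Real.exp (‖c‖ * ‖g‖) * ‖trunc ξ‖ ^ 2 := by ring
    _ ≤ _ := by gcongr; exact norm_trunc_sq_le ξ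

namespace AffineTriplet

variable {d : ℕ} {C : ProperCone ℝ (RVec d)} (χ : AffineTriplet (C : Set (RVec d)))
  {Ω : Type*} [MeasurableSpace Ω] {Z : AffineProcess (C : Set (RVec d)) Ω}

theorem integrable_axisIncrement {x : RVec d} (hx : x ∈ C) (c : ℂ) (g : RVec d) :
    Integrable (axisIncrement c g) (χ.K x) :=
  χ.integrable_of_norm_le hx (measurable_axisIncrement c g).aestronglyMeasurable _
    (norm_axisIncrement_le c g)

variable {ι : Type*} {t : Finset ι} {g : ι → RVec d} {g₀ : RVec d}

/-- On the cone the pairings of g₀ and g j with jumps are nonnegative, so upper bounds on the real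
parts of the coefficients control all exponentials. After the part along g₀ is removed, the size U
of the coefficients enters only linearly, apart from the separate large-jump exponential. -/
theorem norm_expIncrement_sub_axisIncrement_le
    (hg₀ : g₀ ∈ ProperCone.innerDual (C : Set (RVec d)))
    (hg : ∀ j ∈ t, g j ∈ ProperCone.innerDual (C : Set (RVec d)))
    {B N U : ℝ} (hB : 0 ≤ B) {c₀ : ℂ} {v : ι → ℂ} {r u : CVec d}
    (hu : u = c₀ • toC g₀ + ∑ j ∈ t, v j • toC (g j) + r)
    (hc₀ : c₀.re ≤ B) (hv : ∀ j ∈ t, (v j).re ≤ B) (hr : ‖r‖ ≤ N)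
    (hc₀U : ‖c₀‖ ≤ U) (hvU : ∀ j ∈ t, ‖v j‖ ≤ U) {ξ : RVec d} (hξ : ξ ∈ C) :
    ‖expIncrement u ξ - axisIncrement c₀ g₀ ξ‖ ≤ (1 + U) *
      ((Real.exp (2 * (B * (‖g₀‖ + ∑ j ∈ t, ‖g j‖)) + N) + 1) *
          ∑ j ∈ t, inner ℝ (g j) (trunc ξ) +
        (Real.exp (2 * (B * (‖g₀‖ + ∑ j ∈ t, ‖g j‖)) + N) * (N ^ 2 + ‖g₀‖ * N) + 1) *
          levyWeight ξ) +
      {ξ : RVec d | 1 ≤ ‖ξ‖}.indicator (fun ξ => Real.exp (inner ℝ (rePart u) ξ)) ξ := by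
  set E := Real.exp (2 * (B * (‖g₀‖ + ∑ j ∈ t, ‖g j‖)) + N) with hE
  have hE0 : 0 < E := Real.exp_pos _
  have hind : 0 ≤ {ξ : RVec d | 1 ≤ ‖ξ‖}.indicator
      (fun ξ => Real.exp (inner ℝ (rePart u) ξ)) ξ :=
    indicator_nonneg (fun _ _ => (Real.exp_pos _).le) _
  have hN : 0 ≤ N := (norm_nonneg _).trans hr
  have hU : 0 ≤ U := (norm_nonneg _).trans hc₀U
  have hlw := levyWeight_nonneg ξ
  rcases le_or_gt ‖ξ‖ 1 with h | h
  · rw [trunc_of_le h, levyWeight_of_le h]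
    have hgξ : ∀ j ∈ t, 0 ≤ inner ℝ (g j) ξ := fun j hj =>
      inner_nonneg_of_mem_innerDual (hg j hj) hξ
    have hinner : ∀ y : RVec d, inner ℝ y ξ ≤ ‖y‖ := fun y =>
      (real_inner_le_norm _ _).trans (mul_le_of_le_one_right (norm_nonneg _) h)
    set z : ℂ := c₀ * ((inner ℝ g₀ ξ : ℝ) : ℂ) with hz
    set I : ℂ := ∑ j ∈ t, v j * ((inner ℝ (g j) ξ : ℝ) : ℂ) with hI
    set J : ℂ := cpair r ξ with hJ
    set S := ∑ j ∈ t, inner ℝ (g j) ξ with hS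
    have hsum0 : 0 ≤ ∑ j ∈ t, ‖g j‖ := Finset.sum_nonneg fun _ _ => norm_nonneg _
    have hS0 : 0 ≤ S := Finset.sum_nonneg hgξ
    have hcp : cpair u ξ = z + I + J := by
      have hsum : ∀ s : Finset ι, cpair (∑ j ∈ s, v j • toC (g j)) ξ =
          ∑ j ∈ s, v j * ((inner ℝ (g j) ξ : ℝ) : ℂ) := fun s => by
        classical
        induction s using Finset.induction_on with
        | empty => simp [cpair]
        | insert a s ha ih => rw [Finset.sum_insert ha, Finset.sum_insert ha, add_cpair, ih,
            smul_cpair, cpair_toC]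
      rw [hu, add_cpair, add_cpair, smul_cpair, cpair_toC, hsum]
    have hzre : z.re ≤ B * (‖g₀‖ + ∑ j ∈ t, ‖g j‖) := by
      rw [hz, Complex.re_mul_ofReal]
      have h0 := inner_nonneg_of_mem_innerDual hg₀ hξ
      calc _ ≤ B * inner ℝ g₀ ξ := by gcongr
        _ ≤ _ := by gcongr; linarith [hinner g₀]
    have hIre : I.re ≤ B * (‖g₀‖ + ∑ j ∈ t, ‖g j‖) := by
      have h1 : I.re ≤ ∑ j ∈ t, B * ‖g j‖ := by
        rw [hI, Complex.re_sum]
        refine Finset.sum_le_sum fun j hj => ?_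
        rw [Complex.re_mul_ofReal]
        have h0 := hgξ j hj
        calc _ ≤ B * inner ℝ (g j) ξ := by gcongr; exact hv j hj
          _ ≤ _ := by gcongr; exact hinner _
      rw [← Finset.mul_sum] at h1
      refine h1.trans (by gcongr; linarith [norm_nonneg g₀])
    have hInorm : ‖I‖ ≤ U * S := by
      rw [hI, hS, Finset.mul_sum]
      refine (norm_sum_le _ _).trans (Finset.sum_le_sum fun j hj => ?_)
      rw [norm_mul, Complex.norm_real, Real.norm_of_nonneg (hgξ j hj)]
      have := hgξ j hj
      gcongr
      exact hvU j hj
    have hJnorm : ‖J‖ ≤ N * ‖ξ‖ := (norm_cpair_le _ _).trans (by gcongr)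
    have hznorm : ‖z‖ ≤ U * (‖g₀‖ * ‖ξ‖) := by
      rw [hz, norm_mul, Complex.norm_real]
      gcongr
      exact norm_inner_le_norm _ _
    have hmain := norm_exp_add_sub_le (by positivity) hN hzre hIre
      (hJnorm.trans (mul_le_of_le_one_right hN h))
    rw [← hE] at hmain
    have heq : expIncrement u ξ - axisIncrement c₀ g₀ ξ =
        (Complex.exp (z + I + J) - 1 - (z + I + J)) - (Complex.exp z - 1 - z) := by
      rw [expIncrement, axisIncrement, trunc_of_le h, hcp]
    rw [heq]
    refine hmain.trans ?_
    calc E * (‖I‖ + ‖J‖ ^ 2 + ‖z‖ * ‖J‖) + ‖I‖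
        ≤ E * (U * S + (N * ‖ξ‖) ^ 2 + U * (‖g₀‖ * ‖ξ‖) * (N * ‖ξ‖)) + U * S := by gcongr
      _ = U * ((E + 1) * S + E * (‖g₀‖ * N) * ‖ξ‖ ^ 2) + E * N ^ 2 * ‖ξ‖ ^ 2 := by ring
      _ ≤ (1 + U) * ((E + 1) * S + E * (‖g₀‖ * N) * ‖ξ‖ ^ 2) +
          (1 + U) * (E * N ^ 2 * ‖ξ‖ ^ 2) := by
        have h1 : 0 ≤ E * N ^ 2 * ‖ξ‖ ^ 2 := by positivity
        have h2 : 0 ≤ (E + 1) * S + E * (‖g₀‖ * N) * ‖ξ‖ ^ 2 := by positivity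
        nlinarith [mul_nonneg hU h1]
      _ ≤ (1 + U) * ((E + 1) * S + (E * (N ^ 2 + ‖g₀‖ * N) + 1) * ‖ξ‖ ^ 2) := by
        rw [← mul_add]
        refine mul_le_mul_of_nonneg_left ?_ (by linarith)
        nlinarith [sq_nonneg ‖ξ‖]
      _ ≤ _ := le_add_of_nonneg_right hind
  · have h1 : expIncrement u ξ - axisIncrement c₀ g₀ ξ = Complex.exp (cpair u ξ) - 1 := by
      simp [expIncrement, axisIncrement, trunc_of_gt h, cpair_zero]
    rw [h1, trunc_of_gt h, levyWeight_of_ge h.le,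
      indicator_of_mem (show ξ ∈ {ξ : RVec d | 1 ≤ ‖ξ‖} from h.le)]
    have h2 := norm_sub_le (Complex.exp (cpair u ξ)) 1
    rw [Complex.norm_exp, cpair_re, norm_one] at h2
    simp only [inner_zero_right, Finset.sum_const_zero, mul_zero, zero_add, mul_one]
    have h3 : 1 ≤ (1 + U) * (E * (N ^ 2 + ‖g₀‖ * N) + 1) :=
      one_le_mul_of_one_le_of_one_le (by linarith) (le_add_of_nonneg_left (by positivity))
    linarith

/-- If all normals `g j` are orthogonal to `x`, then `ℛ_x` grows at most linearly, apart from the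
contribution of the direction `g₀`. -/
theorem exists_norm_complexRx_sub_axis_le (hχ : χ.IsCharacteristicsOf Z)
    (hspan : Submodule.span ℝ (C : Set (RVec d)) = ⊤) {x : RVec d} (hx : x ∈ C)
    (hg₀ : g₀ ∈ ProperCone.innerDual (C : Set (RVec d)))
    (hg : ∀ j ∈ t, g j ∈ ProperCone.innerDual (C : Set (RVec d)))
    (horth : ∀ j ∈ t, inner ℝ (g j) x = 0) {B N : ℝ} (hB : 0 ≤ B) (hN : 0 ≤ N) :
    ∃ c, 0 ≤ c ∧ ∀ (c₀ : ℂ) (v : ι → ℂ) (r u : CVec d) (U : ℝ),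
      u = c₀ • toC g₀ + ∑ j ∈ t, v j • toC (g j) + r → c₀.re ≤ B → (∀ j ∈ t, (v j).re ≤ B) →
      ‖r‖ ≤ N → ‖c₀‖ ≤ U → (∀ j ∈ t, ‖v j‖ ≤ U) → rePart u ∈ χ.expDomain →
      ∫ ξ, {ξ : RVec d | 1 ≤ ‖ξ‖}.indicator (fun ξ => Real.exp (inner ℝ (rePart u) ξ)) ξ
        ∂(χ.K x) ≤ B →
      ‖χ.complexRx x u - ((1 / 2 : ℂ) * (c₀ ^ 2 * (χ.diffForm x g₀ g₀ : ℂ)) +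
        ∫ ξ, axisIncrement c₀ g₀ ξ ∂(χ.K x))‖ ≤ c * (1 + U) := by
  obtain ⟨a, ha, hale⟩ := χ.exists_norm_diffFormC_le x
  set E := Real.exp (2 * (B * (‖g₀‖ + ∑ j ∈ t, ‖g j‖)) + N) with hE
  have hE0 : 0 < E := Real.exp_pos _
  set S := ∫ ξ, ∑ j ∈ t, inner ℝ (g j) (trunc ξ) ∂(χ.K x) with hS
  set W := ∫ ξ, levyWeight ξ ∂(χ.K x) with hW
  -- Orthogonality of g j to x gives finite variation here and annihilation by the diffusion below;
  -- hence only g₀ can contribute more than linear growth.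
  have hSint : Integrable (fun ξ => ∑ j ∈ t, inner ℝ (g j) (trunc ξ)) (χ.K x) :=
    integrable_finsetSum _ fun j hj =>
      χ.integrable_inner_trunc_of_orthogonal hχ hspan hx (hg j hj) (horth j hj)
  have hWint := χ.integrable_levyWeight (x := x) hx
  have hS0 : 0 ≤ S := integral_nonneg_of_ae (by
    filter_upwards [χ.ae_mem_cone hχ hspan hx] with ξ hξ
    refine Finset.sum_nonneg fun j hj => ?_
    rcases le_or_gt ‖ξ‖ 1 with h | h
    · rw [trunc_of_le h]; exact inner_nonneg_of_mem_innerDual (hg j hj) hξ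
    · rw [trunc_of_gt h, inner_zero_right])
  have hW0 : 0 ≤ W := integral_nonneg levyWeight_nonneg
  have hG0 : 0 ≤ ∑ j ∈ t, ‖toC (g j)‖ := Finset.sum_nonneg fun _ _ => norm_nonneg _
  refine ⟨(a * ‖toC g₀‖ * N + a * N * N) + (‖toC g₀‖ + ∑ j ∈ t, ‖toC (g j)‖ + N) * ‖χ.b x‖ +
    ((E + 1) * S + (E * (N ^ 2 + ‖g₀‖ * N) + 1) * W + B), by positivity, ?_⟩
  intro c₀ v r u U hu hc₀ hv hr hc₀U hvU huY hexp
  have hU : 0 ≤ U := (norm_nonneg _).trans hc₀U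
  -- the quadratic term
  have hzero : ∀ w, χ.diffFormC x (∑ j ∈ t, v j • toC (g j)) w = 0 := fun w => by
    simp only [map_sum, LinearMap.sum_apply, map_smul, LinearMap.smul_apply]
    refine Finset.sum_eq_zero fun j hj => ?_
    have h0 := χ.diffForm_eq_zero hx
      (χ.diffForm_self_eq_zero_of_orthogonal hχ hspan hx (hg j hj) (horth j hj))
    rw [diffFormC_toC, h0, h0]
    simp
  have hquad : χ.diffFormC x u u - c₀ ^ 2 * (χ.diffForm x g₀ g₀ : ℂ) =
      2 * (c₀ * χ.diffFormC x (toC g₀) r) + χ.diffFormC x r r := by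
    have h1 : χ.diffFormC x (toC g₀) (toC g₀) = (χ.diffForm x g₀ g₀ : ℂ) := by
      rw [diffFormC_toC]; simp
    have h2 := χ.diffFormC_symm hx r (toC g₀)
    have hzero' : ∀ w, χ.diffFormC x w (∑ j ∈ t, v j • toC (g j)) = 0 := fun w => by
      rw [χ.diffFormC_symm hx, hzero]
    rw [hu]
    simp only [map_add, LinearMap.add_apply, hzero, hzero', map_smul, LinearMap.smul_apply, h1, h2,
      smul_eq_mul]
    ring
  have hquad' : ‖(1 / 2 : ℂ) * (χ.diffFormC x u u - c₀ ^ 2 * (χ.diffForm x g₀ g₀ : ℂ))‖ ≤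
      (a * ‖toC g₀‖ * N + a * N * N) * (1 + U) := by
    have h1 : ‖2 * (c₀ * χ.diffFormC x (toC g₀) r)‖ ≤ 2 * (U * (a * ‖toC g₀‖ * N)) := by
      rw [norm_mul, norm_mul, RCLike.norm_ofNat]
      gcongr
      exact (hale _ _).trans (by gcongr)
    have h2 : ‖χ.diffFormC x r r‖ ≤ a * N * N := (hale _ _).trans (by gcongr)
    rw [hquad, norm_mul]
    have h3 : ‖(1 / 2 : ℂ)‖ = 1 / 2 := by norm_num
    rw [h3]
    have h4 := norm_add_le (2 * (c₀ * χ.diffFormC x (toC g₀) r)) (χ.diffFormC x r r)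
    have h5 : 0 ≤ a * ‖toC g₀‖ * N := by positivity
    have h6 : 0 ≤ a * N * N := by positivity
    nlinarith
  -- the drift
  have hdrift : ‖cpair u (χ.b x)‖ ≤ (‖toC g₀‖ + ∑ j ∈ t, ‖toC (g j)‖ + N) * ‖χ.b x‖ * (1 + U) := by
    have h1 : ‖u‖ ≤ (‖toC g₀‖ + ∑ j ∈ t, ‖toC (g j)‖ + N) * (1 + U) := by
      have h2 : ‖∑ j ∈ t, v j • toC (g j)‖ ≤ (∑ j ∈ t, ‖toC (g j)‖) * U := by
        rw [Finset.sum_mul]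
        refine (norm_sum_le _ _).trans (Finset.sum_le_sum fun j hj => ?_)
        rw [norm_smul, mul_comm]
        gcongr
        exact hvU j hj
      have h3 : ‖c₀ • toC g₀‖ ≤ U * ‖toC g₀‖ := by rw [norm_smul]; gcongr
      have h4 := norm_add_le (c₀ • toC g₀ + ∑ j ∈ t, v j • toC (g j)) r
      have h5 := norm_add_le (c₀ • toC g₀) (∑ j ∈ t, v j • toC (g j))
      rw [← hu] at h4
      nlinarith [norm_nonneg (toC g₀)]
    refine (norm_cpair_le _ _).trans ?_
    calc _ ≤ (‖toC g₀‖ + ∑ j ∈ t, ‖toC (g j)‖ + N) * (1 + U) * ‖χ.b x‖ := by gcongr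
      _ = _ := by ring
  -- the jumps
  have hjump : ‖∫ ξ, expIncrement u ξ ∂(χ.K x) - ∫ ξ, axisIncrement c₀ g₀ ξ ∂(χ.K x)‖ ≤
      ((E + 1) * S + (E * (N ^ 2 + ‖g₀‖ * N) + 1) * W + B) * (1 + U) := by
    rw [← integral_sub (χ.integrable_expIncrement hx huY) (χ.integrable_axisIncrement hx c₀ g₀)]
    have hint1 : Integrable (fun ξ => (1 + U) * ((E + 1) * ∑ j ∈ t, inner ℝ (g j) (trunc ξ) +
        (E * (N ^ 2 + ‖g₀‖ * N) + 1) * levyWeight ξ)) (χ.K x) :=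
      ((hSint.const_mul _).add (hWint.const_mul _)).const_mul _
    have hint2 := χ.integrable_indicator_exp hx huY
    refine (norm_integral_le_of_norm_le (hint1.add hint2) (by
      filter_upwards [χ.ae_mem_cone hχ hspan hx] with ξ hξ
      exact norm_expIncrement_sub_axisIncrement_le hg₀ hg hB hu hc₀ hv hr hc₀U hvU hξ)).trans ?_
    simp only [Pi.add_apply]
    rw [integral_add hint1 hint2, integral_const_mul,
      integral_add (hSint.const_mul _) (hWint.const_mul _), integral_const_mul, integral_const_mul]
    nlinarith
  have heq : χ.complexRx x u - ((1 / 2 : ℂ) * (c₀ ^ 2 * (χ.diffForm x g₀ g₀ : ℂ)) +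
      ∫ ξ, axisIncrement c₀ g₀ ξ ∂(χ.K x)) =
      (1 / 2 : ℂ) * (χ.diffFormC x u u - c₀ ^ 2 * (χ.diffForm x g₀ g₀ : ℂ)) +
      cpair u (χ.b x) + (∫ ξ, expIncrement u ξ ∂(χ.K x) - ∫ ξ, axisIncrement c₀ g₀ ξ ∂(χ.K x)) := by
    rw [complexRx_eq_diffFormC]; ring
  rw [heq]
  refine (norm_add_le _ _).trans ?_
  have := norm_add_le ((1 / 2 : ℂ) * (χ.diffFormC x u u - c₀ ^ 2 * (χ.diffForm x g₀ g₀ : ℂ)))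
    (cpair u (χ.b x))
  linarith

/-- The contribution of the direction `g₀` satisfies a one-sided bound. -/
theorem re_conj_mul_axis_le {x : RVec d} (hx : x ∈ C)
    (hg₀ : g₀ ∈ ProperCone.innerDual (C : Set (RVec d))) (hχ : χ.IsCharacteristicsOf Z)
    (hspan : Submodule.span ℝ (C : Set (RVec d)) = ⊤) {B : ℝ} (hB : 0 ≤ B) {c₀ : ℂ}
    (hc₀ : c₀.re ≤ B) :
    (starRingEnd ℂ c₀ * ((1 / 2 : ℂ) * (c₀ ^ 2 * (χ.diffForm x g₀ g₀ : ℂ)) +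
        ∫ ξ, axisIncrement c₀ g₀ ξ ∂(χ.K x))).re ≤
      (1 / 2 * B * χ.diffForm x g₀ g₀ + B * Real.exp (‖g₀‖ * B) * ‖g₀‖ ^ 2 *
        ∫ ξ, levyWeight ξ ∂(χ.K x)) * ‖c₀‖ ^ 2 := by
  -- The conjugate of c₀ times c₀² is |c₀|² c₀, whose real part is at most B |c₀|².
  have h1 : (starRingEnd ℂ c₀ * ((1 / 2 : ℂ) * (c₀ ^ 2 * (χ.diffForm x g₀ g₀ : ℂ)))).re =
      1 / 2 * χ.diffForm x g₀ g₀ * ‖c₀‖ ^ 2 * c₀.re := by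
    have : starRingEnd ℂ c₀ * ((1 / 2 : ℂ) * (c₀ ^ 2 * (χ.diffForm x g₀ g₀ : ℂ))) =
        ((1 / 2 * χ.diffForm x g₀ g₀ * ‖c₀‖ ^ 2 : ℝ) : ℂ) * c₀ := by
      push_cast
      rw [show (‖c₀‖ : ℂ) ^ 2 = ((‖c₀‖ ^ 2 : ℝ) : ℂ) by push_cast; rfl,
        ← Complex.normSq_eq_norm_sq, Complex.normSq_eq_conj_mul_self]
      ring
    rw [this, Complex.re_ofReal_mul]
  have h2 : (starRingEnd ℂ c₀ * ∫ ξ, axisIncrement c₀ g₀ ξ ∂(χ.K x)).re ≤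
      ∫ ξ, ‖c₀‖ ^ 2 * (B * Real.exp (‖g₀‖ * B)) * (‖g₀‖ ^ 2 * levyWeight ξ) ∂(χ.K x) := by
    have hint := (χ.integrable_axisIncrement hx c₀ g₀).const_mul (starRingEnd ℂ c₀)
    have h3 : (starRingEnd ℂ c₀ * ∫ ξ, axisIncrement c₀ g₀ ξ ∂(χ.K x)).re =
        ∫ ξ, (starRingEnd ℂ c₀ * axisIncrement c₀ g₀ ξ).re ∂(χ.K x) := by
      rw [← integral_const_mul]
      exact (integral_re hint).symm
    rw [h3]
    refine integral_mono_ae hint.re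
      (((χ.integrable_levyWeight (x := x) hx).const_mul _).const_mul _) ?_
    filter_upwards [χ.ae_mem_cone hχ hspan hx] with ξ hξ
    have hs : 0 ≤ inner ℝ g₀ (trunc ξ) := by
      rcases le_or_gt ‖ξ‖ 1 with h | h
      · rw [trunc_of_le h]; exact inner_nonneg_of_mem_innerDual hg₀ hξ
      · rw [trunc_of_gt h, inner_zero_right]
    have hle := real_inner_le_norm g₀ (trunc ξ)
    have hsS : inner ℝ g₀ (trunc ξ) ≤ ‖g₀‖ :=
      hle.trans (mul_le_of_le_one_right (norm_nonneg _) (norm_trunc_le ξ))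
    refine (re_conj_mul_exp_sub_le hs hsS hB hc₀).trans ?_
    gcongr
    calc _ ≤ (‖g₀‖ * ‖trunc ξ‖) ^ 2 := by gcongr
      _ = ‖g₀‖ ^ 2 * ‖trunc ξ‖ ^ 2 := by ring
      _ ≤ _ := by gcongr; exact norm_trunc_sq_le ξ
  rw [mul_add, Complex.add_re, h1]
  rw [integral_const_mul, integral_const_mul] at h2
  have h4 : 1 / 2 * χ.diffForm x g₀ g₀ * ‖c₀‖ ^ 2 * c₀.re ≤
      1 / 2 * χ.diffForm x g₀ g₀ * ‖c₀‖ ^ 2 * B := by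
    have := χ.diffForm_nonneg hx g₀
    gcongr
  linarith

end AffineTriplet

end AffineMoments

/-! ### The a priori bound on the canonical state space. -/

namespace AffineMoments

/-- Grönwall's inequality for a nonnegative Lyapunov function. -/
theorem le_mul_exp_of_deriv_le {T τ c : ℝ} (hτT : τ ≤ T) (hc : 0 ≤ c) {W W' : ℝ → ℝ}
    (hW0 : 0 ≤ W 0) (hW : ∀ t ∈ Icc 0 τ, HasDerivWithinAt W (W' t) (Icc 0 τ) t)
    (hle : ∀ t ∈ Icc 0 τ, W' t ≤ c * (1 + W t)) :
    ∀ t ∈ Icc 0 τ, W t ≤ (1 + W 0) * Real.exp (c * T) := by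
  intro t ht
  have hsub : Icc 0 t ⊆ Icc 0 τ := Icc_subset_Icc_right ht.2
  have h := add_one_le_of_deriv_le_mul ht.1 (fun s hs => (hW s (hsub hs)).mono hsub)
    (fun s hs => hle s (hsub hs))
  have h1 : Real.exp (c * t) ≤ Real.exp (c * T) :=
    Real.exp_le_exp.2 (mul_le_mul_of_nonneg_left (ht.2.trans hτT) hc)
  have h2 := mul_le_mul_of_nonneg_left h1 (by linarith : 0 ≤ 1 + W 0)
  linarith

namespace AffineTriplet

variable {d : ℕ} {C : ProperCone ℝ (RVec d)} {χ : AffineTriplet (C : Set (RVec d))}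

/-- The common form of all Lyapunov arguments: the derivative of the sum of squares is twice the sum
in the hypothesis, and Grönwall applies. -/
theorem IsRiccatiPath.sum_norm_cpair_sq_le {ι : Type*} [Fintype ι] (x : ι → RVec d) {T τ : ℝ}
    {ψ : ℝ → CVec d} (hψ : χ.IsRiccatiPath τ ψ) (hτT : τ ≤ T) {c : ℝ} (hc : 0 ≤ c)
    (hle : ∀ t ∈ Icc 0 τ, ∑ i, (starRingEnd ℂ (cpair (ψ t) (x i)) *
      cpair (χ.complexR (ψ t)) (x i)).re ≤ c * (1 + ∑ i, ‖cpair (ψ t) (x i)‖ ^ 2)) :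
    ∀ t ∈ Icc 0 τ, ∑ i, ‖cpair (ψ t) (x i)‖ ^ 2 ≤
      (1 + ∑ i, ‖cpair (ψ 0) (x i)‖ ^ 2) * Real.exp (2 * c * T) := by
  refine le_mul_exp_of_deriv_le hτT (by positivity) (W := fun t => ∑ i, ‖cpair (ψ t) (x i)‖ ^ 2)
    (W' := fun t => ∑ i, 2 * (starRingEnd ℂ (cpair (ψ t) (x i)) *
      cpair (χ.complexR (ψ t)) (x i)).re)
    (Finset.sum_nonneg fun _ _ => by positivity) (fun t ht => ?_) fun t ht => ?_
  · refine HasDerivWithinAt.fun_sum fun i _ => ?_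
    have h1 : HasDerivWithinAt (fun t => cpair (ψ t) (x i)) (cpair (χ.complexR (ψ t)) (x i))
        (Icc 0 τ) t := (cpairL (x i)).hasFDerivAt.comp_hasDerivWithinAt t (hψ.2 t ht)
    have h2 := h1.norm_sq
    rwa [Complex.inner, mul_comm (cpair (χ.complexR (ψ t)) (x i))] at h2
  · have h := hle t ht
    rw [← Finset.mul_sum]
    linarith

end AffineTriplet

namespace AffineTriplet

variable {d : ℕ} {C : ProperCone ℝ (RVec d)} (χ : AffineTriplet (C : Set (RVec d)))
  {Ω : Type*} [MeasurableSpace Ω] {Z : AffineProcess (C : Set (RVec d)) Ω}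

/-- Uniform bounds for exponents dominated by a point of a compact subset of the moment domain. -/
theorem exists_integral_exp_le_of_dominated (hχ : χ.IsCharacteristicsOf Z)
    (hspan : Submodule.span ℝ (C : Set (RVec d)) = ⊤) {k : Set (RVec d)} (hk : IsCompact k)
    (hkY : k ⊆ interior χ.expDomain) {x : RVec d} (hx : x ∈ C) :
    ∃ B, ∀ y ∈ k, ∀ v, y - v ∈ ProperCone.innerDual (C : Set (RVec d)) →
      ∫ ξ, {ξ : RVec d | 1 ≤ ‖ξ‖}.indicator (fun ξ => Real.exp (inner ℝ v ξ)) ξ ∂(χ.K x) ≤ B := by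
  obtain ⟨B, hB⟩ := χ.exists_integral_exp_le hk hkY hx
  refine ⟨B, fun y hy v hv => le_trans ?_ (hB y hy)⟩
  have hyY := interior_subset (hkY hy)
  refine integral_mono_ae (χ.integrable_indicator_exp hx (χ.mem_expDomain_of_le hχ hspan hyY hv))
    (χ.integrable_indicator_exp hx hyY) ?_
  filter_upwards [χ.ae_mem_cone hχ hspan hx] with ξ hξ
  refine indicator_le_indicator (Real.exp_le_exp.2 ?_)
  have h := inner_nonneg_of_mem_innerDual hv hξ
  rw [inner_sub_left] at h
  linarith

section Canonical

variable {m n : ℕ} {f g : Fin m → RVec d} {l h : Fin n → RVec d}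

/-- The vectors g and h are the coordinate functionals for f and l; pairing with x and inserting the
expansion of x proves the dual expansion of u. -/
theorem eq_sum_frame (hspan : Submodule.span ℝ (C : Set (RVec d)) = ⊤)
    (hrep : ∀ x, x = ∑ i, inner ℝ (g i) x • f i + ∑ j, inner ℝ (h j) x • l j) (u : CVec d) :
    u = ∑ i, cpair u (f i) • toC (g i) + ∑ j, cpair u (l j) • toC (h j) := by
  refine eq_of_cpair_eq hspan fun x _ => ?_
  have hsum : ∀ {p : ℕ} (c : Fin p → ℂ) (w : Fin p → RVec d),
      cpair (∑ j, c j • toC (w j)) x = ∑ j, c j * ((inner ℝ (w j) x : ℝ) : ℂ) := by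
    intro p c w
    have h1 := map_sum (cpairL x) (fun j => c j • toC (w j)) Finset.univ
    refine h1.trans (Finset.sum_congr rfl fun j _ => ?_)
    change cpair _ x = _
    rw [smul_cpair, cpair_toC]
  rw [add_cpair, hsum, hsum]
  conv_lhs => rw [hrep x]
  rw [cpair_add, cpair_sum, cpair_sum]
  simp only [cpair_smul]
  exact congrArg₂ _ (Finset.sum_congr rfl fun i _ => mul_comm _ _)
    (Finset.sum_congr rfl fun i _ => mul_comm _ _)

/-- The components along the lineality space satisfy an autonomous linear equation. -/
theorem exists_line_components_le (hχ : χ.IsCharacteristicsOf Z)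
    (hspan : Submodule.span ℝ (C : Set (RVec d)) = ⊤)
    (hg : ∀ i, g i ∈ ProperCone.innerDual (C : Set (RVec d)))
    (hl : ∀ j, l j ∈ C) (hl' : ∀ j, -l j ∈ C)
    (hrep : ∀ x, x = ∑ i, inner ℝ (g i) x • f i + ∑ j, inner ℝ (h j) x • l j)
    (u : CVec d) (T : ℝ) : ∃ N, 0 ≤ N ∧ ∀ τ ≤ T, ∀ ψ : ℝ → CVec d, ψ 0 = u →
      χ.IsRiccatiPath τ ψ → ∀ t ∈ Icc 0 τ, ‖∑ j, cpair (ψ t) (l j) • toC (h j)‖ ≤ N := by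
  set β : Fin n → RVec d := fun j => χ.b (l j) - χ.b 0 with hβ
  have hS : ∀ u : CVec d, (∑ j, ‖cpair u (l j)‖) ^ 2 ≤ n * ∑ j, ‖cpair u (l j)‖ ^ 2 := fun u => by
    simpa using sq_sum_le_card_mul_sum_sq (s := Finset.univ) (f := fun j => ‖cpair u (l j)‖)
  have hone : ∀ (u : CVec d) j, ‖cpair u (l j)‖ ≤ ∑ j, ‖cpair u (l j)‖ := fun u j =>
    Finset.single_le_sum (f := fun j => ‖cpair u (l j)‖) (fun _ _ => norm_nonneg _)
      (Finset.mem_univ j)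
  set H := ∑ j, ‖toC (h j)‖ with hH
  have hH0 : 0 ≤ H := Finset.sum_nonneg fun _ _ => norm_nonneg _
  have hr : ∀ u : CVec d, ‖∑ j, cpair u (l j) • toC (h j)‖ ≤ H * ∑ j, ‖cpair u (l j)‖ := by
    intro u
    rw [hH, Finset.sum_mul]
    refine (norm_sum_le _ _).trans (Finset.sum_le_sum fun j _ => ?_)
    rw [norm_smul, mul_comm]
    gcongr
    exact hone u j
  set c := n * H * ∑ j, ‖β j‖ with hc
  have hβ0 : 0 ≤ ∑ j, ‖β j‖ := Finset.sum_nonneg fun _ _ => norm_nonneg _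
  have hc0 : 0 ≤ c := by positivity
  set V := (1 + ∑ j, ‖cpair u (l j)‖ ^ 2) * Real.exp (2 * c * T) with hV
  have hV0 : 0 ≤ V := by
    have : 0 ≤ ∑ j, ‖cpair u (l j)‖ ^ 2 := Finset.sum_nonneg fun _ _ => by positivity
    positivity
  refine ⟨H * Real.sqrt (n * V), by positivity, fun τ hτT ψ hψ0 hψ t ht => ?_⟩
  have hVt := hψ.sum_norm_cpair_sq_le l hτT hc0 (fun t ht => ?_) t ht
  · rw [hψ0] at hVt
    refine (hr _).trans (mul_le_mul_of_nonneg_left ?_ hH0)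
    refine Real.le_sqrt_of_sq_le ((hS _).trans ?_)
    gcongr
  · have huY := interior_subset (hψ.1 t ht)
    have hterm : ∀ j, (starRingEnd ℂ (cpair (ψ t) (l j)) * cpair (χ.complexR (ψ t)) (l j)).re ≤
        H * ‖β j‖ * (∑ j, ‖cpair (ψ t) (l j)‖) ^ 2 := by
      intro j
      -- The drift β j pairs to zero with every g i, so only the components of ψ along h enter, and
      -- the system for them is closed and linear.
      have h1 : cpair (χ.complexR (ψ t)) (l j) =
          cpair (∑ j, cpair (ψ t) (l j) • toC (h j)) (β j) := by
        rw [χ.cpair_complexR_of_neg_mem hspan (hl j) (hl' j) huY]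
        conv_lhs => rw [eq_sum_frame (C := C) hspan hrep (ψ t)]
        rw [add_cpair]
        refine add_eq_right.2 ?_
        have h2 := map_sum (cpairL (β j)) (fun i => cpair (ψ t) (f i) • toC (g i)) Finset.univ
        refine h2.trans (Finset.sum_eq_zero fun i _ => ?_)
        change cpair _ (β j) = 0
        rw [smul_cpair, cpair_toC,
          χ.inner_drift_eq_zero_of_neg_mem hχ hspan (hl j) (hl' j) (hg i)]
        simp
      refine (Complex.re_le_norm _).trans ?_
      rw [norm_mul, RCLike.norm_conj, h1]
      calc _ ≤ (∑ j, ‖cpair (ψ t) (l j)‖) * (H * (∑ j, ‖cpair (ψ t) (l j)‖) * ‖β j‖) := by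
            gcongr
            · exact hone _ j
            · exact (norm_cpair_le _ _).trans (by gcongr; exact hr _)
        _ = _ := by ring
    refine (Finset.sum_le_sum fun j _ => hterm j).trans ?_
    rw [← Finset.sum_mul, ← Finset.mul_sum]
    have h0 : 0 ≤ ∑ j, ‖cpair (ψ t) (l j)‖ ^ 2 := Finset.sum_nonneg fun _ _ => by positivity
    calc _ ≤ H * (∑ j, ‖β j‖) * (n * ∑ j, ‖cpair (ψ t) (l j)‖ ^ 2) := by gcongr; exact hS _
      _ = c * ∑ j, ‖cpair (ψ t) (l j)‖ ^ 2 := by rw [hc]; ring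
      _ ≤ _ := by gcongr; linarith

/-- The component of R along f i is ℛ_{f i} - ℛ_0. At f i every normal g j with j ≠ i is orthogonal,
which leaves the axis g i and its one-sided bound. At 0 all normals are orthogonal, so ℛ_0 grows
linearly; there the axis is taken to be 0. -/
theorem exists_re_conj_mul_complexR_le (hχ : χ.IsCharacteristicsOf Z)
    (hspan : Submodule.span ℝ (C : Set (RVec d)) = ⊤)
    (hf : ∀ i, f i ∈ C) (hg : ∀ i, g i ∈ ProperCone.innerDual (C : Set (RVec d)))
    (hgf : ∀ i j, i ≠ j → inner ℝ (g i) (f j) = 0)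
    (hrep : ∀ x, x = ∑ i, inner ℝ (g i) x • f i + ∑ j, inner ℝ (h j) x • l j)
    {k : Set (RVec d)} (hk : IsCompact k) (hkY : k ⊆ interior χ.expDomain) {N : ℝ} (hN : 0 ≤ N)
    (i : Fin m) : ∃ c, 0 ≤ c ∧ ∀ y ∈ k, ∀ u : CVec d,
      y - rePart u ∈ ProperCone.innerDual (C : Set (RVec d)) →
      ‖∑ j, cpair u (l j) • toC (h j)‖ ≤ N →
      (starRingEnd ℂ (cpair u (f i)) * cpair (χ.complexR u) (f i)).re ≤
        c * (1 + ∑ j, ‖cpair u (f j)‖ ^ 2) := by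
  obtain ⟨B₀, hB₀⟩ := hk.isBounded.exists_norm_le
  obtain ⟨B₁, hB₁⟩ := χ.exists_integral_exp_le_of_dominated hχ hspan hk hkY (hf i)
  obtain ⟨B₂, hB₂⟩ := χ.exists_integral_exp_le_of_dominated hχ hspan hk hkY C.zero_mem
  set F := ∑ j, ‖f j‖ with hF
  have hF0 : 0 ≤ F := Finset.sum_nonneg fun _ _ => norm_nonneg _
  -- One constant for the real parts of all components and for both exponential moment integrals.
  set B := |B₀| * F + |B₁| + |B₂| with hB
  have hB0 : 0 ≤ B := by positivity
  obtain ⟨c₁, hc₁, h₁⟩ := χ.exists_norm_complexRx_sub_axis_le (g₀ := g i) (g := g)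
    (t := Finset.univ.erase i) hχ hspan (hf i) (hg i) (fun j _ => hg j)
    (fun j hj => hgf j i (Finset.ne_of_mem_erase hj)) hB0 hN
  obtain ⟨c₂, hc₂, h₂⟩ := χ.exists_norm_complexRx_sub_axis_le (g₀ := 0) (g := g)
    (t := Finset.univ) hχ hspan C.zero_mem (zero_mem _) (fun j _ => hg j)
    (fun j _ => inner_zero_right _) hB0 hN
  set κ := 1 / 2 * B * χ.diffForm (f i) (g i) (g i) + B * Real.exp (‖g i‖ * B) * ‖g i‖ ^ 2 *
        ∫ ξ, levyWeight ξ ∂(χ.K (f i)) with hκ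
  have hκ0 : 0 ≤ κ := by
    have h1 := χ.diffForm_nonneg (hf i) (g i)
    have h2 : 0 ≤ ∫ ξ, levyWeight ξ ∂(χ.K (f i)) := integral_nonneg levyWeight_nonneg
    positivity
  refine ⟨κ + 2 * (c₁ + c₂), by positivity, fun y hy u hyu hr => ?_⟩
  have huY : rePart u ∈ χ.expDomain :=
    χ.mem_expDomain_of_le hχ hspan (interior_subset (hkY hy)) hyu
  set V := ∑ j, ‖cpair u (f j)‖ ^ 2 with hV
  have hV0 : 0 ≤ V := Finset.sum_nonneg fun _ _ => by positivity
  have hle : ∀ j, ‖cpair u (f j)‖ ^ 2 ≤ V := fun j =>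
    Finset.single_le_sum (f := fun j => ‖cpair u (f j)‖ ^ 2) (fun _ _ => by positivity)
      (Finset.mem_univ j)
  have hnorm : ∀ j, ‖cpair u (f j)‖ ≤ Real.sqrt V := fun j => Real.le_sqrt_of_sq_le (hle j)
  have hre : ∀ j, (cpair u (f j)).re ≤ B := fun j => by
    have h1 := inner_nonneg_of_mem_innerDual hyu (hf j)
    rw [inner_sub_left] at h1
    have h2 : inner ℝ y (f j) ≤ |B₀| * F := by
      refine (real_inner_le_norm _ _).trans ?_
      gcongr
      · exact (hB₀ y hy).trans (le_abs_self _)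
      · exact Finset.single_le_sum (f := fun j => ‖f j‖) (fun _ _ => norm_nonneg _)
          (Finset.mem_univ j)
    rw [cpair_re]
    linarith [abs_nonneg B₁, abs_nonneg B₂]
  have hu := eq_sum_frame (C := C) hspan hrep u
  have hFB : 0 ≤ |B₀| * F := by positivity
  have e₁ := h₁ (cpair u (f i)) (fun j => cpair u (f j)) _ u (Real.sqrt V) (by
      rw [Finset.add_sum_erase _ (fun j => cpair u (f j) • toC (g j)) (Finset.mem_univ i)]
      exact hu) (hre i) (fun j _ => hre j) hr (hnorm i) (fun j _ => hnorm j) huY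
    ((hB₁ y hy _ hyu).trans (by linarith [le_abs_self B₁, abs_nonneg B₂]))
  have e₂ := h₂ 0 (fun j => cpair u (f j)) _ u (Real.sqrt V) (by
      rw [zero_smul, zero_add]; exact hu) (by simpa using hB0) (fun j _ => hre j) hr
    (by simp) (fun j _ => hnorm j) huY
    ((hB₂ y hy _ hyu).trans (by linarith [le_abs_self B₂, abs_nonneg B₁]))
  have haxis : ∀ ξ : RVec d, axisIncrement 0 (0 : RVec d) ξ = 0 := fun ξ => by
    simp [axisIncrement]
  simp only [haxis, integral_zero, add_zero, ne_eq, OfNat.ofNat_ne_zero, not_false_eq_true,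
    zero_pow, zero_mul, mul_zero, sub_zero] at e₂
  have e₃ := χ.re_conj_mul_axis_le (hf i) (hg i) hχ hspan hB0 (hre i)
  rw [χ.cpair_complexR hspan huY (hf i)]
  set A := (1 / 2 : ℂ) * (cpair u (f i) ^ 2 * (χ.diffForm (f i) (g i) (g i) : ℂ)) +
      ∫ ξ, axisIncrement (cpair u (f i)) (g i) ξ ∂(χ.K (f i)) with hA
  set z := cpair u (f i) with hz
  have heq : starRingEnd ℂ z * (χ.complexRx (f i) u - χ.complexRx 0 u) =
      starRingEnd ℂ z * A + starRingEnd ℂ z * (χ.complexRx (f i) u - A) -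
        starRingEnd ℂ z * χ.complexRx 0 u := by ring
  rw [heq, Complex.sub_re, Complex.add_re]
  have hs : 0 ≤ Real.sqrt V := Real.sqrt_nonneg V
  have hsq : Real.sqrt V ^ 2 = V := Real.sq_sqrt hV0
  have e₄ : (starRingEnd ℂ z * (χ.complexRx (f i) u - A)).re ≤
      Real.sqrt V * (c₁ * (1 + Real.sqrt V)) := by
    refine (Complex.re_le_norm _).trans ?_
    rw [norm_mul, RCLike.norm_conj]
    gcongr
    exact hnorm i
  have e₅ : -(starRingEnd ℂ z * χ.complexRx 0 u).re ≤
      Real.sqrt V * (c₂ * (1 + Real.sqrt V)) := by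
    refine (neg_le_abs _).trans ((Complex.abs_re_le_norm _).trans ?_)
    rw [norm_mul, RCLike.norm_conj]
    gcongr
    exact hnorm i
  have e₆ : κ * ‖z‖ ^ 2 ≤ κ * V := by gcongr; exact hle i
  have e₇ : Real.sqrt V * (1 + Real.sqrt V) ≤ 2 * (1 + V) := by nlinarith
  have e₈ : Real.sqrt V * (c₁ * (1 + Real.sqrt V)) ≤ c₁ * (2 * (1 + V)) := by
    rw [mul_left_comm]; gcongr
  have e₉ : Real.sqrt V * (c₂ * (1 + Real.sqrt V)) ≤ c₂ * (2 * (1 + V)) := by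
    rw [mul_left_comm]; gcongr
  nlinarith

/-- The components along the lines are bounded first, independently of the others; given that bound,
the sum of squares of the half-line components is a Lyapunov function. -/
theorem realLifetime_le_of_frame (hχ : χ.IsCharacteristicsOf Z)
    (hspan : Submodule.span ℝ (C : Set (RVec d)) = ⊤)
    (hf : ∀ i, f i ∈ C) (hg : ∀ i, g i ∈ ProperCone.innerDual (C : Set (RVec d)))
    (hgf : ∀ i j, i ≠ j → inner ℝ (g i) (f j) = 0) (hl : ∀ j, l j ∈ C) (hl' : ∀ j, -l j ∈ C)
    (hrep : ∀ x, x = ∑ i, inner ℝ (g i) x • f i + ∑ j, inner ℝ (h j) x • l j) (u : CVec d) :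
    χ.realLifetime (rePart u) ≤ χ.complexLifetime u := by
  refine realLifetime_le_complexLifetime hχ hspan fun T hT q hqc hqO => ?_
  obtain ⟨N, hN, hline⟩ := χ.exists_line_components_le hχ hspan hg hl hl' hrep u T
  have hk : IsCompact (q '' Icc 0 T) := isCompact_Icc.image_of_continuousOn hqc
  have hkY : q '' Icc 0 T ⊆ interior χ.expDomain := by
    rintro _ ⟨t, ht, rfl⟩; exact hqO t ht
  choose c hc0 hc using fun i => χ.exists_re_conj_mul_complexR_le hχ hspan hf hg hgf hrep hk hkY hN i
  have hcs : 0 ≤ ∑ i, c i := Finset.sum_nonneg fun i _ => hc0 i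
  set V := (1 + ∑ i, ‖cpair u (f i)‖ ^ 2) * Real.exp (2 * (∑ i, c i) * T) with hV
  refine ⟨Real.sqrt V * ∑ i, ‖toC (g i)‖ + N, fun τ hτ hτT ψ hψ0 hψ hdom => ?_⟩
  have hτmem : τ ∈ Icc 0 τ := right_mem_Icc.2 hτ.le
  have hVt := hψ.sum_norm_cpair_sq_le f hτT hcs (fun t ht => by
    rw [Finset.sum_mul]
    exact Finset.sum_le_sum fun i _ => hc i _
      (mem_image_of_mem q (Icc_subset_Icc_right hτT ht)) _ (hdom t ht)
      (hline τ hτT ψ hψ0 hψ t ht)) τ hτmem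
  rw [hψ0] at hVt
  rw [eq_sum_frame (C := C) hspan hrep (ψ τ)]
  refine (norm_add_le _ _).trans (add_le_add ?_ (hline τ hτT ψ hψ0 hψ τ hτmem))
  rw [Finset.mul_sum]
  refine (norm_sum_le _ _).trans (Finset.sum_le_sum fun i _ => ?_)
  rw [norm_smul]
  gcongr
  refine Real.le_sqrt_of_sq_le (le_trans ?_ hVt)
  exact Finset.single_le_sum (f := fun i => ‖cpair (ψ τ) (f i)‖ ^ 2) (fun _ _ => by positivity)
    (Finset.mem_univ i)

end Canonical

end AffineTriplet

theorem exists_vector_of_linearMap {d : ℕ} (L : RVec d →ₗ[ℝ] ℝ) :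
    ∃ v : RVec d, ∀ x, inner ℝ v x = L x :=
  ⟨(InnerProductSpace.toDual ℝ (RVec d)).symm (LinearMap.toContinuousLinearMap L), fun x => by
    rw [InnerProductSpace.toDual_symm_apply]; rfl⟩

theorem realLifetime_le_of_isCanonicalStateSpace {d : ℕ} {D : Set (RVec d)} {Ω : Type*}
    [MeasurableSpace Ω] {Z : AffineProcess D Ω} (χ : AffineTriplet D)
    (hχ : χ.IsCharacteristicsOf Z) (hD : IsCanonicalStateSpace D) (u : CVec d) :
    χ.realLifetime (rePart u) ≤ χ.complexLifetime u := by
  obtain ⟨m, n, e, hDe⟩ := hD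
  choose g hg using fun i : Fin m => exists_vector_of_linearMap
    ((LinearMap.proj i ∘ₗ LinearMap.fst ℝ (Fin m → ℝ) (Fin n → ℝ)) ∘ₗ (e : RVec d →ₗ[ℝ] _))
  choose h hh using fun j : Fin n => exists_vector_of_linearMap
    ((LinearMap.proj j ∘ₗ LinearMap.snd ℝ (Fin m → ℝ) (Fin n → ℝ)) ∘ₗ (e : RVec d →ₗ[ℝ] _))
  replace hg : ∀ i x, inner ℝ (g i) x = (e x).1 i := fun i x => hg i x
  replace hh : ∀ j x, inner ℝ (h j) x = (e x).2 j := fun j x => hh j x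
  obtain ⟨C, rfl⟩ : ∃ C : ProperCone ℝ (RVec d), D = C := by
    refine ⟨ProperCone.innerDual (range g), ?_⟩
    ext x
    rw [SetLike.mem_coe, ProperCone.mem_innerDual, hDe]
    simp [hg]
  have hmem : ∀ x, x ∈ C ↔ ∀ i, 0 ≤ (e x).1 i := fun x => by
    rw [← SetLike.mem_coe, hDe]; rfl
  have hf : ∀ i, e.symm (Pi.single i 1, 0) ∈ C := fun i => by
    rw [hmem]
    intro j
    rw [e.apply_symm_apply]
    exact (Pi.single_nonneg.2 zero_le_one : (0 : Fin m → ℝ) ≤ Pi.single i 1) j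
  have hl : ∀ z : Fin n → ℝ, e.symm (0, z) ∈ C := fun z => by
    rw [hmem]; intro j; rw [e.apply_symm_apply]; simp
  have hrep : ∀ x, x = ∑ i, inner ℝ (g i) x • e.symm (Pi.single i 1, 0) +
      ∑ j, inner ℝ (h j) x • e.symm (0, Pi.single j 1) := fun x => by
    apply e.injective
    simp only [map_add, map_sum, map_smul, e.apply_symm_apply, hg, hh]
    ext i
    · simp [Prod.fst_sum, Finset.sum_apply, Pi.single_apply]
    · simp [Prod.snd_sum, Finset.sum_apply, Pi.single_apply]
  refine χ.realLifetime_le_of_frame (f := fun i => e.symm (Pi.single i 1, 0)) (g := g)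
    (l := fun j => e.symm (0, Pi.single j 1)) (h := h) hχ ?_ hf (fun i => ?_) (fun i j hij => ?_)
    (fun j => hl _) (fun j => ?_) hrep u
  · rw [eq_top_iff]
    intro x _
    rw [hrep x]
    exact add_mem
      (sum_mem fun i _ => Submodule.smul_mem _ _ (Submodule.subset_span (hf i)))
      (sum_mem fun j _ => Submodule.smul_mem _ _ (Submodule.subset_span (hl _)))
  · rw [ProperCone.mem_innerDual]
    intro x hx
    rw [real_inner_comm, hg]
    exact (hmem x).1 hx i
  · rw [hg, e.apply_symm_apply]
    simp [hij]
  · rw [← map_neg, Prod.neg_mk, neg_zero]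
    exact hl _

end AffineMoments

/-! ### Domination among the jump kernels, and linear growth under finite variation. -/

namespace AffineMoments

namespace AffineTriplet

variable {d : ℕ} {C : ProperCone ℝ (RVec d)} (χ : AffineTriplet (C : Set (RVec d)))
  {Ω : Type*} [MeasurableSpace Ω] {Z : AffineProcess (C : Set (RVec d)) Ω}

section Domination

theorem two_smul_K_midpoint {x z : RVec d} (hx : x ∈ C) (hz : z ∈ C) :
    (2 : ℝ≥0∞) • χ.K ((1 / 2 : ℝ) • (x + z)) = χ.K x + χ.K z := by
  have h := χ.K_affine x hx z hz (1 / 2) (by norm_num) (by norm_num)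
  have h2 : (2 : ℝ≥0∞) * ENNReal.ofReal (1 / 2) = 1 := by
    rw [← ENNReal.ofReal_ofNat, ← ENNReal.ofReal_mul (by norm_num)]; norm_num
  rw [show (1 : ℝ) - 1 / 2 = 1 / 2 by norm_num, ← smul_add, ← smul_add] at h
  rw [h, smul_smul, h2, one_smul]

theorem two_smul_K_half {x : RVec d} (hx : x ∈ C) :
    (2 : ℝ≥0∞) • χ.K ((1 / 2 : ℝ) • x) = χ.K x + χ.K 0 := by
  simpa using χ.two_smul_K_midpoint hx C.zero_mem

/-- Twice K at the midpoint of x and z equals both K(x) + K(z) and K(x + z) + K(0). -/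
theorem K_add_le {x z : RVec d} (hx : x ∈ C) (hz : z ∈ C) : χ.K (x + z) ≤ χ.K x + χ.K z := by
  rw [← χ.two_smul_K_midpoint hx hz, χ.two_smul_K_half (C.add_mem hx hz)]
  exact Measure.le_add_right le_rfl

theorem K_zero_le {x : RVec d} (hx : x ∈ C) : χ.K 0 ≤ (2 : ℝ≥0∞) • χ.K x := by
  have h := χ.two_smul_K_half (C.smul_mem hx zero_le_two)
  rw [smul_smul, show (1 / 2 : ℝ) * 2 = 1 by norm_num, one_smul] at h
  rw [h]
  exact Measure.le_add_left le_rfl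

/-- With K(0) ≤ 2 K(x + z) the midpoint identity gives K(x) ≤ 3 K(x + z), so integrability descends
from larger to smaller points of the cone. -/
theorem K_le_add {x z : RVec d} (hx : x ∈ C) (hz : z ∈ C) :
    χ.K x ≤ χ.K (x + z) + (2 : ℝ≥0∞) • χ.K (x + z) := by
  have h : χ.K x ≤ χ.K (x + z) + χ.K 0 := by
    rw [← χ.two_smul_K_half (C.add_mem hx hz), χ.two_smul_K_midpoint hx hz]
    exact Measure.le_add_right le_rfl
  exact h.trans (add_le_add le_rfl (χ.K_zero_le (C.add_mem hx hz)))

variable {χ}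

theorem integrable_K_add {x z : RVec d} (hx : x ∈ C) (hz : z ∈ C) {φ : RVec d → ℝ}
    (h1 : Integrable φ (χ.K x)) (h2 : Integrable φ (χ.K z)) : Integrable φ (χ.K (x + z)) :=
  (h1.add_measure h2).mono_measure (χ.K_add_le hx hz)

theorem integrable_K_of_add {x z : RVec d} (hx : x ∈ C) (hz : z ∈ C) {φ : RVec d → ℝ}
    (h : Integrable φ (χ.K (x + z))) : Integrable φ (χ.K x) :=
  (h.add_measure (h.smul_measure (by norm_num))).mono_measure (χ.K_le_add hx hz)

variable (χ)

theorem diffForm_eq_zero_of_add {x z : RVec d} (hx : x ∈ C) (hz : z ∈ C)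
    (h : ∀ v, χ.diffForm (x + z) v v = 0) (h0 : ∀ v, χ.diffForm 0 v v = 0) (v w : RVec d) :
    χ.diffForm x v w = 0 := by
  refine χ.diffForm_eq_zero hx ?_ w
  have h1 := χ.diffForm_convex x z v v (1 / 2)
  have h2 := χ.diffForm_convex (x + z) 0 v v (1 / 2)
  rw [show (1 : ℝ) - 1 / 2 = 1 / 2 by norm_num] at h1 h2
  rw [smul_zero, add_zero, smul_add, h1, h, h0] at h2
  have h3 := χ.diffForm_nonneg hx v
  have h4 := χ.diffForm_nonneg hz v
  linarith

end Domination

section FiniteVariation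

/-- If the jumps have finite variation, then `ℛ_x` grows at most linearly, apart from the
contribution of the diffusion. -/
theorem exists_norm_complexRx_sub_diffFormC_le (hχ : χ.IsCharacteristicsOf Z)
    (hspan : Submodule.span ℝ (C : Set (RVec d)) = ⊤) {k : Set (RVec d)} (hk : IsCompact k)
    (hkY : k ⊆ interior χ.expDomain) {x : RVec d} (hx : x ∈ C)
    (hfv : Integrable (fun ξ => ‖trunc ξ‖) (χ.K x)) :
    ∃ c, 0 ≤ c ∧ ∀ y ∈ k, ∀ u : CVec d,
      y - rePart u ∈ ProperCone.innerDual (C : Set (RVec d)) →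
      ‖χ.complexRx x u - (1 / 2 : ℂ) * χ.diffFormC x u u‖ ≤ c * (1 + ‖u‖) := by
  obtain ⟨B₀, hB₀⟩ := hk.isBounded.exists_norm_le
  obtain ⟨B₁, hB₁⟩ := χ.exists_integral_exp_le_of_dominated hχ hspan hk hkY hx
  set S := ∫ ξ, ‖trunc ξ‖ ∂(χ.K x) with hS
  set W := ∫ ξ, levyWeight ξ ∂(χ.K x) with hW
  have hS0 : 0 ≤ S := integral_nonneg fun _ => norm_nonneg _
  have hW0 : 0 ≤ W := integral_nonneg levyWeight_nonneg
  have hWint := χ.integrable_levyWeight (x := x) hx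
  set E := Real.exp |B₀| + 1 with hE
  have hE0 : 0 < E := by positivity
  refine ⟨‖χ.b x‖ + E * S + W + |B₁|, by positivity, fun y hy u hyu => ?_⟩
  have hyY := interior_subset (hkY hy)
  have huY : rePart u ∈ χ.expDomain := χ.mem_expDomain_of_le hχ hspan hyY hyu
  -- On small jumps only Re⟨u, ξ⟩ ≤ |B₀| is needed, which follows from Re u ≤ y and ξ ∈ C; then |e^w
  -- - 1| and |w| are both linear in ‖u‖.
  have hpt : ∀ ξ ∈ C, ‖expIncrement u ξ‖ ≤ ‖u‖ * E * ‖trunc ξ‖ + (levyWeight ξ +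
      {ξ : RVec d | 1 ≤ ‖ξ‖}.indicator (fun ξ => Real.exp (inner ℝ (rePart u) ξ)) ξ) := by
    intro ξ hξ
    have hind : 0 ≤ {ξ : RVec d | 1 ≤ ‖ξ‖}.indicator
        (fun ξ => Real.exp (inner ℝ (rePart u) ξ)) ξ :=
      indicator_nonneg (fun _ _ => (Real.exp_pos _).le) _
    rcases le_or_gt ‖ξ‖ 1 with h | h
    · have hre : (cpair u ξ).re ≤ |B₀| := by
        have h1 := inner_nonneg_of_mem_innerDual hyu hξ
        rw [inner_sub_left] at h1
        have h2 : inner ℝ y ξ ≤ |B₀| := (real_inner_le_norm _ _).trans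
          ((mul_le_of_le_one_right (norm_nonneg _) h).trans ((hB₀ y hy).trans (le_abs_self _)))
        rw [cpair_re]
        linarith
      have h3 := norm_exp_sub_one_le_of_re_le (abs_nonneg B₀) hre
      have h4 := norm_cpair_le u ξ
      have h5 := norm_sub_le (Complex.exp (cpair u ξ) - 1) (cpair u ξ)
      rw [expIncrement, trunc_of_le h]
      calc _ ≤ E * ‖cpair u ξ‖ := by rw [hE, add_mul, one_mul]; linarith
        _ ≤ E * (‖u‖ * ‖ξ‖) := by gcongr
        _ = ‖u‖ * E * ‖ξ‖ := by ring
        _ ≤ _ := by linarith [levyWeight_nonneg ξ]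
    · rw [expIncrement, trunc_of_gt h, levyWeight_of_ge h.le, cpair_zero, norm_zero,
        indicator_of_mem (show ξ ∈ {ξ : RVec d | 1 ≤ ‖ξ‖} from h.le)]
      have h2 := norm_sub_le (Complex.exp (cpair u ξ)) 1
      rw [Complex.norm_exp, cpair_re, norm_one] at h2
      simp only [sub_zero, mul_zero, zero_add]
      linarith
  have hint := χ.integrable_indicator_exp hx huY
  have hsum : Integrable (fun ξ => levyWeight ξ +
      {ξ : RVec d | 1 ≤ ‖ξ‖}.indicator (fun ξ => Real.exp (inner ℝ (rePart u) ξ)) ξ) (χ.K x) :=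
    hWint.add hint
  have hjump : ‖∫ ξ, expIncrement u ξ ∂(χ.K x)‖ ≤ ‖u‖ * E * S + (W + B₁) := by
    refine (norm_integral_le_of_norm_le ((hfv.const_mul (‖u‖ * E)).add hsum) (by
      filter_upwards [χ.ae_mem_cone hχ hspan hx] with ξ hξ using hpt ξ hξ)).trans ?_
    simp only [Pi.add_apply]
    rw [integral_add (hfv.const_mul _) hsum, integral_const_mul,
      integral_add hWint hint]
    gcongr
    exact hB₁ y hy _ hyu
  have heq : χ.complexRx x u - (1 / 2 : ℂ) * χ.diffFormC x u u =
      cpair u (χ.b x) + ∫ ξ, expIncrement u ξ ∂(χ.K x) := by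
    rw [complexRx_eq_diffFormC]; ring
  rw [heq]
  refine (norm_add_le _ _).trans ?_
  have h1 := norm_cpair_le u (χ.b x)
  have key : ∀ n b e w B : ℝ, 0 ≤ n → 0 ≤ b → 0 ≤ e → 0 ≤ w →
      n * b + (n * e + (w + B)) ≤ (b + e + w + |B|) * (1 + n) := fun n b e w B hn hb he hw => by
    have h2 := mul_nonneg hn hw
    have h3 := mul_nonneg hn (abs_nonneg B)
    linarith [le_abs_self B]
  have h4 := key ‖u‖ ‖χ.b x‖ (E * S) W B₁ (norm_nonneg _) (norm_nonneg _) (by positivity) hW0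
  refine (add_le_add h1 hjump).trans (le_trans (le_of_eq ?_) h4)
  ring

/-- The vector w stands for the quadratic part of R, specified by its pairings; what remains is read
off at finitely many points of the cone. -/
theorem exists_norm_complexR_sub_le (hχ : χ.IsCharacteristicsOf Z)
    (hspan : Submodule.span ℝ (C : Set (RVec d)) = ⊤) {k : Set (RVec d)} (hk : IsCompact k)
    (hkY : k ⊆ interior χ.expDomain)
    (hfv : ∀ x ∈ C, Integrable (fun ξ => ‖trunc ξ‖) (χ.K x)) :
    ∃ c, 0 ≤ c ∧ ∀ y ∈ k, ∀ u : CVec d,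
      y - rePart u ∈ ProperCone.innerDual (C : Set (RVec d)) → ∀ w : CVec d,
      (∀ x ∈ C, cpair w x = (1 / 2 : ℂ) * (χ.diffFormC x u u - χ.diffFormC 0 u u)) →
      ‖χ.complexR u - w‖ ≤ c * (1 + ‖u‖) := by
  obtain ⟨b, c, hb, hc, hle⟩ := exists_norm_le_sum_cpair hspan
  choose! L hL0 hL using fun x (hx : x ∈ C) =>
    χ.exists_norm_complexRx_sub_diffFormC_le hχ hspan hk hkY hx (hfv x hx)
  refine ⟨c * ∑ x ∈ b, (L x + L 0), mul_nonneg hc (Finset.sum_nonneg fun x hx =>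
    add_nonneg (hL0 x (hb hx)) (hL0 0 C.zero_mem)), fun y hy u hyu w hw => ?_⟩
  have huY : rePart u ∈ χ.expDomain :=
    χ.mem_expDomain_of_le hχ hspan (interior_subset (hkY hy)) hyu
  refine (hle _).trans ?_
  rw [mul_assoc, Finset.sum_mul]
  refine mul_le_mul_of_nonneg_left (Finset.sum_le_sum fun x hx => ?_) hc
  rw [sub_cpair, χ.cpair_complexR hspan huY (hb hx), hw x (hb hx), add_mul,
    show ∀ A B q q₀ : ℂ, A - B - 1 / 2 * (q - q₀) = (A - 1 / 2 * q) - (B - 1 / 2 * q₀) by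
      intros; ring]
  exact (norm_sub_le _ _).trans (add_le_add (hL x (hb hx) y hy u hyu)
    (hL 0 C.zero_mem y hy u hyu))

/-- Without diffusion and with jumps of finite variation, the Riccati vector field grows at most
linearly. -/
theorem realLifetime_le_of_diffForm_eq_zero (hχ : χ.IsCharacteristicsOf Z)
    (hspan : Submodule.span ℝ (C : Set (RVec d)) = ⊤)
    (hfv : ∀ x ∈ C, Integrable (fun ξ => ‖trunc ξ‖) (χ.K x))
    (hdiff : ∀ x ∈ C, ∀ v w, χ.diffForm x v w = 0) (u : CVec d) :
    χ.realLifetime (rePart u) ≤ χ.complexLifetime u := by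
  refine realLifetime_le_complexLifetime hχ hspan fun T hT q hqc hqO => ?_
  have hk : IsCompact (q '' Icc 0 T) := isCompact_Icc.image_of_continuousOn hqc
  have hkY : q '' Icc 0 T ⊆ interior χ.expDomain := by
    rintro _ ⟨t, ht, rfl⟩; exact hqO t ht
  obtain ⟨c, hc, hle⟩ := χ.exists_norm_complexR_sub_le hχ hspan hk hkY hfv
  have hC0 : ∀ x ∈ C, ∀ u, χ.diffFormC x u u = 0 := fun x hx u => by
    have := χ.sum_mul_a_mul x hx u
    rw [← diffFormC_apply] at this
    simpa [hdiff x hx] using this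
  have hns : ∀ u : CVec d, ∑ i, ‖cpair u (EuclideanSpace.single i 1)‖ ^ 2 = ‖u‖ ^ 2 := fun u => by
    simp only [cpair_single]
    rw [EuclideanSpace.norm_sq_eq]
  set V := (1 + ‖u‖ ^ 2) * Real.exp (2 * (d * (2 * c)) * T) with hV
  refine ⟨Real.sqrt V, fun τ hτ hτT ψ hψ0 hψ hdom => ?_⟩
  have hVt := hψ.sum_norm_cpair_sq_le (fun i => EuclideanSpace.single i 1) hτT
    (c := d * (2 * c)) (by positivity) (fun t ht => by
      have h1 := hle _ (mem_image_of_mem q (Icc_subset_Icc_right hτT ht)) (ψ t) (hdom t ht) 0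
        (fun x hx => by rw [hC0 x hx, hC0 0 C.zero_mem]; simp [cpair])
      rw [sub_zero] at h1
      have hterm : ∀ i, (starRingEnd ℂ (cpair (ψ t) (EuclideanSpace.single i 1)) *
          cpair (χ.complexR (ψ t)) (EuclideanSpace.single i 1)).re ≤
          2 * c * (1 + ‖ψ t‖ ^ 2) := fun i => by
        refine (Complex.re_le_norm _).trans ?_
        rw [norm_mul, RCLike.norm_conj, cpair_single, cpair_single]
        calc _ ≤ ‖ψ t‖ * (c * (1 + ‖ψ t‖)) := by
              gcongr
              · exact PiLp.norm_apply_le _ i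
              · exact (PiLp.norm_apply_le _ i).trans h1
          _ = c * (‖ψ t‖ * (1 + ‖ψ t‖)) := by ring
          _ ≤ c * (2 * (1 + ‖ψ t‖ ^ 2)) := by
              refine mul_le_mul_of_nonneg_left ?_ hc
              nlinarith [sq_nonneg (‖ψ t‖ - 1), sq_nonneg ‖ψ t‖]
          _ = _ := by ring
      rw [hns]
      refine (Finset.sum_le_sum fun i _ => hterm i).trans (le_of_eq ?_)
      rw [Finset.sum_const, Finset.card_univ, Fintype.card_fin, nsmul_eq_mul]
      ring) τ (right_mem_Icc.2 hτ.le)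
  rw [hns, hns, hψ0] at hVt
  exact Real.le_sqrt_of_sq_le hVt

end FiniteVariation

end AffineTriplet

end AffineMoments

/-! ### Positive semidefinite matrices and coordinates on the symmetric matrices. -/

namespace AffineMoments

section Matrices

open Matrix

open scoped MatrixOrder in
theorem exists_eq_transpose_mul_self {n : ℕ} {A : Matrix (Fin n) (Fin n) ℝ} (hA : A.PosSemidef) :
    ∃ B : Matrix (Fin n) (Fin n) ℝ, A = Bᵀ * B := by
  obtain ⟨B, hB⟩ := CStarAlgebra.nonneg_iff_eq_star_mul_self.mp hA.nonneg
  exact ⟨B, by rw [hB, star_eq_conjTranspose, conjTranspose_eq_transpose_of_trivial]⟩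

theorem dotProduct_transpose_mul_self_mulVec {n : ℕ} (B : Matrix (Fin n) (Fin n) ℝ)
    (s : Fin n → ℝ) : s ⬝ᵥ (Bᵀ * B) *ᵥ s = (B *ᵥ s) ⬝ᵥ (B *ᵥ s) := by
  rw [← mulVec_mulVec, dotProduct_mulVec, vecMul_transpose]

theorem mulVec_dotProduct_self_le {n : ℕ} (B : Matrix (Fin n) (Fin n) ℝ) (s : Fin n → ℝ) :
    (B *ᵥ s) ⬝ᵥ (B *ᵥ s) ≤ (∑ i, ∑ j, B i j ^ 2) * (s ⬝ᵥ s) := by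
  rw [dotProduct, Finset.sum_mul]
  refine Finset.sum_le_sum fun i _ => ?_
  have h := Finset.sum_mul_sq_le_sq_mul_sq Finset.univ (fun j => B i j) s
  simp only [mulVec, dotProduct, ← sq]
  exact h

/-- With A = BᵀB and B invertible, s = B⁻¹(Bs) and sᵀAs = |Bs|². -/
theorem exists_dotProduct_self_le {n : ℕ} {A : Matrix (Fin n) (Fin n) ℝ} (hA : A.PosSemidef)
    (hdet : A.det ≠ 0) : ∃ c, 0 ≤ c ∧ ∀ s, s ⬝ᵥ s ≤ c * (s ⬝ᵥ A *ᵥ s) := by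
  obtain ⟨B, rfl⟩ := exists_eq_transpose_mul_self hA
  have hB : IsUnit B.det := by
    rw [isUnit_iff_ne_zero]
    rintro h
    simp [h] at hdet
  refine ⟨∑ i, ∑ j, B⁻¹ i j ^ 2, Finset.sum_nonneg fun i _ => Finset.sum_nonneg fun j _ =>
    sq_nonneg _, fun s => ?_⟩
  have h := mulVec_dotProduct_self_le B⁻¹ (B *ᵥ s)
  rwa [mulVec_mulVec, nonsing_inv_mul _ hB, one_mulVec, ← dotProduct_transpose_mul_self_mulVec] at h

/-- With A = BᵀB, the vector As = Bᵀ(Bs) is controlled by |Bs|² = sᵀAs. No invertibility is needed,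
since N may be degenerate. -/
theorem exists_mulVec_dotProduct_mulVec_le {n : ℕ} {A : Matrix (Fin n) (Fin n) ℝ}
    (hA : A.PosSemidef) :
    ∃ c, 0 ≤ c ∧ ∀ s, (A *ᵥ s) ⬝ᵥ (A *ᵥ s) ≤ c * (s ⬝ᵥ A *ᵥ s) := by
  obtain ⟨B, rfl⟩ := exists_eq_transpose_mul_self hA
  refine ⟨∑ i, ∑ j, Bᵀ i j ^ 2, Finset.sum_nonneg fun i _ => Finset.sum_nonneg fun j _ =>
    sq_nonneg _, fun s => ?_⟩
  have h := mulVec_dotProduct_self_le Bᵀ (B *ᵥ s)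
  rw [mulVec_mulVec] at h
  rwa [dotProduct_transpose_mul_self_mulVec]

theorem abs_dotProduct_mulVec_le {n : ℕ} (A : Matrix (Fin n) (Fin n) ℝ) (s : Fin n → ℝ) :
    |s ⬝ᵥ A *ᵥ s| ≤ (∑ i, ∑ j, |A i j|) * (s ⬝ᵥ s) := by
  have hle : ∀ i j, |s i * (A i j * s j)| ≤ |A i j| * (s ⬝ᵥ s) := by
    intro i j
    have hone : ∀ i, s i ^ 2 ≤ s ⬝ᵥ s := fun i => by
      rw [sq]
      exact Finset.single_le_sum (f := fun i => s i * s i) (fun i _ => mul_self_nonneg _)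
        (Finset.mem_univ i)
    rw [mul_left_comm, abs_mul]
    gcongr
    rw [abs_le]
    constructor <;> nlinarith [hone i, hone j, sq_nonneg (s i + s j), sq_nonneg (s i - s j)]
  have heq : s ⬝ᵥ A *ᵥ s = ∑ i, ∑ j, s i * (A i j * s j) := by
    simp only [dotProduct, mulVec, Finset.mul_sum]
  rw [heq, Finset.sum_mul]
  refine (Finset.abs_sum_le_sum_abs _ _).trans (Finset.sum_le_sum fun i _ => ?_)
  rw [Finset.sum_mul]
  exact (Finset.abs_sum_le_sum_abs _ _).trans (Finset.sum_le_sum fun j _ => hle i j)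

/-- The coordinate representation of a symmetric matrix by squares of vectors. -/
theorem eq_sum_vecMulVec {n : ℕ} {X : Matrix (Fin n) (Fin n) ℝ} (hX : X.IsSymm) :
    X = ∑ i, ∑ j, (X i j / 2) • (vecMulVec (Pi.single i 1 + Pi.single j 1)
      (Pi.single i 1 + Pi.single j 1) - vecMulVec (Pi.single i 1) (Pi.single i 1) -
      vecMulVec (Pi.single j 1) (Pi.single j 1)) := by
  have hterm : ∀ i j : Fin n, (vecMulVec (Pi.single i 1 + Pi.single j 1)
      (Pi.single i 1 + Pi.single j 1) - vecMulVec (Pi.single i 1) (Pi.single i 1) -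
      vecMulVec (Pi.single j 1) (Pi.single j 1) : Matrix (Fin n) (Fin n) ℝ) =
      single i j 1 + single j i 1 := fun i j => by
    rw [add_vecMulVec, vecMulVec_add, vecMulVec_add]
    rw [single_eq_single_vecMulVec_single, single_eq_single_vecMulVec_single]
    abel
  simp only [hterm, smul_add, Finset.sum_add_distrib]
  ext a b
  simp only [Matrix.add_apply, Matrix.sum_apply, Matrix.smul_apply, single_apply, smul_eq_mul]
  have h := hX.apply a b
  simp [ite_and]
  rw [h]; ring

theorem symMatrices_le_span (n : ℕ) : symMatrices n ≤
    Submodule.span ℝ (range fun f : Fin n → ℝ => vecMulVec f f) := by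
  intro X hX
  rw [eq_sum_vecMulVec (X := X) hX]
  refine sum_mem fun i _ => sum_mem fun j _ => Submodule.smul_mem _ _ (sub_mem (sub_mem ?_ ?_) ?_)
  all_goals exact Submodule.subset_span (mem_range_self _)

theorem isSymm_vecMulVec_self {n : ℕ} (f : Fin n → ℝ) : (vecMulVec f f).IsSymm := by
  ext i j; simp [vecMulVec_apply, mul_comm]

end Matrices

section Frame

open Matrix

variable {d k : ℕ} (e : RVec d ≃ₗ[ℝ] symMatrices k)

/-- The vector representing the functional `x ↦ tr (Y x)` in the coordinates `e`. -/
noncomputable def traceVec : Matrix (Fin k) (Fin k) ℝ →ₗ[ℝ] RVec d where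
  toFun Y := (InnerProductSpace.toDual ℝ (RVec d)).symm (LinearMap.toContinuousLinearMap
    (traceLinearMap (Fin k) ℝ ℝ ∘ₗ LinearMap.mulLeft ℝ Y ∘ₗ (symMatrices k).subtype ∘ₗ
      (e : RVec d →ₗ[ℝ] symMatrices k)))
  map_add' Y Y' := by
    refine ext_inner_right ℝ fun x => ?_
    simp [inner_add_left, add_mul]
  map_smul' c Y := by
    refine ext_inner_right ℝ fun x => ?_
    simp [real_inner_smul_left]

theorem inner_traceVec (Y : Matrix (Fin k) (Fin k) ℝ) (x : RVec d) :
    inner ℝ (traceVec e Y) x = (Y * (e x : Matrix (Fin k) (Fin k) ℝ)).trace := by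
  simp [traceVec]

/-- The functional `x ↦ fᵀ x f`. -/
noncomputable def quadVec (f : Fin k → ℝ) : RVec d := traceVec e (vecMulVec f f)

theorem inner_quadVec (f : Fin k → ℝ) (x : RVec d) :
    inner ℝ (quadVec e f) x = f ⬝ᵥ (e x : Matrix (Fin k) (Fin k) ℝ) *ᵥ f := by
  rw [quadVec, inner_traceVec, vecMulVec_mul, trace_vecMulVec, dotProduct_mulVec, dotProduct_comm]

/-- The rank one matrix `f fᵀ` in the coordinates `e`. -/
noncomputable def rankOne (f : Fin k → ℝ) : RVec d :=
  e.symm ⟨vecMulVec f f, isSymm_vecMulVec_self f⟩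

@[simp] theorem coe_rankOne (f : Fin k → ℝ) :
    (e (rankOne e f) : Matrix (Fin k) (Fin k) ℝ) = vecMulVec f f := by
  rw [rankOne, e.apply_symm_apply]

theorem coe_injective : Function.Injective fun x : RVec d => (e x : Matrix (Fin k) (Fin k) ℝ) :=
  Subtype.val_injective.comp e.injective

theorem inner_quadVec_rankOne (f g : Fin k → ℝ) :
    inner ℝ (quadVec e f) (rankOne e g) = (f ⬝ᵥ g) ^ 2 := by
  rw [inner_quadVec, coe_rankOne, vecMulVec_mulVec, dotProduct_smul, op_smul_eq_smul, smul_eq_mul,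
    dotProduct_comm g f, sq]

theorem eq_sum_rankOne (x : RVec d) :
    x = ∑ i, ∑ j, ((e x : Matrix (Fin k) (Fin k) ℝ) i j / 2) •
      (rankOne e (Pi.single i 1 + Pi.single j 1) - rankOne e (Pi.single i 1) -
        rankOne e (Pi.single j 1)) := by
  apply coe_injective e
  simp only [map_sum, map_smul, map_sub, Submodule.coe_sum, Submodule.coe_smul, Submodule.coe_sub,
    coe_rankOne]
  exact eq_sum_vecMulVec (e x).2

/-- The trace pairing is nondegenerate on symmetric matrices, since tr(YY) = 0 forces Y = 0;
equality of dimensions turns injectivity into surjectivity. -/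
theorem exists_traceVec_eq (v : RVec d) :
    ∃ Y : Matrix (Fin k) (Fin k) ℝ, Y.IsSymm ∧ traceVec e Y = v := by
  have hinj : Function.Injective (traceVec e ∘ₗ (symMatrices k).subtype) := by
    rw [← LinearMap.ker_eq_bot, LinearMap.ker_eq_bot']
    intro Y hY
    have h := inner_traceVec e (Y : Matrix (Fin k) (Fin k) ℝ) (e.symm Y)
    have hY' : traceVec e (Y : Matrix (Fin k) (Fin k) ℝ) = 0 := hY
    have hs : (Y : Matrix (Fin k) (Fin k) ℝ)ᵀ = Y := Y.2
    rw [hY', inner_zero_left, e.apply_symm_apply] at h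
    have h2 := (trace_conjTranspose_mul_self_eq_zero_iff
      (A := (Y : Matrix (Fin k) (Fin k) ℝ))).1 (by
        rw [conjTranspose_eq_transpose_of_trivial, hs]; exact h.symm)
    exact Subtype.ext h2
  have hsurj := (LinearMap.injective_iff_surjective_of_finrank_eq_finrank
    (LinearEquiv.finrank_eq e).symm).1 hinj
  obtain ⟨Y, hY⟩ := hsurj v
  exact ⟨Y, Y.2, hY⟩

variable {C : ProperCone ℝ (RVec d)}

theorem mem_iff_dotProduct_nonneg
    (hC : ∀ x, x ∈ C ↔ (e x : Matrix (Fin k) (Fin k) ℝ).PosSemidef) (x : RVec d) :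
    x ∈ C ↔ ∀ f, 0 ≤ f ⬝ᵥ (e x : Matrix (Fin k) (Fin k) ℝ) *ᵥ f := by
  rw [hC]
  refine ⟨fun h f => by simpa using h.dotProduct_mulVec_nonneg f, fun h =>
    .of_dotProduct_mulVec_nonneg ?_ fun f => by simpa using h f⟩
  rw [IsHermitian, conjTranspose_eq_transpose_of_trivial]
  exact (e x).2

theorem rankOne_mem (hC : ∀ x, x ∈ C ↔ (e x : Matrix (Fin k) (Fin k) ℝ).PosSemidef)
    (f : Fin k → ℝ) : rankOne e f ∈ C := by
  rw [hC, coe_rankOne]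
  simpa using posSemidef_vecMulVec_self_star f

theorem quadVec_mem (hC : ∀ x, x ∈ C ↔ (e x : Matrix (Fin k) (Fin k) ℝ).PosSemidef)
    (f : Fin k → ℝ) : quadVec e f ∈ ProperCone.innerDual (C : Set (RVec d)) := by
  rw [ProperCone.mem_innerDual]
  intro x hx
  rw [real_inner_comm, inner_quadVec]
  exact (mem_iff_dotProduct_nonneg e hC x).1 hx f

theorem span_eq_top (hC : ∀ x, x ∈ C ↔ (e x : Matrix (Fin k) (Fin k) ℝ).PosSemidef) :
    Submodule.span ℝ (C : Set (RVec d)) = ⊤ := by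
  rw [eq_top_iff]
  intro x _
  rw [eq_sum_rankOne e x]
  refine sum_mem fun i _ => sum_mem fun j _ => Submodule.smul_mem _ _ (sub_mem (sub_mem ?_ ?_) ?_)
  all_goals exact Submodule.subset_span (rankOne_mem e hC _)

/-- A positive definite point is an order unit: its form dominates the squared length, which in turn
dominates any other quadratic form up to a constant. -/
theorem exists_nsmul_sub_mem (hC : ∀ x, x ∈ C ↔ (e x : Matrix (Fin k) (Fin k) ℝ).PosSemidef)
    {x₀ : RVec d} (hx₀ : (e x₀ : Matrix (Fin k) (Fin k) ℝ).PosDef) (x : RVec d) :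
    ∃ n : ℕ, (n : ℝ) • x₀ - x ∈ C := by
  obtain ⟨c, hc, hle⟩ := exists_dotProduct_self_le hx₀.posSemidef hx₀.det_pos.ne'
  obtain ⟨n, hn⟩ := exists_nat_ge ((∑ i, ∑ j, |(e x : Matrix (Fin k) (Fin k) ℝ) i j|) * c)
  refine ⟨n, (mem_iff_dotProduct_nonneg e hC _).2 fun f => ?_⟩
  have h1 := abs_dotProduct_mulVec_le (e x : Matrix (Fin k) (Fin k) ℝ) f
  have h0 : 0 ≤ f ⬝ᵥ (e x₀ : Matrix (Fin k) (Fin k) ℝ) *ᵥ f := by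
    simpa using hx₀.posSemidef.dotProduct_mulVec_nonneg f
  have hA : 0 ≤ ∑ i, ∑ j, |(e x : Matrix (Fin k) (Fin k) ℝ) i j| :=
    Finset.sum_nonneg fun _ _ => Finset.sum_nonneg fun _ _ => abs_nonneg _
  simp only [map_sub, map_smul, Submodule.coe_sub, Submodule.coe_smul, sub_mulVec, smul_mulVec,
    dotProduct_sub, dotProduct_smul, smul_eq_mul]
  have h2 := mul_le_mul_of_nonneg_left (hle f) hA
  have h3 := mul_le_mul_of_nonneg_right hn h0
  have h4 := le_abs_self (f ⬝ᵥ (e x : Matrix (Fin k) (Fin k) ℝ) *ᵥ f)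
  linarith

/-- On the cone the trace dominates every entry, as testing with e_i ± e_j shows. -/
theorem exists_norm_le_sum_inner_quadVec
    (hC : ∀ x, x ∈ C ↔ (e x : Matrix (Fin k) (Fin k) ℝ).PosSemidef) :
    ∃ c, 0 ≤ c ∧ ∀ x ∈ C, ‖x‖ ≤ c * ∑ i, inner ℝ (quadVec e (Pi.single i 1)) x := by
  set M : Fin k → Fin k → ℝ := fun i j => ‖rankOne e (Pi.single i 1 + Pi.single j 1) -
    rankOne e (Pi.single i 1) - rankOne e (Pi.single j 1)‖ with hM
  refine ⟨∑ i, ∑ j, M i j, Finset.sum_nonneg fun _ _ => Finset.sum_nonneg fun _ _ =>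
    norm_nonneg _, fun x hx => ?_⟩
  have hpos := (mem_iff_dotProduct_nonneg e hC x).1 hx
  set X := (e x : Matrix (Fin k) (Fin k) ℝ) with hX
  have hdiag : ∀ i, inner ℝ (quadVec e (Pi.single i 1)) x = X i i := fun i => by
    rw [inner_quadVec]; simp [hX]
  have hsymm : ∀ i j, X j i = X i j := fun i j => (e x).2.apply i j
  have hX0 : ∀ i, 0 ≤ X i i := fun i => by
    have := hpos (Pi.single i 1); simpa using this
  have htr : ∀ i j, |X i j| ≤ ∑ i, X i i := fun i j => by
    have hone : ∀ i, X i i ≤ ∑ i, X i i := fun i =>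
      Finset.single_le_sum (f := fun i => X i i) (fun i _ => hX0 i) (Finset.mem_univ i)
    have h1 := hpos (Pi.single i 1 + Pi.single j 1)
    have h2 := hpos (Pi.single i 1 - Pi.single j 1)
    simp only [mulVec_add, mulVec_sub, add_dotProduct, sub_dotProduct, dotProduct_add,
      dotProduct_sub, mulVec_single_one, single_one_dotProduct, col_apply, hsymm i j] at h1 h2
    rw [abs_le]
    constructor <;> linarith [hone i, hone j]
  simp only [hdiag]
  conv_lhs => rw [eq_sum_rankOne e x]
  rw [Finset.sum_mul]
  refine (norm_sum_le _ _).trans (Finset.sum_le_sum fun i _ => ?_)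
  rw [Finset.sum_mul]
  refine (norm_sum_le _ _).trans (Finset.sum_le_sum fun j _ => ?_)
  rw [norm_smul, mul_comm]
  refine mul_le_mul_of_nonneg_left ?_ (norm_nonneg _)
  rw [Real.norm_eq_abs, abs_div, abs_two]
  linarith [htr i j, abs_nonneg (X i j)]

end Frame

end AffineMoments

/-! ### Finite variation of the jumps on positive semidefinite matrices. -/

namespace AffineMoments

namespace AffineTriplet

open Matrix

variable {d k : ℕ} (e : RVec d ≃ₗ[ℝ] symMatrices k) {C : ProperCone ℝ (RVec d)}
  {χ : AffineTriplet (C : Set (RVec d))} {Ω : Type*} [MeasurableSpace Ω]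
  {Z : AffineProcess (C : Set (RVec d)) Ω}

theorem trunc_mem {ξ : RVec d} (hξ : ξ ∈ C) : trunc ξ ∈ C := by
  rcases le_or_gt ‖ξ‖ 1 with h | h
  · rwa [trunc_of_le h]
  · rw [trunc_of_gt h]; exact C.zero_mem

theorem integrable_inner_quadVec_trunc (hχ : χ.IsCharacteristicsOf Z)
    (hC : ∀ x, x ∈ C ↔ (e x : Matrix (Fin k) (Fin k) ℝ).PosSemidef) {f g : Fin k → ℝ}
    (hfg : f ⬝ᵥ g = 0) :
    Integrable (fun ξ => inner ℝ (quadVec e f) (trunc ξ)) (χ.K (rankOne e g)) :=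
  χ.integrable_inner_trunc_of_orthogonal hχ (span_eq_top e hC) (rankOne_mem e hC g)
    (quadVec_mem e hC f) (by rw [inner_quadVec_rankOne, hfg, zero_pow two_ne_zero])

/-- The part of the jumps of a diagonal entry on which it is dominated by the quadratic form in the
direction `e i + s e j`. -/
theorem integrable_indicator_of_ne (hχ : χ.IsCharacteristicsOf Z)
    (hC : ∀ x, x ∈ C ↔ (e x : Matrix (Fin k) (Fin k) ℝ).PosSemidef) {i j : Fin k} (hij : i ≠ j)
    {s : ℝ} (hs : s ^ 2 = 1) :
    Integrable ({ξ : RVec d | inner ℝ (quadVec e (Pi.single i 1)) (trunc ξ) ≤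
      inner ℝ (quadVec e (Pi.single i 1 + s • Pi.single j 1)) (trunc ξ)}.indicator
      fun ξ => inner ℝ (quadVec e (Pi.single i 1)) (trunc ξ))
      (χ.K (rankOne e (Pi.single i 1))) := by
  have hspan := span_eq_top e hC
  have hmeas : ∀ y : RVec d, Measurable fun ξ : RVec d => inner ℝ y (trunc ξ) := fun y =>
    measurable_const.inner measurable_trunc
  have hset := measurableSet_le (hmeas (quadVec e (Pi.single i 1)))
    (hmeas (quadVec e (Pi.single i 1 + s • Pi.single j 1)))
  set A := {ξ : RVec d | inner ℝ (quadVec e (Pi.single i 1)) (trunc ξ) ≤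
      inner ℝ (quadVec e (Pi.single i 1 + s • Pi.single j 1)) (trunc ξ)} with hA
  set φ := A.indicator fun ξ => inner ℝ (quadVec e (Pi.single i 1)) (trunc ξ) with hφ
  have hφm : Measurable φ := (hmeas _).indicator hset
  have hφ0 : ∀ ξ ∈ C, 0 ≤ φ ξ := fun ξ hξ => indicator_apply_nonneg fun _ =>
    inner_nonneg_of_mem_innerDual (quadVec_mem e hC _) (trunc_mem hξ)
  have hdom : ∀ (x : RVec d) (_ : x ∈ C) (f : Fin k → ℝ),
      Integrable (fun ξ => inner ℝ (quadVec e f) (trunc ξ)) (χ.K x) →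
      (∀ ξ ∈ C, φ ξ ≤ inner ℝ (quadVec e f) (trunc ξ)) → Integrable φ (χ.K x) := by
    intro x hx f hint hle
    refine hint.mono' hφm.aestronglyMeasurable ?_
    filter_upwards [χ.ae_mem_cone hχ hspan hx] with ξ hξ
    rw [Real.norm_of_nonneg (hφ0 ξ hξ)]
    exact hle ξ hξ
  have h1 : Integrable φ (χ.K (rankOne e (Pi.single j 1))) := by
    refine hdom _ (rankOne_mem e hC _) (Pi.single i 1)
      (integrable_inner_quadVec_trunc e hχ hC (by simp [hij])) fun ξ hξ => ?_
    exact indicator_le_self' (fun _ _ =>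
      inner_nonneg_of_mem_innerDual (quadVec_mem e hC _) (trunc_mem hξ)) ξ
  -- As s² = 1, the vectors e_i - s e_j and e_i + s e_j are orthogonal, and on A the form in the
  -- second direction dominates the diagonal entry.
  have h2 : Integrable φ (χ.K (rankOne e (Pi.single i 1 - s • Pi.single j 1))) := by
    refine hdom _ (rankOne_mem e hC _) (Pi.single i 1 + s • Pi.single j 1)
      (integrable_inner_quadVec_trunc e hχ hC ?_) fun ξ hξ => ?_
    · simp [hij, hij.symm, dotProduct_sub, dotProduct_smul]
      nlinarith
    · by_cases h : ξ ∈ A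
      · rw [hφ, indicator_of_mem h]; exact h
      · rw [hφ, indicator_of_notMem h]
        exact inner_nonneg_of_mem_innerDual (quadVec_mem e hC _) (trunc_mem hξ)
  have h3 := integrable_K_add (rankOne_mem e hC _) (rankOne_mem e hC _) h2 h1
  have h4 := integrable_K_add (C.add_mem (rankOne_mem e hC _) (rankOne_mem e hC _))
    (C.add_mem (rankOne_mem e hC _) (rankOne_mem e hC _)) h3 h3
  -- Twice the sum of the squares of e_i - s e_j and e_j is the square of e_i plus the square of e_i
  -- - 2s e_j. Hence the kernel at e_i e_iᵀ is dominated by kernels against which φ is integrable.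
  refine integrable_K_of_add (z := rankOne e (Pi.single i 1 - (2 * s) • Pi.single j 1))
    (rankOne_mem e hC _) (rankOne_mem e hC _) ?_
  convert h4 using 2
  apply coe_injective e
  simp only [map_add, Submodule.coe_add, coe_rankOne]
  simp only [vecMulVec_sub, sub_vecMulVec, smul_vecMulVec, vecMulVec_smul]
  ext p q
  simp only [Matrix.add_apply, Matrix.sub_apply, Matrix.smul_apply, smul_eq_mul]
  linear_combination (2 * vecMulVec (Pi.single j 1) (Pi.single j 1) p q) * hs

theorem integrable_of_indicator_of_indicator {μ : Measure (RVec d)} {a b b' : RVec d → ℝ}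
    (ha : Measurable a) (h0 : ∀ᵐ ξ ∂μ, 0 ≤ a ξ ∧ (a ξ ≤ b ξ ∨ a ξ ≤ b' ξ))
    (h1 : Integrable ({ξ | a ξ ≤ b ξ}.indicator a) μ)
    (h2 : Integrable ({ξ | a ξ ≤ b' ξ}.indicator a) μ) : Integrable a μ := by
  refine (h1.add h2).mono' ha.aestronglyMeasurable ?_
  filter_upwards [h0] with ξ hξ
  rw [Real.norm_of_nonneg hξ.1, Pi.add_apply]
  have hn : ∀ b : RVec d → ℝ, 0 ≤ {ξ | a ξ ≤ b ξ}.indicator a ξ := fun b =>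
    indicator_apply_nonneg fun _ => hξ.1
  rcases hξ.2 with h | h
  · rw [indicator_of_mem (s := {ξ | a ξ ≤ b ξ}) h]
    exact le_add_of_nonneg_right (hn b')
  · rw [indicator_of_mem (s := {ξ | a ξ ≤ b' ξ}) h]
    exact le_add_of_nonneg_left (hn b)

/-- The forms in the directions e_i + e_j and e_i - e_j add up to 2ξ_ii + 2ξ_jj ≥ 2ξ_ii, so at every
jump one of them dominates ξ_ii. A second index j is indispensable. -/
theorem integrable_inner_quadVec_trunc_self (hχ : χ.IsCharacteristicsOf Z)
    (hC : ∀ x, x ∈ C ↔ (e x : Matrix (Fin k) (Fin k) ℝ).PosSemidef) {i j : Fin k} (hij : i ≠ j) :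
    Integrable (fun ξ => inner ℝ (quadVec e (Pi.single i 1)) (trunc ξ))
      (χ.K (rankOne e (Pi.single i 1))) := by
  refine integrable_of_indicator_of_indicator (measurable_const.inner measurable_trunc) ?_
    (integrable_indicator_of_ne e hχ hC hij (s := 1) (by norm_num))
    (integrable_indicator_of_ne e hχ hC hij (s := -1) (by norm_num))
  filter_upwards [χ.ae_mem_cone hχ (span_eq_top e hC)
    (rankOne_mem e hC (Pi.single i 1))] with ξ hξ
  have hn : ∀ f, 0 ≤ inner ℝ (quadVec e f) (trunc ξ) := fun f =>
    inner_nonneg_of_mem_innerDual (quadVec_mem e hC f) (trunc_mem hξ)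
  have hsum : inner ℝ (quadVec e (Pi.single i 1 + (1 : ℝ) • Pi.single j 1)) (trunc ξ) +
      inner ℝ (quadVec e (Pi.single i 1 + (-1 : ℝ) • Pi.single j 1)) (trunc ξ) =
      2 * inner ℝ (quadVec e (Pi.single i 1)) (trunc ξ) +
      2 * inner ℝ (quadVec e (Pi.single j 1)) (trunc ξ) := by
    simp only [inner_quadVec, mulVec_add, add_dotProduct, dotProduct_add, mulVec_smul,
      dotProduct_smul, smul_dotProduct, smul_eq_mul]
    ring
  refine ⟨hn _, ?_⟩
  by_contra! h
  linarith [hn (Pi.single j 1), h.1, h.2]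

/-- Jumps on the cone of positive semidefinite matrices of size at least two have finite
variation. -/
theorem integrable_norm_trunc (hχ : χ.IsCharacteristicsOf Z)
    (hC : ∀ x, x ∈ C ↔ (e x : Matrix (Fin k) (Fin k) ℝ).PosSemidef) (hk : 2 ≤ k) {x : RVec d}
    (hx : x ∈ C) : Integrable (fun ξ => ‖trunc ξ‖) (χ.K x) := by
  have hspan := span_eq_top e hC
  have : Nontrivial (Fin k) := Fin.nontrivial_iff_two_le.2 hk
  have hil : ∀ i l : Fin k, Integrable (fun ξ => inner ℝ (quadVec e (Pi.single i 1)) (trunc ξ))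
      (χ.K (rankOne e (Pi.single l 1))) := by
    intro i l
    by_cases h : i = l
    · obtain ⟨j, hj⟩ := exists_ne i
      rw [← h]
      exact integrable_inner_quadVec_trunc_self e hχ hC hj.symm
    · exact integrable_inner_quadVec_trunc e hχ hC (by simp [h])
  have h0 : ∀ i, Integrable (fun ξ => inner ℝ (quadVec e (Pi.single i 1)) (trunc ξ)) (χ.K 0) :=
    fun i => χ.integrable_inner_trunc_of_orthogonal hχ hspan C.zero_mem (quadVec_mem e hC _)
      (inner_zero_right _)
  have hsmem : ∀ s : Finset (Fin k), ∑ l ∈ s, rankOne e (Pi.single l 1) ∈ C := fun s =>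
    sum_mem fun l _ => rankOne_mem e hC _
  have hs : ∀ i, ∀ s : Finset (Fin k), Integrable
      (fun ξ => inner ℝ (quadVec e (Pi.single i 1)) (trunc ξ))
      (χ.K (∑ l ∈ s, rankOne e (Pi.single l 1))) := by
    intro i s
    induction s using Finset.induction_on with
    | empty => exact h0 i
    | insert a s ha ih =>
      rw [Finset.sum_insert ha]
      exact integrable_K_add (rankOne_mem e hC _) (hsmem s) (hil i a) ih
  -- The point x₁ is the identity matrix, whose multiples dominate every x in the cone.
  set x₁ := ∑ l, rankOne e (Pi.single l 1) with hx₁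
  have hx₁C : x₁ ∈ C := hsmem _
  have hx₁e : (e x₁ : Matrix (Fin k) (Fin k) ℝ) = 1 := by
    rw [hx₁, map_sum, Submodule.coe_sum]
    simp only [coe_rankOne]
    ext a b
    simp [Matrix.sum_apply, vecMulVec_apply, one_apply, Pi.single_apply]
  have hn : ∀ i, ∀ n : ℕ, Integrable
      (fun ξ => inner ℝ (quadVec e (Pi.single i 1)) (trunc ξ)) (χ.K ((n : ℝ) • x₁)) := by
    intro i n
    induction n with
    | zero => simpa using h0 i
    | succ n ih =>
      rw [Nat.cast_succ, add_smul, one_smul]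
      exact integrable_K_add (C.smul_mem hx₁C n.cast_nonneg) hx₁C ih (hs i _)
  obtain ⟨n, hn'⟩ := exists_nsmul_sub_mem e hC (x₀ := x₁) (by rw [hx₁e]; exact PosDef.one) x
  have hxi : ∀ i, Integrable (fun ξ => inner ℝ (quadVec e (Pi.single i 1)) (trunc ξ)) (χ.K x) :=
    fun i => integrable_K_of_add hx hn' (by rw [add_sub_cancel]; exact hn i n)
  obtain ⟨c, hc, hle⟩ := exists_norm_le_sum_inner_quadVec e hC
  refine ((integrable_finsetSum Finset.univ fun i _ => hxi i).const_mul c).mono'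
    measurable_trunc.norm.aestronglyMeasurable ?_
  filter_upwards [χ.ae_mem_cone hχ hspan hx] with ξ hξ
  rw [norm_norm]
  exact hle _ (trunc_mem hξ)

/-- The constant part of the diffusion vanishes. -/
theorem diffForm_zero_eq_zero (hχ : χ.IsCharacteristicsOf Z)
    (hC : ∀ x, x ∈ C ↔ (e x : Matrix (Fin k) (Fin k) ℝ).PosSemidef) (v w : RVec d) :
    χ.diffForm 0 v w = 0 := by
  obtain ⟨Y, hY, rfl⟩ := exists_traceVec_eq e v
  -- At the origin every normal is orthogonal, so the diffusion form kills all squares f fᵀ, and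
  -- these span.
  have hle : Submodule.span ℝ (range fun f : Fin k → ℝ => vecMulVec f f) ≤
      LinearMap.ker (χ.diffForm 0 ∘ₗ traceVec e) := by
    rw [Submodule.span_le]
    rintro _ ⟨f, rfl⟩
    exact LinearMap.ext fun w => χ.diffForm_eq_zero C.zero_mem
      (χ.diffForm_self_eq_zero_of_orthogonal hχ (span_eq_top e hC) C.zero_mem
        (quadVec_mem e hC f) (inner_zero_right _)) w
  exact LinearMap.congr_fun (hle (symMatrices_le_span k hY)) w

end AffineTriplet

end AffineMoments

/-! ### Trilinear forms vanishing on orthogonal squares. -/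

namespace AffineMoments

section Classification

open Matrix

variable {k : ℕ}

/-- A quadratic form vanishing on the hyperplane f_i = 0 is divisible by f_i; the quotient appears
on expanding the form at f - f_i e_i. -/
theorem apply_self_eq_of_vanish {B : (Fin k → ℝ) →ₗ[ℝ] (Fin k → ℝ) →ₗ[ℝ] ℝ}
    (hsymm : ∀ f g, B f g = B g f) {i : Fin k} (h : ∀ f : Fin k → ℝ, f i = 0 → B f f = 0)
    (f : Fin k → ℝ) : B f f =
      f i * (2 * B f (Pi.single i 1) - f i * B (Pi.single i 1) (Pi.single i 1)) := by
  have h1 := h (f - f i • Pi.single i 1) (by simp)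
  simp only [map_sub, map_smul, LinearMap.sub_apply, LinearMap.smul_apply, smul_eq_mul,
    hsymm (Pi.single i 1) f] at h1
  linarith

/-- Along f + t·1, with 1 the all-ones vector, the form is a polynomial in t without quadratic term
and vanishes at two large values of t. This removes the division by f_i f_j in later steps. -/
theorem apply_self_eq_zero_of_generic {D : (Fin k → ℝ) →ₗ[ℝ] (Fin k → ℝ) →ₗ[ℝ] ℝ} {i j : Fin k}
    (h : ∀ f : Fin k → ℝ, f i ≠ 0 → f j ≠ 0 → D f f = 0) (f : Fin k → ℝ) : D f f = 0 := by
  have h0 := h 1 (by simp) (by simp)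
  have ht : ∀ t : ℝ, |f i| + |f j| < t → D (f + t • 1) (f + t • 1) = 0 := fun t ht => by
    have h1 := neg_abs_le (f i)
    have h2 := neg_abs_le (f j)
    refine h _ (ne_of_gt ?_) (ne_of_gt ?_) <;>
      simp only [Pi.add_apply, Pi.smul_apply, Pi.one_apply, smul_eq_mul, mul_one] <;>
      linarith [abs_nonneg (f i), abs_nonneg (f j)]
  have h1 := ht (|f i| + |f j| + 1) (by linarith)
  have h2 := ht (|f i| + |f j| + 2) (by linarith)
  simp only [map_add, map_smul, LinearMap.add_apply, LinearMap.smul_apply, smul_eq_mul, h0] at h1 h2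
  have h3 : D f 1 + D 1 f = 0 := by linarith
  have h4 : D f f = 0 := by linear_combination h1 - (|f i| + |f j| + 1) * h3
  exact h4

theorem apply_eq_zero_of_generic {L : (Fin k → ℝ) →ₗ[ℝ] ℝ} {i j : Fin k}
    (h : ∀ f : Fin k → ℝ, f i ≠ 0 → f j ≠ 0 → L f = 0) (f : Fin k → ℝ) : L f = 0 := by
  have h0 := h 1 (by simp) (by simp)
  have h1 := neg_abs_le (f i)
  have h2 := neg_abs_le (f j)
  have h3 := h (f + (|f i| + |f j| + 1) • 1) (ne_of_gt ?_) (ne_of_gt ?_)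
  · simpa [h0] using h3
  all_goals
    simp only [Pi.add_apply, Pi.smul_apply, Pi.one_apply, smul_eq_mul, mul_one]
    linarith [abs_nonneg (f i), abs_nonneg (f j)]

/-- A product of two linear forms vanishes only if one of them does. -/
theorem apply_eq_zero_of_dotProduct_mul {L : (Fin k → ℝ) →ₗ[ℝ] ℝ} {h : Fin k → ℝ} (hh : h ≠ 0)
    (hL : ∀ f, (f ⬝ᵥ h) * L f = 0) (f : Fin k → ℝ) : L f = 0 := by
  have hpos : h ⬝ᵥ h ≠ 0 := fun h0 => hh (dotProduct_self_eq_zero.1 h0)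
  have h1 : L h = 0 := (mul_eq_zero.1 (hL h)).resolve_left hpos
  by_cases hf : f ⬝ᵥ h = 0
  · have h2 := hL (f + h)
    rw [add_dotProduct, hf, zero_add, map_add, h1, add_zero] at h2
    exact (mul_eq_zero.1 h2).resolve_left hpos
  · exact (mul_eq_zero.1 (hL f)).resolve_left hf

/-- The bilinear form `(f, g) ↦ b (f gᵀ)`. -/
noncomputable def outerForm (b : Matrix (Fin k) (Fin k) ℝ →ₗ[ℝ] ℝ) :
    (Fin k → ℝ) →ₗ[ℝ] (Fin k → ℝ) →ₗ[ℝ] ℝ :=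
  LinearMap.mk₂ ℝ (fun f g => b (vecMulVec f g))
    (fun f f' g => by rw [add_vecMulVec, map_add])
    (fun c f g => by rw [smul_vecMulVec, map_smul])
    (fun f g g' => by rw [vecMulVec_add, map_add])
    (fun c f g => by rw [vecMulVec_smul, map_smul])

@[simp] theorem outerForm_apply (b : Matrix (Fin k) (Fin k) ℝ →ₗ[ℝ] ℝ) (f g : Fin k → ℝ) :
    outerForm b f g = b (vecMulVec f g) := rfl

/-- The linear map that represents a bilinear form on matrices vanishing on pairs of orthogonal
squares. -/
noncomputable def orthRep (b : Matrix (Fin k) (Fin k) ℝ →ₗ[ℝ] Matrix (Fin k) (Fin k) ℝ →ₗ[ℝ] ℝ)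
    (j : Fin k) : (Fin k → ℝ) →ₗ[ℝ] ℝ :=
  (2 : ℝ) • (outerForm (b.flip (single j j 1))).flip (Pi.single j 1) -
    b (single j j 1) (single j j 1) • LinearMap.proj j

theorem orthRep_apply (b : Matrix (Fin k) (Fin k) ℝ →ₗ[ℝ] Matrix (Fin k) (Fin k) ℝ →ₗ[ℝ] ℝ)
    (j : Fin k) (f : Fin k → ℝ) : orthRep b j f =
      2 * b (vecMulVec f (Pi.single j 1)) (single j j 1) -
        f j * b (single j j 1) (single j j 1) := by
  simp [orthRep, mul_comm]

theorem apply_vecMulVec_eq_of_orthogonal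
    {b : Matrix (Fin k) (Fin k) ℝ →ₗ[ℝ] Matrix (Fin k) (Fin k) ℝ →ₗ[ℝ] ℝ}
    (hb : ∀ V X, b Vᵀ X = b V X) (hb' : ∀ V X, b V Xᵀ = b V X)
    (horth : ∀ f h, f ⬝ᵥ h = 0 → b (vecMulVec f f) (vecMulVec h h) = 0) (f : Fin k → ℝ)
    {X : Matrix (Fin k) (Fin k) ℝ} (hX : X.IsSymm) :
    b (vecMulVec f f) X = f ⬝ᵥ X *ᵥ (fun j => orthRep b j f) := by
  have hsingle : ∀ i : Fin k, single i i (1 : ℝ) = vecMulVec (Pi.single i 1) (Pi.single i 1) :=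
    fun i => single_eq_single_vecMulVec_single i i
  have hdiag : ∀ i f, b (vecMulVec f f) (single i i 1) = f i * orthRep b i f := by
    intro i f
    have h := apply_self_eq_of_vanish (B := outerForm (b.flip (single i i 1))) (i := i)
      (fun f g => by
        simp only [outerForm_apply, LinearMap.flip_apply]
        rw [← hb (vecMulVec f g), transpose_vecMulVec])
      (fun f hf => by
        simp only [outerForm_apply, LinearMap.flip_apply]
        rw [hsingle]
        exact horth _ _ (by simpa using hf)) f
    rw [orthRep_apply]
    simpa [← hsingle] using h
  have hoff : ∀ i j f, 2 * b (vecMulVec f f) (single i j 1) =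
      f j * orthRep b i f + f i * orthRep b j f := by
    intro i j f
    have h := apply_self_eq_zero_of_generic (i := i) (j := j)
      (D := (2 : ℝ) • outerForm (b.flip (single i j 1)) -
        (LinearMap.mul ℝ ℝ).compl₁₂ (LinearMap.proj j) (orthRep b i) -
        (LinearMap.mul ℝ ℝ).compl₁₂ (LinearMap.proj i) (orthRep b j)) (fun f hi hj => ?_) f
    · simp only [LinearMap.sub_apply, LinearMap.smul_apply, outerForm_apply, LinearMap.flip_apply,
        LinearMap.compl₁₂_apply, LinearMap.mul_apply', LinearMap.proj_apply, smul_eq_mul] at h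
      linarith
    · simp only [LinearMap.sub_apply, LinearMap.smul_apply, outerForm_apply, LinearMap.flip_apply,
        LinearMap.compl₁₂_apply, LinearMap.mul_apply', LinearMap.proj_apply, smul_eq_mul]
      -- The test vector f_j e_i - f_i e_j is orthogonal to f. Expanding its square isolates the
      -- mixed entry, up to the factor f_i f_j, which is nonzero here.
      have h1 := horth f (f j • Pi.single i 1 - f i • Pi.single j 1) (by
        simp [dotProduct_sub, dotProduct_smul, mul_comm])
      have h2 : b (vecMulVec f f) (single j i 1) = b (vecMulVec f f) (single i j 1) := by
        rw [← hb' _ (single i j 1), transpose_single]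
      simp only [vecMulVec_sub, sub_vecMulVec, smul_vecMulVec, vecMulVec_smul, map_sub, map_smul,
        ← single_eq_single_vecMulVec_single, smul_eq_mul, hdiag, h2] at h1
      have h3 : f i * f j * (2 * b (vecMulVec f f) (single i j 1) - f j * orthRep b i f -
          f i * orthRep b j f) = 0 := by linear_combination -h1
      exact (mul_eq_zero.1 h3).resolve_left (mul_ne_zero hi hj)
  have hsum : b (vecMulVec f f) X = ∑ i, ∑ j, X i j * b (vecMulVec f f) (single i j 1) := by
    conv_lhs => rw [matrix_eq_sum_single X]
    simp only [map_sum]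
    refine Finset.sum_congr rfl fun i _ => Finset.sum_congr rfl fun j _ => ?_
    rw [← smul_eq_mul, ← map_smul, smul_single, smul_eq_mul, mul_one]
  have hA : f ⬝ᵥ X *ᵥ (fun j => orthRep b j f) = ∑ i, ∑ j, X i j * (f i * orthRep b j f) := by
    simp only [dotProduct, mulVec, Finset.mul_sum]
    exact Finset.sum_congr rfl fun i _ => Finset.sum_congr rfl fun j _ => by ring
  have hB : f ⬝ᵥ X *ᵥ (fun j => orthRep b j f) = ∑ i, ∑ j, X i j * (f j * orthRep b i f) := by
    rw [hA, Finset.sum_comm]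
    exact Finset.sum_congr rfl fun i _ => Finset.sum_congr rfl fun j _ => by rw [hX.apply i j]
  have h2 : 2 * b (vecMulVec f f) X = 2 * (f ⬝ᵥ X *ᵥ (fun j => orthRep b j f)) := by
    rw [two_mul (f ⬝ᵥ _)]
    nth_rewrite 1 [hB]
    rw [hA, hsum, Finset.mul_sum, ← Finset.sum_add_distrib]
    refine Finset.sum_congr rfl fun i _ => ?_
    rw [Finset.mul_sum, ← Finset.sum_add_distrib]
    exact Finset.sum_congr rfl fun j _ => by rw [mul_left_comm, hoff]; ring
  linarith

variable {T : Matrix (Fin k) (Fin k) ℝ →ₗ[ℝ] Matrix (Fin k) (Fin k) ℝ →ₗ[ℝ]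
  Matrix (Fin k) (Fin k) ℝ →ₗ[ℝ] ℝ}

/-- A trilinear form on symmetric matrices that vanishes on pairs of orthogonal squares is of the
form `(f fᵀ, g gᵀ, X) ↦ (fᵀ X g) (fᵀ N g)`. -/
theorem exists_matrix_of_orthogonal (hk : 0 < k) (hT₁ : ∀ V W X, T Vᵀ W X = T V W X)
    (hT₂ : ∀ V W X, T V W Xᵀ = T V W X) (hT : ∀ V W X, T V W X = T W V X)
    (horth : ∀ f h W, f ⬝ᵥ h = 0 → T (vecMulVec f f) W (vecMulVec h h) = 0) :
    ∃ N : Matrix (Fin k) (Fin k) ℝ, N.IsSymm ∧ ∀ f g X, X.IsSymm →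
      T (vecMulVec f f) (vecMulVec g g) X = (f ⬝ᵥ X *ᵥ g) * (f ⬝ᵥ N *ᵥ g) := by
  have hsingle : ∀ i : Fin k, single i i (1 : ℝ) = vecMulVec (Pi.single i 1) (Pi.single i 1) :=
    fun i => single_eq_single_vecMulVec_single i i
  have hT₃ : ∀ V W X, T V Wᵀ X = T V W X := fun V W X => by rw [hT, hT₁, hT]
  have horth' : ∀ g h V, g ⬝ᵥ h = 0 → T V (vecMulVec g g) (vecMulVec h h) = 0 :=
    fun g h V hgh => by rw [hT, horth g h V hgh]
  -- `M W j f` is the `j`-th component of the vector representing `T · W ·` at `f`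
  set M : Matrix (Fin k) (Fin k) ℝ → Fin k → (Fin k → ℝ) →ₗ[ℝ] ℝ :=
    fun W j => orthRep (T.flip W) j with hM
  have hMapp : ∀ W j f, M W j f = 2 * T (vecMulVec f (Pi.single j 1)) W (single j j 1) -
      f j * T (single j j 1) W (single j j 1) := fun W j f => orthRep_apply _ j f
  have hrep : ∀ f W X, X.IsSymm → T (vecMulVec f f) W X = f ⬝ᵥ X *ᵥ (fun j => M W j f) :=
    fun f W X hX => apply_vecMulVec_eq_of_orthogonal (b := T.flip W) (fun V X => hT₁ V W X)
      (fun V X => hT₂ V W X) (fun f h => horth f h W) f hX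
  set n : Fin k → (Fin k → ℝ) →ₗ[ℝ] (Fin k → ℝ) →ₗ[ℝ] ℝ := fun j =>
    LinearMap.mk₂ ℝ (fun f g => 2 * M (vecMulVec g (Pi.single j 1)) j f -
      g j * M (single j j 1) j f)
      (fun f f' g => by simp only [map_add]; ring)
      (fun c f g => by simp only [map_smul, smul_eq_mul]; ring)
      (fun f g g' => by
        simp only [hMapp, add_vecMulVec, map_add, LinearMap.add_apply, Pi.add_apply]; ring)
      (fun c f g => by
        simp only [hMapp, smul_vecMulVec, map_smul, LinearMap.smul_apply, Pi.smul_apply,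
          smul_eq_mul]; ring) with hn
  have hnapp : ∀ j f g, n j f g = 2 * M (vecMulVec g (Pi.single j 1)) j f -
      g j * M (single j j 1) j f := fun j f g => rfl
  -- For g_j = 0 the vectors g and e_j are orthogonal, so the j-th component vanishes and g_j
  -- factors out.
  have hMn : ∀ j f g, M (vecMulVec g g) j f = g j * n j f g := by
    intro j f g
    set B : (Fin k → ℝ) →ₗ[ℝ] (Fin k → ℝ) →ₗ[ℝ] ℝ :=
      (2 : ℝ) • outerForm ((T (vecMulVec f (Pi.single j 1))).flip (single j j 1)) -
        f j • outerForm ((T (single j j 1)).flip (single j j 1)) with hB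
    have hBapp : ∀ g g', B g g' = M (vecMulVec g g') j f := fun g g' => by
      rw [hMapp]
      simp [hB]
    have h := apply_self_eq_of_vanish (B := B) (i := j)
      (fun g g' => by
        rw [hBapp, hBapp, hMapp, hMapp, ← transpose_vecMulVec g g', hT₃, hT₃])
      (fun g hg => by
        have h0 : ∀ V, T V (vecMulVec g g) (single j j 1) = 0 := fun V => by
          rw [hsingle]; exact horth' _ _ _ (by simpa using hg)
        rw [hBapp, hMapp, h0, h0]; ring) g
    rw [hBapp, hBapp, hBapp, ← hsingle] at h
    rw [h, hnapp]
  -- Testing with h = g_j e_i - g_i e_j, which is orthogonal to g, gives (f · h) g_i g_j (n_i -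
  -- n_j)(f, g) = 0 for all f. Hence the quotients do not depend on the index.
  have hgen : ∀ i j f g, n i f g = n j f g := by
    intro i j f g
    have h := apply_eq_zero_of_generic (i := i) (j := j) (L := n i f - n j f)
      (fun g hi hj => ?_) g
    · rw [LinearMap.sub_apply] at h; linarith
    · by_cases hij : i = j
      · rw [hij, sub_self, LinearMap.zero_apply]
      set h : Fin k → ℝ := g j • Pi.single i 1 - g i • Pi.single j 1 with hh
      have hne : h ≠ 0 := fun h0 => hj (by
        have := congrFun h0 i
        simpa [hh, hij] using this)
      have h1 := apply_eq_zero_of_dotProduct_mul (L := (n i).flip g - (n j).flip g) hne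
        (fun f => by
          have h2 := horth' g h (vecMulVec f f) (by
            simp [hh, dotProduct_sub, dotProduct_smul, mul_comm])
          rw [hrep _ _ _ (isSymm_vecMulVec_self h), vecMulVec_mulVec, dotProduct_smul,
            op_smul_eq_smul, smul_eq_mul] at h2
          simp only [hMn] at h2
          have h3 : h ⬝ᵥ (fun j => g j * n j f g) = g j * g i * (n i f g - n j f g) := by
            simp only [hh, sub_dotProduct, smul_dotProduct, single_one_dotProduct, smul_eq_mul]
            ring
          rw [h3] at h2
          have h4 : g j * g i ≠ 0 := mul_ne_zero hj hi
          have h5 : g j * g i * ((f ⬝ᵥ h) * (n i f g - n j f g)) = 0 := by linear_combination h2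
          simpa using (mul_eq_zero.1 h5).resolve_left h4) f
      simpa using h1
  set i₀ : Fin k := ⟨0, hk⟩
  have hfull : ∀ f g X, X.IsSymm → T (vecMulVec f f) (vecMulVec g g) X =
      (f ⬝ᵥ X *ᵥ g) * n i₀ f g := by
    intro f g X hX
    rw [hrep _ _ _ hX]
    have h1 : (fun j => M (vecMulVec g g) j f) = n i₀ f g • g := by
      ext j
      rw [hMn, hgen j i₀, Pi.smul_apply, smul_eq_mul, mul_comm]
    rw [h1, mulVec_smul, dotProduct_smul, smul_eq_mul, mul_comm]
  set N₀ : Matrix (Fin k) (Fin k) ℝ := LinearMap.toMatrix₂' ℝ (n i₀) with hN₀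
  have hN₀app : ∀ f g, n i₀ f g = f ⬝ᵥ N₀ *ᵥ g := fun f g => by
    rw [hN₀, ← toLinearMap₂'_apply', toLinearMap₂'_toMatrix']
  -- The matrix N₀ need not be symmetric, but exchanging f and g leaves T unchanged, so averaging
  -- gives a symmetric representative.
  refine ⟨(1 / 2 : ℝ) • (N₀ + N₀ᵀ), ?_, fun f g X hX => ?_⟩
  · rw [IsSymm, transpose_smul, transpose_add, transpose_transpose, add_comm]
  · have h1 := hfull f g X hX
    have h2 := hfull g f X hX
    rw [← hT (vecMulVec f f)] at h2
    have h3 : g ⬝ᵥ X *ᵥ f = f ⬝ᵥ X *ᵥ g := by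
      rw [dotProduct_mulVec, ← mulVec_transpose, hX.eq, dotProduct_comm]
    have h4 : f ⬝ᵥ N₀ᵀ *ᵥ g = n i₀ g f := by
      rw [hN₀app, mulVec_transpose, dotProduct_mulVec, dotProduct_comm]
    rw [h3] at h2
    rw [smul_mulVec, dotProduct_smul, add_mulVec, dotProduct_add, h4, ← hN₀app, smul_eq_mul]
    linear_combination (1 / 2 : ℝ) * h1 + (1 / 2 : ℝ) * h2

theorem eq_of_eq_on_squares {L L' : Matrix (Fin k) (Fin k) ℝ →ₗ[ℝ] ℝ}
    (h : ∀ f, L (vecMulVec f f) = L' (vecMulVec f f)) {V : Matrix (Fin k) (Fin k) ℝ}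
    (hV : V.IsSymm) : L V = L' V :=
  LinearMap.eqOn_span (s := range fun f : Fin k → ℝ => vecMulVec f f)
    (by rintro _ ⟨f, rfl⟩; exact h f) (symMatrices_le_span k hV)

/-- Squares span the symmetric matrices, so the identity on squares extends by linearity in W and
then in V. -/
theorem exists_trace_formula_of_orthogonal (hk : 0 < k) (hT₁ : ∀ V W X, T Vᵀ W X = T V W X)
    (hT₂ : ∀ V W X, T V W Xᵀ = T V W X) (hT : ∀ V W X, T V W X = T W V X)
    (horth : ∀ f h W, f ⬝ᵥ h = 0 → T (vecMulVec f f) W (vecMulVec h h) = 0) :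
    ∃ N : Matrix (Fin k) (Fin k) ℝ, N.IsSymm ∧
      (∀ f X, X.IsSymm → T (vecMulVec f f) (vecMulVec f f) X = (f ⬝ᵥ X *ᵥ f) * (f ⬝ᵥ N *ᵥ f)) ∧
      ∀ V W X, V.IsSymm → W.IsSymm → X.IsSymm →
        T V W X = (1 / 2) * ((V * N * W * X).trace + (W * N * V * X).trace) := by
  obtain ⟨N, hN, hNT⟩ := exists_matrix_of_orthogonal hk hT₁ hT₂ hT horth
  refine ⟨N, hN, fun f X hX => hNT f f X hX, fun V W X hV hW hX => ?_⟩
  have hbase : ∀ f g, T (vecMulVec f f) (vecMulVec g g) X =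
      (1 / 2) * ((vecMulVec f f * N * vecMulVec g g * X).trace +
        (vecMulVec g g * N * vecMulVec f f * X).trace) := by
    intro f g
    have htr : ∀ f g : Fin k → ℝ, (vecMulVec f f * N * vecMulVec g g * X).trace =
        (f ⬝ᵥ N *ᵥ g) * (g ⬝ᵥ X *ᵥ f) := fun f g => by
      rw [vecMulVec_mul, vecMulVec_mul_vecMulVec, vecMulVec_mul, trace_vecMulVec,
        ← dotProduct_mulVec, smul_vecMul, dotProduct_smul, smul_eq_mul,
        dotProduct_comm f (g ᵥ* X),
        ← dotProduct_mulVec]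
    have hs : ∀ Y : Matrix (Fin k) (Fin k) ℝ, Y.IsSymm → g ⬝ᵥ Y *ᵥ f = f ⬝ᵥ Y *ᵥ g :=
      fun Y hY => by rw [dotProduct_mulVec, ← mulVec_transpose, hY.eq, dotProduct_comm]
    rw [hNT f g X hX, htr, htr, hs X hX, hs N hN]
    ring
  have hlin : ∀ (A V B W : Matrix (Fin k) (Fin k) ℝ), ((1 / 2 : ℝ) •
      (traceLinearMap (Fin k) ℝ ℝ ∘ₗ LinearMap.mulRight ℝ B ∘ₗ LinearMap.mulLeft ℝ A +
        traceLinearMap (Fin k) ℝ ℝ ∘ₗ LinearMap.mulRight ℝ (N * V * X))) W =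
      (1 / 2) * ((A * W * B).trace + (W * N * V * X).trace) := fun A V B W => by
    simp [mul_assoc, mul_add]
  have hright : ∀ f, T (vecMulVec f f) W X =
      (1 / 2) * ((vecMulVec f f * N * W * X).trace + (W * N * vecMulVec f f * X).trace) := by
    intro f
    have h := eq_of_eq_on_squares (L := (T (vecMulVec f f)).flip X) (L' := (1 / 2 : ℝ) •
      (traceLinearMap (Fin k) ℝ ℝ ∘ₗ LinearMap.mulRight ℝ X ∘ₗ
          LinearMap.mulLeft ℝ (vecMulVec f f * N) +
        traceLinearMap (Fin k) ℝ ℝ ∘ₗ LinearMap.mulRight ℝ (N * vecMulVec f f * X)))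
      (fun g => by rw [LinearMap.flip_apply, hbase, hlin]) hW
    rwa [LinearMap.flip_apply, hlin] at h
  have h := eq_of_eq_on_squares (L := (T.flip W).flip X) (L' := (1 / 2 : ℝ) •
      (traceLinearMap (Fin k) ℝ ℝ ∘ₗ LinearMap.mulRight ℝ X ∘ₗ LinearMap.mulLeft ℝ (W * N) +
        traceLinearMap (Fin k) ℝ ℝ ∘ₗ LinearMap.mulRight ℝ (N * W * X)))
      (fun g => by
        rw [LinearMap.flip_apply, LinearMap.flip_apply, hright, hlin, add_comm (trace _)]) hV
  rw [LinearMap.flip_apply, LinearMap.flip_apply, hlin] at h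
  rw [h, add_comm (trace _)]

end Classification

end AffineMoments

/-! ### The diffusion is of Wishart type. -/

namespace AffineMoments

open Matrix

/-- The symmetric part of a matrix. -/
noncomputable def symPart (k : ℕ) : Matrix (Fin k) (Fin k) ℝ →ₗ[ℝ] symMatrices k :=
  LinearMap.codRestrict (symMatrices k)
    ((1 / 2 : ℝ) • (LinearMap.id + (transposeLinearEquiv (Fin k) (Fin k) ℝ ℝ).toLinearMap))
    fun X => by
      change IsSymm _
      ext i j
      simp [add_comm]

theorem coe_symPart {k : ℕ} (X : Matrix (Fin k) (Fin k) ℝ) :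
    (symPart k X : Matrix (Fin k) (Fin k) ℝ) = (1 / 2 : ℝ) • (X + Xᵀ) := rfl

theorem symPart_of_isSymm {k : ℕ} {X : Matrix (Fin k) (Fin k) ℝ} (hX : X.IsSymm) :
    symPart k X = ⟨X, hX⟩ := by
  refine Subtype.ext ?_
  rw [coe_symPart, hX.eq, ← two_smul ℝ, smul_smul]
  norm_num

theorem symPart_transpose {k : ℕ} (X : Matrix (Fin k) (Fin k) ℝ) :
    symPart k Xᵀ = symPart k X := by
  refine Subtype.ext ?_
  rw [coe_symPart, coe_symPart, transpose_transpose, add_comm]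

theorem traceVec_transpose {d k : ℕ} (e : RVec d ≃ₗ[ℝ] symMatrices k)
    (Y : Matrix (Fin k) (Fin k) ℝ) : traceVec e Yᵀ = traceVec e Y := by
  refine ext_inner_right ℝ fun x => ?_
  have h : (e x : Matrix (Fin k) (Fin k) ℝ)ᵀ = e x := (e x).2
  rw [inner_traceVec, inner_traceVec, ← trace_transpose, transpose_mul, transpose_transpose, h,
    trace_mul_comm]

/-- With X = BᵀB the trace is that of B A Bᵀ. -/
theorem trace_mul_nonneg {k : ℕ} {A X : Matrix (Fin k) (Fin k) ℝ} (hA : A.PosSemidef)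
    (hX : X.PosSemidef) : 0 ≤ (A * X).trace := by
  obtain ⟨B, rfl⟩ := exists_eq_transpose_mul_self hX
  rw [← Matrix.mul_assoc, trace_mul_comm, ← Matrix.mul_assoc]
  have h := hA.mul_mul_conjTranspose_same B
  rw [conjTranspose_eq_transpose_of_trivial] at h
  exact h.trace_nonneg

namespace AffineTriplet

variable {d k : ℕ} (e : RVec d ≃ₗ[ℝ] symMatrices k) {C : ProperCone ℝ (RVec d)}
  (χ : AffineTriplet (C : Set (RVec d))) {Ω : Type*} [MeasurableSpace Ω]
  {Z : AffineProcess (C : Set (RVec d)) Ω}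

theorem exists_linear_diffForm (h0 : ∀ v w, χ.diffForm 0 v w = 0) :
    ∃ Q : RVec d →ₗ[ℝ] RVec d →ₗ[ℝ] RVec d →ₗ[ℝ] ℝ, ∀ x, Q x = χ.diffForm x := by
  have hsmul : ∀ (s : ℝ) x, χ.diffForm (s • x) = s • χ.diffForm x := fun s x => by
    ext v w
    have h := χ.diffForm_convex x 0 v w s
    rw [smul_zero, add_zero, h0, mul_zero, add_zero] at h
    rw [h]; rfl
  refine ⟨{ toFun := χ.diffForm, map_add' := fun x y => ?_, map_smul' := hsmul }, fun x => rfl⟩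
  ext v w
  have h := χ.diffForm_convex ((2 : ℝ) • x) ((2 : ℝ) • y) v w (1 / 2)
  rw [show (1 : ℝ) - 1 / 2 = 1 / 2 by norm_num, smul_smul, smul_smul,
    show (1 / 2 : ℝ) * 2 = 1 by norm_num, one_smul, one_smul, hsmul, hsmul] at h
  simp only [LinearMap.smul_apply, smul_eq_mul] at h
  simp only [LinearMap.add_apply]
  linarith

/-- The diffusion of an affine process on positive semidefinite matrices is that of a Wishart
process, with some positive semidefinite volatility matrix. -/
theorem exists_diffusion_matrix (hχ : χ.IsCharacteristicsOf Z)
    (hC : ∀ x, x ∈ C ↔ (e x : Matrix (Fin k) (Fin k) ℝ).PosSemidef) (hk : 0 < k) :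
    ∃ N : Matrix (Fin k) (Fin k) ℝ, N.PosSemidef ∧ ∀ V W x, V.IsSymm → W.IsSymm →
      χ.diffForm x (traceVec e V) (traceVec e W) =
        (1 / 2) * ((V * N * W * (e x : Matrix (Fin k) (Fin k) ℝ)).trace +
          (W * N * V * (e x : Matrix (Fin k) (Fin k) ℝ)).trace) := by
  have h0 := diffForm_zero_eq_zero e (χ := χ) hχ hC
  have hspan := span_eq_top e hC
  obtain ⟨Q, hQ⟩ := χ.exists_linear_diffForm h0
  set S : Matrix (Fin k) (Fin k) ℝ →ₗ[ℝ] RVec d := (e.symm : symMatrices k →ₗ[ℝ] RVec d) ∘ₗ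
    symPart k with hS
  -- Symmetrizing the arguments defines T on all matrices. Its vanishing on orthogonal squares is
  -- the annihilation of the normals at f fᵀ by the diffusion there.
  set T : Matrix (Fin k) (Fin k) ℝ →ₗ[ℝ] Matrix (Fin k) (Fin k) ℝ →ₗ[ℝ]
      Matrix (Fin k) (Fin k) ℝ →ₗ[ℝ] ℝ :=
    LinearMap.mk₂ ℝ (fun V W => ((Q.flip (traceVec e V)).flip (traceVec e W)) ∘ₗ S)
      (fun V V' W => by ext; simp) (fun c V W => by ext; simp)
      (fun V W W' => by ext; simp) (fun c V W => by ext; simp) with hT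
  have hTapp : ∀ V W X, T V W X = χ.diffForm (S X) (traceVec e V) (traceVec e W) :=
    fun V W X => by rw [← hQ]; rfl
  have hSC : ∀ f, S (vecMulVec f f) = rankOne e f := fun f => by
    change e.symm (symPart k _) = _
    rw [symPart_of_isSymm (isSymm_vecMulVec_self f)]; rfl
  have hSe : ∀ x, S (e x) = x := fun x => by
    change e.symm (symPart k _) = _
    rw [symPart_of_isSymm (e x).2]; exact e.symm_apply_apply x
  have hsymm : ∀ x v w, χ.diffForm x v w = χ.diffForm x w v := by
    intro x v w
    have h : (Q.flip v).flip w = (Q.flip w).flip v := LinearMap.ext_on hspan fun y hy => by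
      change Q y v w = Q y w v
      rw [hQ, χ.diffForm_symm hy]
    rw [← hQ]
    exact LinearMap.congr_fun h x
  obtain ⟨N, hN, hNT, hNtr⟩ := exists_trace_formula_of_orthogonal (T := T) hk
    (fun V W X => by rw [hTapp, hTapp, traceVec_transpose])
    (fun V W X => by
      rw [hTapp, hTapp]
      congr 3
      change e.symm (symPart k _) = e.symm (symPart k _)
      rw [symPart_transpose])
    (fun V W X => by rw [hTapp, hTapp, hsymm])
    (fun f h W hfh => by
      rw [hTapp, hSC]
      exact χ.diffForm_eq_zero (rankOne_mem e hC h) (χ.diffForm_self_eq_zero_of_orthogonal hχ hspan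
        (rankOne_mem e hC h) (quadVec_mem e hC f)
        (by rw [inner_quadVec_rankOne, hfh, zero_pow two_ne_zero])) _)
  refine ⟨N, .of_dotProduct_mulVec_nonneg ?_ fun f => ?_, fun V W x hV hW => ?_⟩
  · rw [IsHermitian, conjTranspose_eq_transpose_of_trivial, hN.eq]
  · by_cases hf : f = 0
    · simp [hf]
    -- At the identity matrix the diffusion form on f fᵀ equals |f|² fᵀNf, which yields positivity
    -- of N.
    have h1 := hNT f 1 isSymm_one
    rw [one_mulVec, hTapp] at h1
    have hpos : 0 < f ⬝ᵥ f := lt_of_le_of_ne (by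
      simpa using dotProduct_star_self_nonneg f) fun h => hf (dotProduct_self_eq_zero.1 h.symm)
    have h2 : 0 ≤ χ.diffForm (S 1) (traceVec e (vecMulVec f f)) (traceVec e (vecMulVec f f)) := by
      refine χ.diffForm_nonneg (SetLike.mem_coe.2 ((hC _).2 ?_)) _
      change (e (e.symm (symPart k 1)) : Matrix (Fin k) (Fin k) ℝ).PosSemidef
      rw [symPart_of_isSymm isSymm_one, e.apply_symm_apply]
      exact PosSemidef.one
    rw [h1] at h2
    simpa using nonneg_of_mul_nonneg_right h2 hpos
  · rw [← hNtr V W _ hV hW (e x).2, hTapp, hSe]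

end AffineTriplet

end AffineMoments

/-! ### The energy estimate for the quadratic part. -/

namespace AffineMoments

open Matrix

/-- Conjugating cN - NVN by U = V and by U = W preserves positivity, and so does taking the trace
against X. -/
theorem trace_cubic_le {k : ℕ} {V W N X : Matrix (Fin k) (Fin k) ℝ} {c : ℝ} (hV : V.IsSymm)
    (hW : W.IsSymm) (hX : X.PosSemidef) (hN : (c • N - N * V * N).PosSemidef) :
    (V * N * V * N * V * X).trace + (W * N * V * N * W * X).trace ≤
      c * ((V * N * V * X).trace + (W * N * W * X).trace) := by
  have key : ∀ U : Matrix (Fin k) (Fin k) ℝ, U.IsSymm →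
      (U * N * V * N * U * X).trace ≤ c * (U * N * U * X).trace := fun U hU => by
    have h := hN.mul_mul_conjTranspose_same U
    rw [conjTranspose_eq_transpose_of_trivial, hU.eq] at h
    have h2 := trace_mul_nonneg h hX
    have h3 : U * (c • N - N * V * N) * U * X = c • (U * N * U * X) - U * N * V * N * U * X := by
      simp only [mul_sub, sub_mul, mul_smul_comm, smul_mul_assoc, Matrix.mul_assoc]
    rw [h3, trace_sub, trace_smul, smul_eq_mul] at h2
    linarith
  rw [mul_add]
  exact add_le_add (key V hV) (key W hW)

namespace AffineTriplet

theorem re_conj_mul_cpair {d : ℕ} (u z : CVec d) (b : RVec d) :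
    (starRingEnd ℂ (cpair u b) * cpair z b).re =
      inner ℝ (rePart u) b * inner ℝ (rePart z) b + inner ℝ (imPart u) b * inner ℝ (imPart z) b := by
  rw [Complex.mul_re, Complex.conj_re, Complex.conj_im, cpair_re, cpair_im, cpair_re, cpair_im]
  ring

section Wishart

variable {d k : ℕ} (e : RVec d ≃ₗ[ℝ] symMatrices k) {C : ProperCone ℝ (RVec d)}
  (χ : AffineTriplet (C : Set (RVec d))) {Ω : Type*} [MeasurableSpace Ω]
  {Z : AffineProcess (C : Set (RVec d)) Ω}

/-- The diffusion form at a point of the state space is a sum of squares of linear forms. -/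
theorem exists_sum_inner_mul_inner {D : Set (RVec d)} (χ : AffineTriplet D) {x : RVec d}
    (hx : x ∈ D) : ∃ b : Fin d → RVec d,
      ∀ v w, χ.diffForm x v w = ∑ i, inner ℝ v (b i) * inner ℝ w (b i) := by
  obtain ⟨B, hB⟩ := exists_eq_transpose_mul_self (χ.a_posSemidef x hx)
  refine ⟨fun i => WithLp.toLp 2 (B i), fun v w => ?_⟩
  rw [diffForm_eq_dotProduct, hB, ← mulVec_mulVec, dotProduct_mulVec, vecMul_transpose]
  refine Finset.sum_congr rfl fun i _ => ?_
  congr 1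

/-- With g = Nf, fᵀNVNf = gᵀVg ≤ ⟨q, g gᵀ⟩ ≤ B r |g|², and |Nf|² ≤ s fᵀNf. An upper bound on V
suffices. -/
theorem exists_posSemidef_smul_sub
    (hC : ∀ x, x ∈ C ↔ (e x : Matrix (Fin k) (Fin k) ℝ).PosSemidef)
    {N : Matrix (Fin k) (Fin k) ℝ} (hN : N.PosSemidef) {B : ℝ} (hB : 0 ≤ B) :
    ∃ c : ℝ, 0 ≤ c ∧ ∀ (q : RVec d) (V : Matrix (Fin k) (Fin k) ℝ), ‖q‖ ≤ B → V.IsSymm →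
      q - traceVec e V ∈ ProperCone.innerDual (C : Set (RVec d)) →
      (c • N - N * V * N).PosSemidef := by
  obtain ⟨r, hr, hrle⟩ := exists_norm_le_sum_inner_quadVec e hC
  obtain ⟨s, hs, hsle⟩ := exists_mulVec_dotProduct_mulVec_le hN
  have hNT : Nᵀ = N := by
    have := hN.isHermitian
    rwa [IsHermitian, conjTranspose_eq_transpose_of_trivial] at this
  refine ⟨B * (r * s), by positivity, fun q V hq hV hqV =>
    .of_dotProduct_mulVec_nonneg ?_ fun f => ?_⟩
  · rw [IsHermitian, conjTranspose_eq_transpose_of_trivial, transpose_sub, transpose_smul,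
      transpose_mul, transpose_mul, hNT, hV.eq, Matrix.mul_assoc]
  · set g := N *ᵥ f with hg
    have h1 : g ⬝ᵥ V *ᵥ g = inner ℝ (traceVec e V) (rankOne e g) := by
      rw [inner_traceVec, coe_rankOne, mul_vecMulVec, trace_vecMulVec, dotProduct_comm]
    have h2 := inner_nonneg_of_mem_innerDual hqV (rankOne_mem e hC g)
    rw [inner_sub_left] at h2
    have h3 : ‖rankOne e g‖ ≤ r * (g ⬝ᵥ g) := by
      refine (hrle _ (rankOne_mem e hC g)).trans (le_of_eq ?_)
      congr 1
      refine Finset.sum_congr rfl fun i _ => ?_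
      rw [inner_quadVec_rankOne, single_one_dotProduct, sq]
    have h4 : inner ℝ q (rankOne e g) ≤ B * (r * (s * (f ⬝ᵥ N *ᵥ f))) := by
      refine (real_inner_le_norm _ _).trans ?_
      refine mul_le_mul hq (h3.trans ?_) (norm_nonneg _) hB
      exact mul_le_mul_of_nonneg_left (hsle f) hr
    have h5 : f ⬝ᵥ (N * V * N) *ᵥ f = g ⬝ᵥ V *ᵥ g := by
      rw [← mulVec_mulVec, ← mulVec_mulVec, dotProduct_mulVec, ← mulVec_transpose, hNT]
    rw [star_trivial, sub_mulVec, dotProduct_sub, smul_mulVec, dotProduct_smul, smul_eq_mul, h5,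
      h1]
    linarith

/-- The quadratic part of the Riccati vector field of an affine process on positive semidefinite
matrices, and the energy estimate for it. -/
theorem exists_quadratic_part
    (hC : ∀ x, x ∈ C ↔ (e x : Matrix (Fin k) (Fin k) ℝ).PosSemidef)
    {N : Matrix (Fin k) (Fin k) ℝ}
    (hNQ : ∀ V W x, V.IsSymm → W.IsSymm → χ.diffForm x (traceVec e V) (traceVec e W) =
      (1 / 2) * ((V * N * W * (e x : Matrix (Fin k) (Fin k) ℝ)).trace +
        (W * N * V * (e x : Matrix (Fin k) (Fin k) ℝ)).trace)) (hN : N.PosSemidef)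
    {B : ℝ} (hB : 0 ≤ B) {x₀ : RVec d} (hx₀ : x₀ ∈ C) :
    ∃ c : ℝ, 0 ≤ c ∧ ∀ (q : RVec d) (u : CVec d), ‖q‖ ≤ B →
      q - rePart u ∈ ProperCone.innerDual (C : Set (RVec d)) → ∃ z : CVec d,
      (∀ x ∈ C, cpair z x = (1 / 2 : ℂ) * χ.diffFormC x u u) ∧
      χ.diffForm x₀ (rePart u) (rePart z) + χ.diffForm x₀ (imPart u) (imPart z) ≤
        c * (χ.diffForm x₀ (rePart u) (rePart u) + χ.diffForm x₀ (imPart u) (imPart u)) := by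
  obtain ⟨c, hc, hcN⟩ := exists_posSemidef_smul_sub e hC hN hB
  have hNT : Nᵀ = N := by
    have := hN.isHermitian
    rwa [IsHermitian, conjTranspose_eq_transpose_of_trivial] at this
  refine ⟨c / 2, by positivity, fun q u hq hqu => ?_⟩
  obtain ⟨V, hV, hVu⟩ := exists_traceVec_eq e (rePart u)
  obtain ⟨W, hW, hWu⟩ := exists_traceVec_eq e (imPart u)
  -- Y and Y' are the real and imaginary parts of ½ (V + iW) N (V + iW).
  set Y := (1 / 2 : ℝ) • (V * N * V - W * N * W) with hY
  set Y' := (1 / 2 : ℝ) • (V * N * W + W * N * V) with hY'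
  have hYs : Y.IsSymm := by
    rw [IsSymm, hY, transpose_smul, transpose_sub]
    simp only [transpose_mul, hNT, hV.eq, hW.eq, Matrix.mul_assoc]
  have hYs' : Y'.IsSymm := by
    rw [IsSymm, hY', transpose_smul, transpose_add]
    simp only [transpose_mul, hNT, hV.eq, hW.eq, Matrix.mul_assoc, add_comm]
  refine ⟨toC (traceVec e Y) + Complex.I • toC (traceVec e Y'), fun x hx => ?_, ?_⟩
  · have h := χ.sum_mul_a_mul x hx u
    rw [← diffFormC_apply, ← hVu, ← hWu, hNQ _ _ _ hV hV, hNQ _ _ _ hW hW, hNQ _ _ _ hV hW] at h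
    rw [h, add_cpair, smul_cpair, cpair_toC, cpair_toC, inner_traceVec, inner_traceVec, hY, hY']
    simp only [smul_mul_assoc, sub_mul, add_mul, trace_smul, trace_sub, trace_add, smul_eq_mul]
    push_cast
    ring
  · have hre : rePart (toC (traceVec e Y) + Complex.I • toC (traceVec e Y')) = traceVec e Y := by
      ext i; simp
    have him : imPart (toC (traceVec e Y) + Complex.I • toC (traceVec e Y')) = traceVec e Y' := by
      ext i; simp
    -- Between the real and imaginary contributions the terms VNWNW and WNWNV cancel. What remains
    -- is half of tr(VNVNVX) + tr(WNVNWX), whence the constant c / 2.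
    have hle := trace_cubic_le hV hW ((hC _).1 hx₀) (hcN q V hq hV (by rwa [hVu]))
    rw [hre, him, ← hVu, ← hWu, hNQ _ _ _ hV hYs, hNQ _ _ _ hW hYs', hNQ _ _ _ hV hV,
      hNQ _ _ _ hW hW, hY, hY']
    simp only [smul_mul_assoc, mul_smul_comm, sub_mul, add_mul, mul_sub, mul_add, trace_smul,
      trace_sub, trace_add, smul_eq_mul, ← Matrix.mul_assoc]
    linarith

/-- The Lyapunov function is the energy of a(x₀) on real and imaginary parts, written as a sum of
squared pairings. Nondegeneracy makes it control ‖ψ‖²; the quadratic part of R obeys the energy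
estimate, and the rest grows linearly. -/
theorem realLifetime_le_of_det_ne_zero (hχ : χ.IsCharacteristicsOf Z)
    (hC : ∀ x, x ∈ C ↔ (e x : Matrix (Fin k) (Fin k) ℝ).PosSemidef) (hk : 2 ≤ k)
    {x₀ : RVec d} (hx₀ : x₀ ∈ C) (hdet : (χ.a x₀).det ≠ 0) (u : CVec d) :
    χ.realLifetime (rePart u) ≤ χ.complexLifetime u := by
  have hspan := span_eq_top e hC
  refine realLifetime_le_complexLifetime hχ hspan fun T hT q hqc hqO => ?_
  have hkc : IsCompact (q '' Icc 0 T) := isCompact_Icc.image_of_continuousOn hqc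
  have hkY : q '' Icc 0 T ⊆ interior χ.expDomain := by
    rintro _ ⟨t, ht, rfl⟩; exact hqO t ht
  obtain ⟨B, hB⟩ := hkc.isBounded.exists_norm_le
  obtain ⟨N, hN, hNQ⟩ := exists_diffusion_matrix e χ hχ hC (by omega)
  obtain ⟨l, hl, hquad⟩ := exists_quadratic_part e χ hC hNQ hN (le_max_right B 0) hx₀
  obtain ⟨c, hc, hle⟩ := χ.exists_norm_complexR_sub_le hχ hspan hkc hkY
    fun x hx => integrable_norm_trunc e hχ hC hk hx
  obtain ⟨s, hs, hcoer⟩ := exists_dotProduct_self_le (χ.a_posSemidef x₀ hx₀) hdet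
  obtain ⟨b, hb⟩ := χ.exists_sum_inner_mul_inner hx₀
  have hE : ∀ v : CVec d, ∑ i, ‖cpair v (b i)‖ ^ 2 =
      χ.diffForm x₀ (rePart v) (rePart v) + χ.diffForm x₀ (imPart v) (imPart v) := fun v => by
    rw [hb, hb, ← Finset.sum_add_distrib]
    refine Finset.sum_congr rfl fun i _ => ?_
    rw [← re_conj_mul_cpair, ← Complex.normSq_eq_conj_mul_self, Complex.ofReal_re,
      Complex.normSq_eq_norm_sq]
  have hnorm : ∀ v : CVec d, ‖v‖ ^ 2 ≤ s * ∑ i, ‖cpair v (b i)‖ ^ 2 := fun v => by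
    have h1 := hcoer (rePart v)
    have h2 := hcoer (imPart v)
    rw [← diffForm_eq_dotProduct] at h1 h2
    rw [hE, mul_add]
    refine le_trans (le_of_eq ?_) (add_le_add h1 h2)
    rw [EuclideanSpace.norm_sq_eq, dotProduct, dotProduct, ← Finset.sum_add_distrib]
    refine Finset.sum_congr rfl fun i _ => ?_
    rw [← Complex.normSq_eq_norm_sq, Complex.normSq_apply]; rfl
  set β := ∑ i, ‖b i‖ ^ 2 with hβ
  -- The second term pays for the linear remainder, through ‖ψ‖ (1 + ‖ψ‖) ≤ 2 (1 + s)(1 + E), which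
  -- follows from ‖ψ‖² ≤ s E.
  set c' := l + β * (c * (2 * (1 + s))) with hc'
  have hβ0 : 0 ≤ β := Finset.sum_nonneg fun _ _ => by positivity
  have hc0 : 0 ≤ c' := by positivity
  set V := (1 + ∑ i, ‖cpair u (b i)‖ ^ 2) * Real.exp (2 * c' * T) with hV
  refine ⟨Real.sqrt (s * V), fun τ hτ hτT ψ hψ0 hψ hdom => ?_⟩
  have hVt := hψ.sum_norm_cpair_sq_le b hτT hc0 (fun t ht => by
    have hqt : q t ∈ q '' Icc 0 T := mem_image_of_mem q (Icc_subset_Icc_right hτT ht)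
    obtain ⟨z, hz, hzle⟩ := hquad (q t) (ψ t) ((hB _ hqt).trans (le_max_left _ _)) (hdom t ht)
    have h0 : χ.diffFormC 0 (ψ t) (ψ t) = 0 := by
      have := χ.sum_mul_a_mul 0 C.zero_mem (ψ t)
      rw [← diffFormC_apply] at this
      simpa [diffForm_zero_eq_zero e hχ hC] using this
    have h1 := hle _ hqt (ψ t) (hdom t ht) z fun x hx => by rw [hz x hx, h0, sub_zero]
    set E := ∑ i, ‖cpair (ψ t) (b i)‖ ^ 2 with hEdef
    have hE0 : 0 ≤ E := Finset.sum_nonneg fun _ _ => by positivity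
    have h2 : ∀ i, (starRingEnd ℂ (cpair (ψ t) (b i)) * cpair (χ.complexR (ψ t)) (b i)).re ≤
        (starRingEnd ℂ (cpair (ψ t) (b i)) * cpair z (b i)).re +
          ‖b i‖ ^ 2 * (c * (2 * (1 + s) * (1 + E))) := fun i => by
      have h3 : cpair (χ.complexR (ψ t)) (b i) =
          cpair z (b i) + cpair (χ.complexR (ψ t) - z) (b i) := by
        rw [← add_cpair, add_sub_cancel]
      rw [h3, mul_add, Complex.add_re]
      refine add_le_add le_rfl ((Complex.re_le_norm _).trans ?_)
      rw [norm_mul, RCLike.norm_conj]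
      calc _ ≤ (‖ψ t‖ * ‖b i‖) * ((c * (1 + ‖ψ t‖)) * ‖b i‖) := by
            gcongr
            · exact norm_cpair_le _ _
            · exact (norm_cpair_le _ _).trans (by gcongr)
        _ = ‖b i‖ ^ 2 * (c * (‖ψ t‖ * (1 + ‖ψ t‖))) := by ring
        _ ≤ _ := by
            refine mul_le_mul_of_nonneg_left (mul_le_mul_of_nonneg_left ?_ hc) (by positivity)
            have h5 : ‖ψ t‖ ^ 2 ≤ s * E := hnorm (ψ t)
            nlinarith [sq_nonneg (‖ψ t‖ - 1), mul_nonneg hs hE0]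
    refine (Finset.sum_le_sum fun i _ => h2 i).trans ?_
    rw [Finset.sum_add_distrib, ← Finset.sum_mul]
    have h4 : ∑ i, (starRingEnd ℂ (cpair (ψ t) (b i)) * cpair z (b i)).re ≤ l * E := by
      rw [hEdef, hE]
      refine le_trans (le_of_eq ?_) hzle
      rw [hb, hb, ← Finset.sum_add_distrib]
      exact Finset.sum_congr rfl fun i _ => re_conj_mul_cpair _ _ _
    rw [← hβ, hc', add_mul]
    refine add_le_add (h4.trans ?_) (le_of_eq (by ring))
    nlinarith) τ (right_mem_Icc.2 hτ.le)
  rw [hψ0] at hVt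
  exact Real.le_sqrt_of_sq_le ((hnorm _).trans (mul_le_mul_of_nonneg_left hVt hs))

end Wishart

end AffineTriplet

end AffineMoments

/-! ### Small matrix sizes and the conclusion. -/

namespace AffineMoments

open Matrix

theorem eq_diagonal_of_subsingleton {ι : Type*} [Subsingleton ι] [DecidableEq ι]
    (A : Matrix ι ι ℝ) : A = diagonal fun i => A i i := by
  ext i j
  obtain rfl := Subsingleton.elim i j
  rw [diagonal_apply_eq]

/-- Symmetric matrices of size at most one, as coordinate vectors. -/
noncomputable def symMatricesEquivOfLeOne {k : ℕ} (hk : k ≤ 1) :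
    symMatrices k ≃ₗ[ℝ] (Fin k → ℝ) × (Fin 0 → ℝ) where
  toFun X := (fun i => (X : Matrix (Fin k) (Fin k) ℝ) i i, 0)
  map_add' X Y := Prod.ext (by ext; simp) (Subsingleton.elim _ _)
  map_smul' c X := Prod.ext (by ext; simp) (Subsingleton.elim _ _)
  invFun z := ⟨diagonal z.1, isSymm_diagonal z.1⟩
  left_inv X := by
    have : Subsingleton (Fin k) := Fin.subsingleton_iff_le_one.2 hk
    exact Subtype.ext (eq_diagonal_of_subsingleton (X : Matrix (Fin k) (Fin k) ℝ)).symm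
  right_inv z := by
    ext i
    · simp
    · exact i.elim0

theorem isCanonicalStateSpace_of_le_one {d k : ℕ} {D : Set (RVec d)} (hk : k ≤ 1)
    (e : RVec d ≃ₗ[ℝ] symMatrices k)
    (hD : D = {x | (e x : Matrix (Fin k) (Fin k) ℝ).PosSemidef}) : IsCanonicalStateSpace D := by
  have : Subsingleton (Fin k) := Fin.subsingleton_iff_le_one.2 hk
  refine ⟨k, 0, e.trans (symMatricesEquivOfLeOne hk), ?_⟩
  rw [hD]
  ext x
  change PosSemidef _ ↔ ∀ i, 0 ≤ (e x : Matrix (Fin k) (Fin k) ℝ) i i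
  rw [eq_diagonal_of_subsingleton (e x : Matrix (Fin k) (Fin k) ℝ), posSemidef_diagonal_iff]
  simp

theorem exists_properCone_eq_posSemidef {d k : ℕ} (e : RVec d ≃ₗ[ℝ] symMatrices k) :
    ∃ C : ProperCone ℝ (RVec d),
      (C : Set (RVec d)) = {x | (e x : Matrix (Fin k) (Fin k) ℝ).PosSemidef} := by
  refine ⟨ProperCone.innerDual (range (quadVec e)), ?_⟩
  ext x
  rw [SetLike.mem_coe, ProperCone.mem_innerDual, mem_ofPred_eq]
  simp only [mem_range, forall_exists_index, forall_apply_eq_imp_iff, inner_quadVec]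
  refine ⟨fun h => .of_dotProduct_mulVec_nonneg ?_ fun f => by simpa using h f,
    fun h f => by simpa using h.dotProduct_mulVec_nonneg f⟩
  rw [IsHermitian, conjTranspose_eq_transpose_of_trivial]
  exact (e x).2

namespace AffineTriplet

theorem realLifetime_le_of_isMatrixStateSpace {d : ℕ} {D : Set (RVec d)} {Ω : Type*}
    [MeasurableSpace Ω] {Z : AffineProcess D Ω} (χ : AffineTriplet D)
    (hχ : χ.IsCharacteristicsOf Z) (hD : IsMatrixStateSpace χ) (u : CVec d) :
    χ.realLifetime (rePart u) ≤ χ.complexLifetime u := by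
  obtain ⟨k, e, hDe, x₀, hx₀, ha⟩ := hD
  rcases le_or_gt k 1 with hk | hk
  · exact realLifetime_le_of_isCanonicalStateSpace χ hχ (isCanonicalStateSpace_of_le_one hk e hDe) u
  obtain ⟨C, hCe⟩ := exists_properCone_eq_posSemidef e
  obtain rfl : D = C := hDe.trans hCe.symm
  have hC : ∀ x, x ∈ C ↔ (e x : Matrix (Fin k) (Fin k) ℝ).PosSemidef := fun x => by
    rw [← SetLike.mem_coe, hCe]; rfl
  rcases ha with ha | ha
  · have hspan := span_eq_top e hC
    have h0 := diffForm_zero_eq_zero e hχ hC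
    refine χ.realLifetime_le_of_diffForm_eq_zero hχ hspan
      (fun x hx => integrable_norm_trunc e hχ hC hk hx) (fun x hx v w => ?_) u
    -- The diffusion vanishes at 0 and x₀, hence at n x₀, and therefore at every x below n x₀ in the
    -- order of the cone.
    obtain ⟨n, hn⟩ := exists_nsmul_sub_mem e hC hx₀ x
    refine χ.diffForm_eq_zero_of_add hx hn (fun v => ?_) (fun v => h0 v v) v w
    have h1 := χ.diffForm_convex x₀ 0 v v n
    have h2 : χ.diffForm x₀ v v = 0 := by rw [diffForm_eq_dotProduct, ha]; simp
    rwa [smul_zero, add_zero, h0, h2, mul_zero, mul_zero, add_zero,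
      ← add_sub_cancel x ((n : ℝ) • x₀)] at h1
  · exact realLifetime_le_of_det_ne_zero e χ hχ hC hk ((hC _).2 hx₀.posSemidef) ha u

end AffineTriplet

end AffineMoments

theorem propositionc {d : ℕ} {D : Set (AffineMoments.RVec d)} {Ω : Type*} [MeasurableSpace Ω]
    (Z : AffineMoments.AffineProcess D Ω) (χ : AffineMoments.AffineTriplet D)
    (hχ : χ.IsCharacteristicsOf Z)
    (hD : AffineMoments.IsCanonicalStateSpace D ∨ AffineMoments.IsMatrixStateSpace χ)
    (u : AffineMoments.CVec d) (hu : u ∈ AffineMoments.strip (interior χ.expDomain)) :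
    χ.realLifetime (AffineMoments.rePart u) ≤ χ.complexLifetime u := by
  rcases hD with hD | hD
  · exact AffineMoments.realLifetime_le_of_isCanonicalStateSpace χ hχ hD u
  · exact χ.realLifetime_le_of_isMatrixStateSpace hχ hD u
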